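/- There are a single randomised algorithm and an absolute constant $C$ such that the following holds. Let $G=(V,E)$ be a connected (simple, finite) undirected graph with $n=|V|$ vertices and $m=|E|\ge 1$ edges, given by $n$, $m$ and a list of its edges, let $0<p_e<1$ be a failure probability for each edge $e\in E$, and let $p_{\max}=\max_{e\in E}p_e$. Run on $G$, the algorithm halts with probability $1$ and outputs a random set $S\subseteq E$ such that $(V,S)$ is connected, where each such set $S$ is output with probability exactly $$\frac{\mathrm{wt}(S)}{\sum_{S'\subseteq E,\ (V,S')\text{ connected}}\mathrm{wt}(S')},\qquad \mathrm{wt}(S)=\prod_{e\in S}(1-p_e)\prod_{e\in E\setminus S}p_e ,$$ and its expected running time is at most $$C\left(m+\frac{p_{\max}\,m\,n}{1-p_{\max}}\right),$$ that is, $O\!\left(m+\frac{p_{\max}mn}{1-p_{\max}}\right)$. Here an algorithm is a program of a random access machine, and its running time is the number of executed instructions. The machine has natural-number registers and arrays. A single instruction assigns a constant, copies a register, adds or subtracts one, reads or writes an array entry at the address held in a register, jumps (unconditionally, or if two registers compare as $=$ or $<$), or, given the index of an edge $e$, draws a fresh independent bit that is $1$ with probability $1-p_e$. -/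

import Mathlib

/-! ## Random access machines with coin tosses -/

/-- Instructions of a random access machine. The machine has registers `R 0, R 1, …` and arrays
`A 0, A 1, …`, all of whose entries are natural numbers; the registers, arrays and jump targets
that an instruction names are constants of the program. The only arithmetic is adding and
subtracting one, so no single instruction can build large numbers. -/
inductive Instr where
  /-- `R d := k` -/
  | const (d k : ℕ)
  /-- `R d := R s` -/
  | copy (d s : ℕ)
  /-- `R d := R d + 1` -/
  | succ (d : ℕ)
  /-- `R d := R d - 1` (and `0` if `R d = 0`) -/
  | pred (d : ℕ)
  /-- `R d := A a [R i]` -/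
  | load (d a i : ℕ)
  /-- `A a [R i] := R s` -/
  | store (a i s : ℕ)
  /-- go to instruction `l` -/
  | jump (l : ℕ)
  /-- go to instruction `l` if `R i = R j` -/
  | jumpEq (i j l : ℕ)
  /-- go to instruction `l` if `R i < R j` -/
  | jumpLt (i j l : ℕ)
  /-- toss a fresh coin of kind `R i` and put the outcome (`1` or `0`) into `R d` -/
  | toss (d i : ℕ)

/-- A program is a finite list of instructions, numbered from `0`. -/
abbrev Program := List Instr

/-- A configuration: the instruction pointer, the registers, and the arrays. -/
structure Config where
  pc : ℕ
  reg : ℕ → ℕ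
  arr : ℕ → ℕ → ℕ

namespace Config

/-- Proceed to the next instruction. -/
def next (c : Config) : Config := { c with pc := c.pc + 1 }

/-- Write `x` into register `d` and proceed to the next instruction. -/
def setReg (c : Config) (d x : ℕ) : Config :=
  { c with pc := c.pc + 1, reg := Function.update c.reg d x }

/-- Write `x` into entry `i` of array `a` and proceed to the next instruction. -/
def setArr (c : Config) (a i x : ℕ) : Config :=
  { c with pc := c.pc + 1, arr := Function.update c.arr a (Function.update (c.arr a) i x) }

/-- Continue at instruction `l`. -/
def goto (c : Config) (l : ℕ) : Config := { c with pc := l }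

/-- The machine has halted when the instruction pointer is outside the program. -/
def Halted (prog : Program) (c : Config) : Prop := prog.length ≤ c.pc

end Config

/-- The effect of one instruction; `coin i` is the law of a coin of kind `i`. -/
noncomputable def Instr.exec (coin : ℕ → PMF Bool) (c : Config) : Instr → PMF Config
  | .const d k => PMF.pure (c.setReg d k)
  | .copy d s => PMF.pure (c.setReg d (c.reg s))
  | .succ d => PMF.pure (c.setReg d (c.reg d + 1))
  | .pred d => PMF.pure (c.setReg d (c.reg d - 1))
  | .load d a i => PMF.pure (c.setReg d (c.arr a (c.reg i)))
  | .store a i s => PMF.pure (c.setArr a (c.reg i) (c.reg s))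
  | .jump l => PMF.pure (c.goto l)
  | .jumpEq i j l => PMF.pure (if c.reg i = c.reg j then c.goto l else c.next)
  | .jumpLt i j l => PMF.pure (if c.reg i < c.reg j then c.goto l else c.next)
  | .toss d i => (coin (c.reg i)).map fun b => c.setReg d (if b then 1 else 0)

/-- One step of the machine; a halted machine stays as it is. -/
noncomputable def Program.step (prog : Program) (coin : ℕ → PMF Bool) (c : Config) : PMF Config :=
  match prog[c.pc]? with
  | none => PMF.pure c
  | some I => I.exec coin c

/-- The law of the configuration after `t` steps from `c`; all coin tosses are independent. -/
noncomputable def Program.run (prog : Program) (coin : ℕ → PMF Bool) (c : Config) : ℕ → PMF Config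
  | 0 => PMF.pure c
  | t + 1 => (Program.run prog coin c t).bind (prog.step coin)

/-- The expected number of instructions executed before halting. If `T ∈ {0, 1, …, ∞}` is this
number, then the `t`-th summand is the probability of `T > t`, so that the sum is the expectation
of `T` (and is `∞` if the machine runs forever with positive probability). -/
noncomputable def Program.expectedTime (prog : Program) (coin : ℕ → PMF Bool) (c : Config) :
    ENNReal :=
  ∑' t : ℕ, (prog.run coin c t).toOuterMeasure {c' | ¬ c'.Halted prog}

/-- The probability that the machine halts in a configuration satisfying `Q`. The events
"halted within `t` steps, in a configuration satisfying `Q`" increase with `t`, so that the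
supremum is the probability of their union. -/
noncomputable def Program.haltProb (prog : Program) (coin : ℕ → PMF Bool) (c : Config)
    (Q : Config → Prop) : ENNReal :=
  ⨆ t : ℕ, (prog.run coin c t).toOuterMeasure {c' | c'.Halted prog ∧ Q c'}

/-- The law of a coin that shows `true` with probability `x`, for `x ∈ [0, 1]`. -/
noncomputable def coinLaw (x : ℝ) : PMF Bool :=
  PMF.bernoulli (min 1 x.toNNReal) (min_le_left _ _)

/-! ## Graphs as inputs, and sets of edges as outputs -/

/-- The `i`-th edge of a list of pairs of vertices, without its orientation. -/
def listedEdge {n m : ℕ} (ends : Fin m → Fin n × Fin n) (i : Fin m) : Sym2 (Fin n) :=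
  s((ends i).1, (ends i).2)

/-- `ends` lists every edge of `G` exactly once, in some order, each with an arbitrary order of
its two endpoints. -/
def IsEdgeList {n m : ℕ} (G : SimpleGraph (Fin n)) (ends : Fin m → Fin n × Fin n) : Prop :=
  Function.Injective (listedEdge ends) ∧ Set.range (listedEdge ends) = G.edgeSet

/-- The initial configuration: `n` and `m` are in the registers `0` and `1`, the endpoints of the
edges `0, …, m - 1` are in the arrays `0` and `1`, and everything else is `0`. -/
def inputConfig {n m : ℕ} (ends : Fin m → Fin n × Fin n) : Config where
  pc := 0
  reg r := if r = 0 then n else if r = 1 then m else 0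
  arr a i :=
    if h : i < m then
      if a = 0 then ((ends ⟨i, h⟩).1 : ℕ) else if a = 1 then ((ends ⟨i, h⟩).2 : ℕ) else 0
    else 0

/-- The coins at the disposal of the machine: a coin of kind `i < m` shows `true` with probability
`1 - p e`, where `e` is the `i`-th edge. (Coins of kind `i ≥ m` always show `false`.) -/
noncomputable def edgeCoin {n m : ℕ} (ends : Fin m → Fin n × Fin n) (p : Sym2 (Fin n) → ℝ)
    (i : ℕ) : PMF Bool :=
  if h : i < m then coinLaw (1 - p (listedEdge ends ⟨i, h⟩)) else PMF.pure false

/-- The set of edges that a configuration represents: those marked by a nonzero entry of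
array `2`. -/
def outputEdges {n m : ℕ} (ends : Fin m → Fin n × Fin n) (c : Config) : Finset (Sym2 (Fin n)) :=
  (Finset.univ.filter fun i : Fin m => c.arr 2 i ≠ 0).image (listedEdge ends)

/-! ## The target distribution -/

/-- The weight of the spanning subgraph of `G` with edge set `S`, when `p e` is the failure
probability of the edge `e`. -/
def subgraphWeight {V : Type*} [Fintype V] [DecidableEq V] (G : SimpleGraph V)
    [DecidableRel G.Adj] (p : Sym2 V → ℝ) (S : Finset (Sym2 V)) : ℝ :=
  (∏ e ∈ S, (1 - p e)) * ∏ e ∈ G.edgeFinset \ S, p e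

open Classical in
/-- The edge sets of the connected spanning subgraphs of `G`. -/
noncomputable def connectedSubgraphs {V : Type*} [Fintype V] [DecidableEq V] (G : SimpleGraph V)
    [DecidableRel G.Adj] : Finset (Finset (Sym2 V)) :=
  G.edgeFinset.powerset.filter fun S => (SimpleGraph.fromEdgeSet (S : Set (Sym2 V))).Connected

open Classical in
/-- The probability of `S` in the distribution on the connected spanning subgraphs of `G` that is
proportional to their weights. -/
noncomputable def connectedSubgraphLaw {V : Type*} [Fintype V] [DecidableEq V]
    (G : SimpleGraph V) [DecidableRel G.Adj] (p : Sym2 V → ℝ) (S : Finset (Sym2 V)) : ℝ :=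
  if S ∈ connectedSubgraphs G then
    subgraphWeight G p S / ∑ S' ∈ connectedSubgraphs G, subgraphWeight G p S'
  else 0

/-! ## Cluster popping on directed graphs with random arcs -/

/-! The sampler is cluster popping. Every edge is replaced by two opposite arcs, the arcs out of a
root are forbidden, and every other arc of the edge `e` is present independently with probability `1
- p e`. As long as some vertex does not reach the root, there is a minimal cluster: a strongly
connected set without the root that no present arc leaves. All arcs out of it are redrawn. When
every vertex reaches the root, a breadth-first search turns the arcs into a set of edges.

Law and running time come from one quantity. `value` is the best expected reward that a popping
strategy collects, with `κ` for each redrawn arc and `ψ` at the end. Distinct minimal clusters are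
disjoint, so pops commute, and by `value_le_pop` any of them may be assumed to be popped first. Now
consider the configurations in which all vertices reach a set `R` of sinks. If `v` is dropped from
`R`, then either all vertices reach the rest, or exactly one minimal cluster `C` contains `v` and
avoids the rest (`ind_reachesSet_eq`); the arcs out of `C` are independent of the event that all
vertices reach `R ∪ C`. Hence `reachProb` is harmonic for this recursion (`reachProb_eq`), and `gain
+ κ * trapCost` is subharmonic (`gain_le`, `trapCost_add`). The maximum principle `le_mul_reachProb`
compares the full set of sinks with `{root}` and gives `sum_value_le`: the expected value is at most
the mean of `ψ` over good configurations plus `κ * trapCost {root}`, divided by the probability of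
being good.

Here `trapCost {root}` is the mean number of arcs out of the minimal cluster when there is exactly
one. Such a configuration is repaired by adding an arc from the vertices that miss the root to those
that reach it and reversing all arcs among the vertices reachable from its tail. For a fixed tail
this is injective (`Repairable.eq_of_repair_eq`), and it loses a factor of at most `ρ = pmax / (1 -
pmax)`, so that the ratio is at most `|A| * |V| * ρ` (`Bidirected.trapCost_root_le`).

The machine finds minimal clusters by a path-based depth-first search. A last component without
unexplored arcs is a minimal cluster; it is popped, and the search resumes with the rest of the
path. The potential `pot` shows that the work is linear in the input size plus the number of redrawn
arcs. Starting with no arcs at all amounts to popping every vertex but the root once.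

The final breadth-first search runs from the root along reversed arcs and outputs, for each edge,
the state of the arc to the endpoint found first. The order depends only on these arcs
(`bfsOrder_congr`). The event that the output is `S` therefore prescribes one arc per edge, none of
them out of the root, and has probability `wt(S)` for connected `S` (`goodMean_earlier`). With `κ =
0` the value bounds the probability of every output event from above; applied to an event and its
complement, and with almost sure halting, this is an equality. With `ψ = 0` it bounds the time. -/

/-- A directed graph with a root, each of whose arcs is present with a law of its own. -/
structure CoinDigraph (V A : Type*) where
  tail : A → V
  head : A → V
  root : V
  coin : A → Bool → ENNReal
  coin_sum : ∀ a, coin a true + coin a false = 1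

namespace CoinDigraph

set_option linter.unusedSectionVars false

open scoped Classical in
/-- The indicator of a proposition. -/
noncomputable def ind (P : Prop) : ENNReal := if P then 1 else 0

theorem ind_true {P : Prop} (h : P) : ind P = 1 := if_pos h

theorem ind_false {P : Prop} (h : ¬ P) : ind P = 0 := if_neg h

theorem ind_congr {P Q : Prop} (h : P ↔ Q) : ind P = ind Q := by rw [propext h]

/-! ### Reachability and minimal clusters. -/

section

variable {V A : Type*} (N : CoinDigraph V A)

/-- There is a present arc from `x` to `y`. -/
def Step (ω : A → Bool) (x y : V) : Prop :=
  ∃ a, N.tail a = x ∧ N.head a = y ∧ ω a = true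

/-- There is a path of present arcs from `x` to `y`. -/
def Reach (ω : A → Bool) : V → V → Prop := Relation.ReflTransGen (N.Step ω)

/-- Every vertex has a path to a vertex in `R`. -/
def ReachesSet (ω : A → Bool) (R : Finset V) : Prop := ∀ x, ∃ y ∈ R, N.Reach ω x y

/-- No present arc leaves `C`. -/
def Closed (ω : A → Bool) (C : Finset V) : Prop :=
  ∀ a, N.tail a ∈ C → ω a = true → N.head a ∈ C

/-- A minimal cluster: a strongly connected set that no present arc leaves. -/
def IsTrap (ω : A → Bool) (C : Finset V) : Prop :=
  C.Nonempty ∧ N.Closed ω C ∧ ∀ x ∈ C, ∀ y ∈ C, N.Reach ω x y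

variable {N} {ω ω' : A → Bool} {C D R : Finset V} {x y : V}

theorem Closed.mem_of_reach (h : N.Closed ω C) (hx : x ∈ C) (hr : N.Reach ω x y) : y ∈ C := by
  induction hr with
  | refl => exact hx
  | tail _ hs ih => obtain ⟨a, rfl, rfl, ha⟩ := hs; exact h a ih ha

/-- A path from a vertex outside of `C` follows arcs out of vertices outside of `C` until it
meets `C`. -/
theorem Reach.until (hr : N.Reach ω x y) (hω : ∀ a, N.tail a ∉ C → ω a = ω' a) :
    N.Reach ω' x y ∨ ∃ z ∈ C, N.Reach ω' x z := by
  induction hr with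
  | refl => exact Or.inl .refl
  | @tail b c _ hs ih =>
    rcases ih with ih | ih
    · by_cases hb : b ∈ C
      · exact Or.inr ⟨b, hb, ih⟩
      · obtain ⟨a, rfl, rfl, ha⟩ := hs
        exact Or.inl (ih.tail ⟨a, rfl, rfl, by rw [← hω a hb, ha]⟩)
    · exact Or.inr ih

/-- A path to a vertex outside of a closed set avoids that set. -/
theorem Closed.reach_of_agree (h : N.Closed ω C) (hy : y ∉ C) (hr : N.Reach ω x y)
    (hω : ∀ a, N.tail a ∉ C → ω a = ω' a) : N.Reach ω' x y := by
  induction hr using Relation.ReflTransGen.head_induction_on with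
  | refl => exact .refl
  | @head b c hs hr ih =>
    have hb : b ∉ C := fun hb => hy (h.mem_of_reach hb (.head hs hr))
    obtain ⟨a, rfl, rfl, ha⟩ := hs
    exact .head ⟨a, rfl, rfl, by rw [← hω a hb, ha]⟩ ih

theorem Closed.of_agree (h : N.Closed ω C) (hω : ∀ a, N.tail a ∈ C → ω a = ω' a) :
    N.Closed ω' C := fun a ha h1 => h a ha (by rw [hω a ha, h1])

/-- Paths between members of a closed set never leave it, so only the arcs out of `C` matter. -/
theorem IsTrap.of_agree (h : N.IsTrap ω C) (hω : ∀ a, N.tail a ∈ C → ω a = ω' a) :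
    N.IsTrap ω' C := by
  refine ⟨h.1, h.2.1.of_agree hω, fun x hx y hy => ?_⟩
  have hr := h.2.2 x hx y hy
  induction hr with
  | refl => exact .refl
  | @tail b c hb hs ih =>
    have hbC := h.2.1.mem_of_reach hx hb
    obtain ⟨a, rfl, rfl, ha⟩ := hs
    exact (ih hbC).tail ⟨a, rfl, rfl, by rw [← hω a hbC, ha]⟩

theorem IsTrap.subset_of_mem (hC : N.IsTrap ω C) (hD : N.Closed ω D) (hx : x ∈ C) (hxD : x ∈ D) :
    C ⊆ D := fun y hy => hD.mem_of_reach hxD (hC.2.2 x hx y hy)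

/-- From a common vertex each set reaches all of itself, and the other set, being closed, contains
it; so the two would be equal. -/
theorem IsTrap.disjoint (hC : N.IsTrap ω C) (hD : N.IsTrap ω D) (h : C ≠ D) : Disjoint C D := by
  rw [Finset.disjoint_left]
  intro x hx hx'
  exact h ((hC.subset_of_mem hD.2.1 hx hx').antisymm (hD.subset_of_mem hC.2.1 hx' hx))

theorem IsTrap.not_reachesSet (hC : N.IsTrap ω C) (hR : Disjoint C R) : ¬ N.ReachesSet ω R := by
  intro h
  obtain ⟨x, hx⟩ := hC.1
  obtain ⟨y, hy, hr⟩ := h x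
  exact Finset.disjoint_left.1 hR (hC.2.1.mem_of_reach hx hr) hy

/-- A path may stop as soon as it meets `C ⊆ R`, so the arcs out of `C` are never needed. Together
with `IsTrap.of_agree` this is the source of independence. -/
theorem ReachesSet.of_agree (h : N.ReachesSet ω R) (hC : C ⊆ R)
    (hω : ∀ a, N.tail a ∉ C → ω a = ω' a) : N.ReachesSet ω' R := by
  intro x
  obtain ⟨y, hy, hr⟩ := h x
  rcases hr.until hω with h1 | ⟨z, hz, h1⟩
  · exact ⟨y, hy, h1⟩
  · exact ⟨z, hC hz, h1⟩

theorem ReachesSet.trans {R' : Finset V} (h : N.ReachesSet ω R)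
    (h' : ∀ x ∈ R, ∃ y ∈ R', N.Reach ω x y) : N.ReachesSet ω R' := by
  intro x
  obtain ⟨y, hy, hr⟩ := h x
  obtain ⟨z, hz, hr'⟩ := h' y hy
  exact ⟨z, hz, hr.trans hr'⟩

theorem ReachesSet.mono {R' : Finset V} (h : N.ReachesSet ω R) (h' : R ⊆ R') :
    N.ReachesSet ω R' := h.trans fun x hx => ⟨x, h' hx, .refl⟩

end

/-! ### Resampling, and the value of popping strategies. -/

section

open scoped Classical

variable {V A : Type*} [Fintype V] [Fintype A] (N : CoinDigraph V A)

/-- The arcs out of the vertices in `C`. -/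
noncomputable def out (C : Finset V) : Finset A := Finset.univ.filter fun a => N.tail a ∈ C

theorem mem_out {C : Finset V} {a : A} : a ∈ N.out C ↔ N.tail a ∈ C := by simp [out]

/-- The configuration `η` on the arcs in `X` and `ω` on the others. -/
noncomputable def mix (X : Finset A) (η ω : A → Bool) : A → Bool :=
  fun a => if a ∈ X then η a else ω a

theorem mix_of_mem {X : Finset A} {η ω : A → Bool} {a : A} (h : a ∈ X) : mix X η ω a = η a :=
  if_pos h

theorem mix_of_notMem {X : Finset A} {η ω : A → Bool} {a : A} (h : a ∉ X) :
    mix X η ω a = ω a := if_neg h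

/-- The probability of a configuration. -/
noncomputable def wt (ω : A → Bool) : ENNReal := ∏ a, N.coin a (ω a)

theorem sum_wt : ∑ ω, N.wt ω = 1 := by
  unfold wt
  rw [← Fintype.prod_sum (fun a b => N.coin a b)]
  simp [N.coin_sum]

theorem wt_le_one (ω : A → Bool) : N.wt ω ≤ 1 := by
  rw [← N.sum_wt]; exact Finset.single_le_sum (f := N.wt) (fun _ _ => zero_le) (Finset.mem_univ ω)

theorem wt_mul_wt (X : Finset A) (η ω : A → Bool) :
    N.wt (mix X η ω) * N.wt (mix X ω η) = N.wt ω * N.wt η := by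
  unfold wt
  rw [← Finset.prod_mul_distrib, ← Finset.prod_mul_distrib]
  refine Finset.prod_congr rfl fun a _ => ?_
  by_cases h : a ∈ X
  · rw [mix_of_mem h, mix_of_mem h, mul_comm]
  · rw [mix_of_notMem h, mix_of_notMem h]

/-- Exchanging the coordinates in `X` between two independent copies is an involution that preserves
the product law. -/
theorem sum_sum_mix (X : Finset A) (F : (A → Bool) → (A → Bool) → ENNReal) :
    ∑ ω, ∑ η, N.wt ω * N.wt η * F (mix X η ω) (mix X ω η) =
      ∑ ω, ∑ η, N.wt ω * N.wt η * F ω η := by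
  rw [← Fintype.sum_prod_type', ← Fintype.sum_prod_type']
  have inv : Function.Involutive
      (fun q : (A → Bool) × (A → Bool) => (mix X q.2 q.1, mix X q.1 q.2)) := by
    intro q
    ext a <;> by_cases h : a ∈ X <;> simp [mix, h]
  refine Fintype.sum_equiv inv.toPerm _ _ fun q => ?_
  simp [wt_mul_wt]

/-- Redrawing the arcs in `X` leaves the law of a random configuration unchanged. -/
theorem sum_sum_mix_left (X : Finset A) (F : (A → Bool) → ENNReal) :
    ∑ ω, N.wt ω * ∑ η, N.wt η * F (mix X η ω) = ∑ ω, N.wt ω * F ω := by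
  have h := N.sum_sum_mix X (fun ω _ => F ω)
  simp only [Finset.mul_sum, ← mul_assoc]
  rw [h]
  refine Finset.sum_congr rfl fun ω _ => ?_
  rw [← Finset.sum_mul, ← Finset.mul_sum, sum_wt, mul_one]

/-- Functions of disjoint sets of arcs are independent. -/
theorem sum_mul_indep (X : Finset A) (F G : (A → Bool) → ENNReal)
    (hF : ∀ ω ω', (∀ a ∈ X, ω a = ω' a) → F ω = F ω')
    (hG : ∀ ω ω', (∀ a ∉ X, ω a = ω' a) → G ω = G ω') :
    ∑ ω, N.wt ω * (F ω * G ω) = (∑ ω, N.wt ω * F ω) * ∑ ω, N.wt ω * G ω := by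
  rw [← N.sum_sum_mix_left X, mul_comm, Finset.sum_mul]
  refine Finset.sum_congr rfl fun ω _ => ?_
  rw [mul_assoc, Finset.mul_sum, Finset.mul_sum, Finset.mul_sum]
  refine Finset.sum_congr rfl fun η _ => ?_
  rw [hF (mix X η ω) η fun a ha => mix_of_mem ha, hG (mix X η ω) ω fun a ha => mix_of_notMem ha]
  ring

/-- The number of arcs out of `C`. -/
noncomputable def cost (C : Finset V) : ENNReal := (N.out C).card

/-- The largest expected total reward that some way of popping minimal clusters can collect in
`t` rounds: each popped cluster `C` yields `κ` times the number of arcs out of `C`, and a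
configuration `ω` in which all vertices reach the root yields `ψ ω` and ends the process. -/
noncomputable def value (κ : ENNReal) (ψ : (A → Bool) → ENNReal) : ℕ → (A → Bool) → ENNReal
  -- Without rounds left even a good configuration is worth nothing, so `ψ` is only collected from
  -- `t + 1` on.
  | 0, _ => 0
  | t + 1, ω =>
    if N.ReachesSet ω {N.root} then ψ ω
    else ⨆ (C : Finset V) (_ : N.IsTrap ω C ∧ N.root ∉ C),
      (κ * N.cost C + ∑ η, N.wt η * value κ ψ t (mix (N.out C) η ω))

variable {N} {κ : ENNReal} {ψ : (A → Bool) → ENNReal} {C : Finset V} {ω : A → Bool}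

theorem IsTrap.not_good (hC : N.IsTrap ω C) (hr : N.root ∉ C) : ¬ N.ReachesSet ω {N.root} :=
  hC.not_reachesSet (by simpa using hr)

theorem le_value_succ (t : ℕ) (hC : N.IsTrap ω C) (hr : N.root ∉ C) :
    κ * N.cost C + ∑ η, N.wt η * N.value κ ψ t (mix (N.out C) η ω) ≤
      N.value κ ψ (t + 1) ω := by
  rw [value, if_neg (hC.not_good hr)]
  exact le_iSup₂_of_le C ⟨hC, hr⟩ le_rfl

theorem value_good (t : ℕ) (h : N.ReachesSet ω {N.root}) : N.value κ ψ (t + 1) ω = ψ ω := by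
  rw [value, if_pos h]

theorem value_mono_succ (t : ℕ) (ω : A → Bool) : N.value κ ψ t ω ≤ N.value κ ψ (t + 1) ω := by
  induction t generalizing ω with
  | zero => simp [value]
  | succ t ih =>
    rw [value, value]
    split_ifs
    · rfl
    · refine iSup₂_mono fun C _ => ?_
      gcongr
      exact ih _

theorem value_mono : Monotone fun t => N.value κ ψ t ω :=
  monotone_nat_of_le_succ fun t => value_mono_succ t ω

/-- Finiteness is what later permits cancellation in the maximum principle. -/
theorem value_lt_top (hκ : κ ≠ ⊤) (hψ : ∀ ω, ψ ω ≠ ⊤) (t : ℕ) (ω : A → Bool) :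
    N.value κ ψ t ω < ⊤ := by
  induction t generalizing ω with
  | zero => simp [value]
  | succ t ih =>
    rw [value]
    split_ifs
    · exact (hψ ω).lt_top
    · have key : ∀ C : Finset V,
          κ * N.cost C + ∑ η, N.wt η * N.value κ ψ t (mix (N.out C) η ω) < ⊤ := by
        intro C
        refine ENNReal.add_lt_top.2 ⟨ENNReal.mul_lt_top hκ.lt_top (by simp [cost]), ?_⟩
        exact ENNReal.sum_lt_top.2 fun η _ =>
          ENNReal.mul_lt_top ((N.wt_le_one η).trans_lt ENNReal.one_lt_top) (ih _)
      refine lt_of_le_of_lt (iSup_le fun C => iSup_le fun _ => Finset.single_le_sum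
        (f := fun C => κ * N.cost C + ∑ η, N.wt η * N.value κ ψ t (mix (N.out C) η ω))
        (fun _ _ => zero_le) (Finset.mem_univ C)) ?_
      exact ENNReal.sum_lt_top.2 fun C _ => key C

theorem mix_comm_of_disjoint {X Y : Finset A} (h : Disjoint X Y) (η η' ω : A → Bool) :
    mix X η (mix Y η' ω) = mix Y η' (mix X η ω) := by
  ext a
  by_cases hX : a ∈ X
  · simp [mix, hX, Finset.disjoint_left.1 h hX]
  · simp [mix, hX]

theorem disjoint_out {C D : Finset V} (h : Disjoint C D) : Disjoint (N.out C) (N.out D) := by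
  rw [Finset.disjoint_left] at h ⊢
  intro a ha hb
  exact h (N.mem_out.1 ha) (N.mem_out.1 hb)

theorem IsTrap.mix_of_disjoint {D : Finset V} (hC : N.IsTrap ω C) (h : Disjoint C D)
    (η : A → Bool) : N.IsTrap (mix (N.out D) η ω) C :=
  hC.of_agree fun _ ha => (mix_of_notMem fun hb =>
    Finset.disjoint_left.1 h ha (N.mem_out.1 hb)).symm

/-- Popping any one minimal cluster first costs nothing: the order of pops is irrelevant. -/
theorem value_le_pop (t : ℕ) (hC : N.IsTrap ω C) (hr : N.root ∉ C) :
    N.value κ ψ t ω ≤ κ * N.cost C + ∑ η, N.wt η * N.value κ ψ t (mix (N.out C) η ω) := by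
  induction t generalizing ω with
  | zero => simp [value]
  | succ t ih =>
    rw [value, if_neg (hC.not_good hr)]
    refine iSup₂_le fun D hD => ?_
    by_cases hCD : C = D
    · subst hCD
      gcongr
      exact value_mono_succ t _
    -- Popping `D` leaves the disjoint set `C` a minimal cluster. The induction hypothesis pops `C`
    -- next; the two redraws commute, and `D` is then a legitimate second pop.
    · have hdis := hC.disjoint hD.1 hCD
      calc κ * N.cost D + ∑ η, N.wt η * N.value κ ψ t (mix (N.out D) η ω)
          ≤ κ * N.cost D + ∑ η, N.wt η * (κ * N.cost C + ∑ η', N.wt η' *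
              N.value κ ψ t (mix (N.out C) η' (mix (N.out D) η ω))) := by
            gcongr with η
            exact ih (hC.mix_of_disjoint hdis η)
        _ = κ * N.cost C + ∑ η', N.wt η' * (κ * N.cost D + ∑ η, N.wt η *
              N.value κ ψ t (mix (N.out D) η (mix (N.out C) η' ω))) := by
            simp only [mul_add, Finset.sum_add_distrib, ← Finset.sum_mul, sum_wt, one_mul]
            rw [add_left_comm]
            congr 2
            simp only [Finset.mul_sum]
            rw [Finset.sum_comm]
            refine Finset.sum_congr rfl fun η' _ => Finset.sum_congr rfl fun η _ => ?_
            rw [mix_comm_of_disjoint (disjoint_out hdis), mul_left_comm]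
        _ ≤ _ := by
            gcongr with η'
            exact le_value_succ t (hD.1.mix_of_disjoint hdis.symm η') hD.2

end

end CoinDigraph

/-! ### The recursion over sets of sinks and the maximum principle. -/

namespace CoinDigraph

set_option linter.unusedSectionVars false

section

open scoped Classical

variable {V A : Type*} [Fintype V] [Fintype A] (N : CoinDigraph V A)

/-- The probability that all vertices reach `R`. -/
noncomputable def reachProb (R : Finset V) : ENNReal := ∑ ω, N.wt ω * ind (N.ReachesSet ω R)

/-- The probability that `C` is a minimal cluster. -/
noncomputable def trapProb (C : Finset V) : ENNReal := ∑ ω, N.wt ω * ind (N.IsTrap ω C)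

/-- The sum over the sets `C` disjoint from `R` of the number of arcs out of `C` times the
probability that `C` is a minimal cluster and the only one disjoint from `R`. -/
noncomputable def trapCost (R : Finset V) : ENNReal :=
  ∑ C ∈ Finset.univ.filter (fun C => Disjoint C R), N.cost C * N.trapProb C * N.reachProb (R ∪ C)

/-- The sets containing `v` that avoid the rest of `R`. -/
noncomputable def trapsAt (v : V) (R : Finset V) : Finset (Finset V) :=
  Finset.univ.filter fun C => v ∈ C ∧ Disjoint C (R.erase v)

/-- The expected value over the configurations in which all vertices reach `R`. -/
noncomputable def gain (κ : ENNReal) (ψ : (A → Bool) → ENNReal) (t : ℕ) (R : Finset V) : ENNReal :=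
  ∑ ω, N.wt ω * (ind (N.ReachesSet ω R) * N.value κ ψ t ω)

variable {N} {κ : ENNReal} {ψ : (A → Bool) → ENNReal} {C R : Finset V} {ω ω' : A → Bool} {v : V}

/-- Suppose that all vertices reach `R` but not all reach `R.erase v`. Then `v` reaches nothing in
the rest of `R`, so every vertex reachable from `v` can meet `R` only at `v` and must lead back to
it: these vertices form a minimal cluster. It is the only one containing `v`. Conversely, a minimal
cluster through `v` funnels whatever reaches it into `v ∈ R`. -/
theorem ind_reachesSet_eq (hv : v ∈ R) (ω : A → Bool) :
    ind (N.ReachesSet ω R) = ind (N.ReachesSet ω (R.erase v)) +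
      ∑ C ∈ trapsAt v R, ind (N.IsTrap ω C) * ind (N.ReachesSet ω (R ∪ C)) := by
  by_cases hR' : N.ReachesSet ω (R.erase v)
  · rw [ind_true hR', ind_true (hR'.mono (Finset.erase_subset _ _)), Finset.sum_eq_zero, add_zero]
    intro C hC
    rw [trapsAt, Finset.mem_filter] at hC
    rw [ind_false, zero_mul]
    exact fun h => h.not_reachesSet hC.2.2 hR'
  rw [ind_false hR', zero_add]
  by_cases hR : N.ReachesSet ω R
  · rw [ind_true hR]
    set C₀ : Finset V := Finset.univ.filter fun x => N.Reach ω v x with hC₀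
    have hmem : ∀ x, x ∈ C₀ ↔ N.Reach ω v x := by simp [hC₀]
    have hdis : Disjoint C₀ (R.erase v) := by
      rw [Finset.disjoint_left]
      intro x hx hx'
      refine hR' (hR.trans fun y hy => ?_)
      by_cases hyv : y = v
      · exact ⟨x, hx', by rw [hyv]; exact (hmem x).1 hx⟩
      · exact ⟨y, Finset.mem_erase.2 ⟨hyv, hy⟩, .refl⟩
    have hclosed : N.Closed ω C₀ := fun a ha h => (hmem _).2 (((hmem _).1 ha).tail ⟨a, rfl, rfl, h⟩)
    have hback : ∀ x ∈ C₀, N.Reach ω x v := by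
      intro x hx
      obtain ⟨y, hy, hr⟩ := hR x
      by_cases hyv : y = v
      · rwa [← hyv]
      · exact absurd (Finset.mem_erase.2 ⟨hyv, hy⟩)
          (Finset.disjoint_left.1 hdis (hclosed.mem_of_reach hx hr))
    have hv₀ : v ∈ C₀ := (hmem v).2 .refl
    have htrap : N.IsTrap ω C₀ :=
      ⟨⟨v, hv₀⟩, hclosed, fun x hx y hy => (hback x hx).trans ((hmem y).1 hy)⟩
    rw [Finset.sum_eq_single_of_mem C₀
      (by rw [trapsAt, Finset.mem_filter]; exact ⟨Finset.mem_univ _, hv₀, hdis⟩),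
      ind_true htrap, ind_true (hR.mono Finset.subset_union_left), one_mul]
    intro C hC hne
    rw [ind_false, zero_mul]
    intro h
    rw [trapsAt, Finset.mem_filter] at hC
    exact Finset.disjoint_left.1 (h.disjoint htrap hne) hC.2.1 hv₀
  · rw [ind_false hR, Finset.sum_eq_zero]
    intro C hC
    rw [trapsAt, Finset.mem_filter] at hC
    by_cases h1 : N.IsTrap ω C
    · rw [ind_false (P := N.ReachesSet ω (R ∪ C)), mul_zero]
      refine fun h2 => hR (h2.trans fun y hy => ?_)
      rcases Finset.mem_union.1 hy with hy | hy
      · exact ⟨y, hy, .refl⟩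
      · exact ⟨v, hv, h1.2.2 y hy v hC.2.1⟩
    · rw [ind_false h1, zero_mul]

theorem isTrap_congr (h : ∀ a ∈ N.out C, ω a = ω' a) : N.IsTrap ω C ↔ N.IsTrap ω' C :=
  ⟨fun h1 => h1.of_agree fun a ha => h a (N.mem_out.2 ha),
    fun h1 => h1.of_agree fun a ha => (h a (N.mem_out.2 ha)).symm⟩

theorem reachesSet_congr (hC : C ⊆ R) (h : ∀ a ∉ N.out C, ω a = ω' a) :
    N.ReachesSet ω R ↔ N.ReachesSet ω' R :=
  ⟨fun h1 => h1.of_agree hC fun a ha => h a (by rwa [N.mem_out]),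
    fun h1 => h1.of_agree hC fun a ha => (h a (by rwa [N.mem_out])).symm⟩

/-- The arcs out of a minimal cluster are independent of the others. -/
theorem sum_trap_mul (hC : C ⊆ R) (F : (A → Bool) → ENNReal)
    (hF : ∀ ω ω', (∀ a ∉ N.out C, ω a = ω' a) → F ω = F ω') :
    ∑ ω, N.wt ω * (ind (N.IsTrap ω C) * ind (N.ReachesSet ω R) * F ω) =
      N.trapProb C * ∑ ω, N.wt ω * (ind (N.ReachesSet ω R) * F ω) := by
  simp only [mul_assoc (ind _)]
  refine N.sum_mul_indep (N.out C) (fun ω => ind (N.IsTrap ω C))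
    (fun ω => ind (N.ReachesSet ω R) * F ω) (fun ω ω' h => ?_) (fun ω ω' h => ?_)
  · exact ind_congr (isTrap_congr h)
  · rw [hF ω ω' h, ind_congr (reachesSet_congr hC h)]

/-- The expectation of `ind_reachesSet_eq`: each product of indicators factorises, since the first
reads only the arcs out of `C` and the second only the others. -/
theorem reachProb_eq (hv : v ∈ R) :
    N.reachProb R = N.reachProb (R.erase v) +
      ∑ C ∈ trapsAt v R, N.trapProb C * N.reachProb (R ∪ C) := by
  unfold reachProb
  simp only [ind_reachesSet_eq hv, mul_add, Finset.sum_add_distrib, Finset.mul_sum]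
  congr 1
  rw [Finset.sum_comm]
  refine Finset.sum_congr rfl fun C _ => ?_
  have := sum_trap_mul (N := N) (R := R ∪ C) (C := C) Finset.subset_union_right (fun _ => 1)
    (fun _ _ _ => rfl)
  simp only [mul_one] at this
  rw [this, Finset.mul_sum]

/-- In the term of `C` the configuration has `C` as a minimal cluster, which may be popped first.
The redraw does not affect the event that all vertices reach `R ∪ C` and leaves a configuration with
the original law, so what remains is the gain at `R ∪ C`. The root stays a sink, which keeps it out
of `C`. -/
theorem gain_le (t : ℕ) (hv : v ∈ R) (hr : N.root ∈ R.erase v) :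
    N.gain κ ψ t R ≤ N.gain κ ψ t (R.erase v) + ∑ C ∈ trapsAt v R,
      N.trapProb C * (κ * N.cost C * N.reachProb (R ∪ C) + N.gain κ ψ t (R ∪ C)) := by
  have h1 : N.gain κ ψ t R = N.gain κ ψ t (R.erase v) + ∑ C ∈ trapsAt v R, ∑ ω, N.wt ω *
      (ind (N.IsTrap ω C) * ind (N.ReachesSet ω (R ∪ C)) * N.value κ ψ t ω) := by
    unfold gain
    simp only [ind_reachesSet_eq hv, add_mul, mul_add, Finset.sum_add_distrib, Finset.sum_mul,
      Finset.mul_sum]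
    congr 1
    rw [Finset.sum_comm]
  rw [h1]
  refine add_le_add_right (Finset.sum_le_sum fun C hC => ?_) _
  rw [trapsAt, Finset.mem_filter] at hC
  have hrC : N.root ∉ C := fun h => Finset.disjoint_left.1 hC.2.2 h hr
  calc ∑ ω, N.wt ω * (ind (N.IsTrap ω C) * ind (N.ReachesSet ω (R ∪ C)) * N.value κ ψ t ω)
      ≤ ∑ ω, N.wt ω * (ind (N.IsTrap ω C) * ind (N.ReachesSet ω (R ∪ C)) *
        (κ * N.cost C + ∑ η, N.wt η * N.value κ ψ t (mix (N.out C) η ω))) := by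
        refine Finset.sum_le_sum fun ω _ => ?_
        by_cases h : N.IsTrap ω C
        · gcongr
          exact value_le_pop t h hrC
        · simp [ind_false h]
    _ = N.trapProb C * ∑ ω, N.wt ω * (ind (N.ReachesSet ω (R ∪ C)) *
        (κ * N.cost C + ∑ η, N.wt η * N.value κ ψ t (mix (N.out C) η ω))) := by
        refine sum_trap_mul Finset.subset_union_right (fun ω => κ * N.cost C +
          ∑ η, N.wt η * N.value κ ψ t (mix (N.out C) η ω)) fun ω ω' h => ?_
        congr 1
        refine Finset.sum_congr rfl fun η _ => ?_
        have : mix (N.out C) η ω = mix (N.out C) η ω' := by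
          ext a
          by_cases ha : a ∈ N.out C
          · rw [mix_of_mem ha, mix_of_mem ha]
          · rw [mix_of_notMem ha, mix_of_notMem ha, h a ha]
        rw [this]
    _ = _ := by
        congr 1
        simp only [mul_add, Finset.sum_add_distrib]
        congr 1
        · rw [reachProb, Finset.mul_sum]
          exact Finset.sum_congr rfl fun ω _ => by ring
        · rw [gain, ← N.sum_sum_mix_left (N.out C)
            (fun ω => ind (N.ReachesSet ω (R ∪ C)) * N.value κ ψ t ω)]
          refine Finset.sum_congr rfl fun ω _ => ?_
          rw [Finset.mul_sum]
          congr 1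
          refine Finset.sum_congr rfl fun η _ => ?_
          rw [ind_congr (reachesSet_congr (ω := mix (N.out C) η ω) (ω' := ω)
            Finset.subset_union_right fun a ha => mix_of_notMem ha)]
          ring

/-- `trapCost` is designed to absorb the pop costs in `gain_le`. The sets counted for `R.erase v`
are split by whether they contain `v`; those that do give the extra sum on the left. For the others,
`reachProb_eq` is expanded at `v` and the order of the two sets is exchanged. -/
theorem trapCost_add (hv : v ∈ R) :
    N.trapCost R + ∑ C ∈ trapsAt v R, N.trapProb C * (N.cost C * N.reachProb (R ∪ C)) =
      N.trapCost (R.erase v) + ∑ C ∈ trapsAt v R, N.trapProb C * N.trapCost (R ∪ C) := by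
  have h1 : N.trapCost (R.erase v) =
      ∑ C ∈ Finset.univ.filter (fun C => Disjoint C R),
        N.cost C * N.trapProb C * N.reachProb ((R ∪ C).erase v) +
      ∑ C ∈ trapsAt v R, N.trapProb C * (N.cost C * N.reachProb (R ∪ C)) := by
    rw [trapCost, ← Finset.sum_filter_add_sum_filter_not _ (fun C => v ∉ C),
      Finset.filter_filter, Finset.filter_filter]
    congr 1
    · refine Finset.sum_congr ?_ fun C hC => ?_
      · ext C
        simp only [Finset.mem_filter, Finset.mem_univ, true_and]
        rw [← Finset.insert_erase hv, Finset.disjoint_insert_right, Finset.insert_erase hv]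
        tauto
      · rw [Finset.mem_filter] at hC
        congr 2
        ext x
        simp only [Finset.mem_union, Finset.mem_erase]
        have : x ∈ C → x ≠ v := fun h1 h2 => Finset.disjoint_left.1 hC.2 h1 (h2 ▸ hv)
        tauto
    · refine Finset.sum_congr ?_ fun C hC => ?_
      · ext C
        simp only [trapsAt, Finset.mem_filter, Finset.mem_univ, true_and, not_not]
        tauto
      · rw [trapsAt, Finset.mem_filter] at hC
        have : R.erase v ∪ C = R ∪ C := by
          ext x
          simp only [Finset.mem_union, Finset.mem_erase]
          have : x = v → x ∈ C := fun h => h ▸ hC.2.1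
          tauto
        rw [this]
        ring
  have h2 : N.trapCost R =
      ∑ C ∈ Finset.univ.filter (fun C => Disjoint C R),
        N.cost C * N.trapProb C * N.reachProb ((R ∪ C).erase v) +
      ∑ D ∈ trapsAt v R, N.trapProb D * N.trapCost (R ∪ D) := by
    have h3 : N.trapCost R = ∑ C ∈ Finset.univ.filter (fun C => Disjoint C R),
        (N.cost C * N.trapProb C * N.reachProb ((R ∪ C).erase v) +
        ∑ D ∈ trapsAt v (R ∪ C), N.trapProb D * (N.cost C * N.trapProb C *
          N.reachProb (R ∪ C ∪ D))) := by
      refine Finset.sum_congr rfl fun C _ => ?_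
      rw [reachProb_eq (v := v) (Finset.mem_union_left C hv), mul_add, Finset.mul_sum]
      congr 1
      exact Finset.sum_congr rfl fun D _ => by ring
    rw [h3, Finset.sum_add_distrib]
    congr 1
    simp only [trapCost, Finset.mul_sum]
    -- Both sides run over the same pairs of disjoint sets `C` and `D`: `C` avoids `R`, while `D`
    -- contains `v` and avoids the rest of `R`.
    rw [Finset.sum_comm' (t' := trapsAt v R)
      (s' := fun D => Finset.univ.filter fun C => Disjoint C (R ∪ D))]
    · refine Finset.sum_congr rfl fun D _ => Finset.sum_congr rfl fun C _ => ?_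
      rw [Finset.union_right_comm]
    · intro C D
      simp only [trapsAt, Finset.mem_filter, Finset.mem_univ, true_and, Finset.disjoint_left,
        Finset.mem_erase, Finset.mem_union]
      constructor
      · rintro ⟨h1, h2, h3⟩
        refine ⟨fun x hx h => ?_, h2, fun x hx h => h3 hx ⟨h.1, Or.inl h.2⟩⟩
        rcases h with h | h
        · exact h1 hx h
        · exact h3 h ⟨fun e => h1 hx (e ▸ hv), Or.inr hx⟩
      · rintro ⟨h1, h2, h3⟩
        refine ⟨fun x hx h => h1 hx (Or.inl h), h2, fun x hx h => ?_⟩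
        rcases h.2 with h4 | h4
        · exact h3 hx ⟨h.1, h4⟩
        · exact h1 h4 (Or.inr hx)
  rw [h2, h1]
  ring

theorem reachProb_le_one (R : Finset V) : N.reachProb R ≤ 1 := by
  rw [← N.sum_wt]
  refine Finset.sum_le_sum fun ω _ => ?_
  refine mul_le_of_le_one_right' ?_
  unfold ind
  split_ifs <;> simp

theorem trapProb_le_one (C : Finset V) : N.trapProb C ≤ 1 := by
  rw [← N.sum_wt]
  refine Finset.sum_le_sum fun ω _ => ?_
  refine mul_le_of_le_one_right' ?_
  unfold ind
  split_ifs <;> simp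

theorem trapCost_ne_top (R : Finset V) : N.trapCost R ≠ ⊤ := by
  refine (ENNReal.sum_lt_top.2 fun C _ => ?_).ne
  exact ENNReal.mul_lt_top (ENNReal.mul_lt_top (by simp [cost])
    ((trapProb_le_one C).trans_lt ENNReal.one_lt_top))
    ((reachProb_le_one _).trans_lt ENNReal.one_lt_top)

/-- The maximum principle for the removal of vertices from the set of sinks. -/
theorem le_mul_reachProb (hpos : ∀ R, N.root ∈ R → N.reachProb R ≠ 0) (z : Finset V → ENNReal)
    (hz : ∀ R, z R ≠ ⊤)
    (hsub : ∀ R v, v ∈ R → N.root ∈ R.erase v →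
      z R ≤ z (R.erase v) + ∑ C ∈ trapsAt v R, N.trapProb C * z (R ∪ C))
    (R : Finset V) (hR : N.root ∈ R) :
    z R ≤ z {N.root} / N.reachProb {N.root} * N.reachProb R := by
  have hq : ∀ R, N.reachProb R ≠ ⊤ := fun R =>
    ((reachProb_le_one R).trans_lt ENNReal.one_lt_top).ne
  obtain ⟨R₀, hR₀, hmax⟩ := Finset.exists_max_image
    (Finset.univ.filter fun R : Finset V => N.root ∈ R) (fun R => z R / N.reachProb R)
    ⟨R, by simpa using hR⟩
  set ρ := z R₀ / N.reachProb R₀ with hρ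
  have hR₀' : N.root ∈ R₀ := by simpa using hR₀
  have hle : ∀ R, N.root ∈ R → z R ≤ ρ * N.reachProb R := by
    intro R hR
    rw [← ENNReal.div_le_iff (hpos R hR) (hq R)]
    exact hmax R (by simpa using hR)
  have hρtop : ρ ≠ ⊤ := ENNReal.div_ne_top (hz _) (hpos _ hR₀')
  -- A set of sinks at which the largest ratio `ρ` is attained passes this on to `R.erase v`: the
  -- sets `R ∪ C` have ratio at most `ρ`, `reachProb` satisfies the recursion with equality, and the
  -- common sum is finite and cancels. The descent ends at `{root}`.
  have key : ∀ k, ∀ R, R.card = k + 1 → N.root ∈ R → ρ * N.reachProb R ≤ z R →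
      ρ * N.reachProb {N.root} ≤ z {N.root} := by
    intro k
    induction k with
    | zero =>
      intro R hk hR h
      obtain ⟨x, rfl⟩ := Finset.card_eq_one.1 hk
      rw [Finset.mem_singleton] at hR
      rwa [hR]
    | succ k ih =>
      intro R hk hR h
      obtain ⟨v, hv⟩ : (R.erase N.root).Nonempty := by
        rw [← Finset.card_pos, Finset.card_erase_of_mem hR]
        omega
      have hvR := Finset.mem_of_mem_erase hv
      have hr : N.root ∈ R.erase v :=
        Finset.mem_erase.2 ⟨(Finset.ne_of_mem_erase hv).symm, hR⟩
      refine ih (R.erase v) (by rw [Finset.card_erase_of_mem hvR]; omega) hr ?_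
      have hsum : ∑ C ∈ trapsAt v R, N.trapProb C * z (R ∪ C) ≤
          ∑ C ∈ trapsAt v R, N.trapProb C * (ρ * N.reachProb (R ∪ C)) := by
        gcongr with C
        exact hle _ (Finset.mem_union_left _ hR)
      have h2 := (h.trans (hsub R v hvR hr)).trans (add_le_add_right hsum _)
      rw [reachProb_eq hvR, mul_add, Finset.mul_sum] at h2
      simp only [mul_left_comm ρ] at h2
      refine (ENNReal.add_le_add_iff_right ?_).1 h2
      refine (ENNReal.sum_lt_top.2 fun C _ => ?_).ne
      exact ENNReal.mul_lt_top ((trapProb_le_one C).trans_lt ENNReal.one_lt_top)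
        (ENNReal.mul_lt_top hρtop.lt_top (hq _).lt_top)
  have h3 := key (R₀.card - 1) R₀
    (by have := Finset.card_pos.2 ⟨_, hR₀'⟩; omega) hR₀'
    (by rw [hρ, ENNReal.div_mul_cancel (hpos _ hR₀') (hq _)])
  refine (hle R hR).trans ?_
  gcongr
  rwa [ENNReal.le_div_iff_mul_le (Or.inl (hpos _ (by simp))) (Or.inl (hq _))]

theorem trapCost_univ : N.trapCost Finset.univ = 0 := by
  refine Finset.sum_eq_zero fun C hC => ?_
  have hC' : C = ∅ := by
    have h := (Finset.mem_filter.1 hC).2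
    rw [Finset.disjoint_left] at h
    exact Finset.eq_empty_of_forall_notMem fun x hx => h hx (Finset.mem_univ x)
  subst hC'
  simp [cost, out]

theorem reachesSet_univ (ω : A → Bool) : N.ReachesSet ω Finset.univ :=
  fun x => ⟨x, Finset.mem_univ x, .refl⟩

theorem reachProb_univ : N.reachProb Finset.univ = 1 := by
  rw [← N.sum_wt]
  refine Finset.sum_congr rfl fun ω _ => ?_
  rw [ind_true (reachesSet_univ ω), mul_one]

/-- The expected value from a random configuration. -/
theorem sum_value_le (hpos : ∀ R, N.root ∈ R → N.reachProb R ≠ 0) (hκ : κ ≠ ⊤)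
    (hψ : ∀ ω, ψ ω ≠ ⊤) (t : ℕ) :
    ∑ ω, N.wt ω * N.value κ ψ t ω ≤
      (∑ ω, N.wt ω * (ind (N.ReachesSet ω {N.root}) * ψ ω) + κ * N.trapCost {N.root}) /
        N.reachProb {N.root} := by
  -- With one more round, good configurations are worth exactly `ψ`, also for `t = 0`. The principle
  -- then compares all vertices as sinks, where the gain is the whole expectation and `trapCost`
  -- vanishes, with `{root}`.
  refine (Finset.sum_le_sum fun ω _ => mul_le_mul_right (value_mono_succ t ω) _).trans ?_
  have h := le_mul_reachProb hpos (fun R => N.gain κ ψ (t + 1) R + κ * N.trapCost R) ?_ ?_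
    Finset.univ (Finset.mem_univ _)
  · rw [reachProb_univ, mul_one, trapCost_univ, mul_zero, add_zero] at h
    have h1 : N.gain κ ψ (t + 1) Finset.univ = ∑ ω, N.wt ω * N.value κ ψ (t + 1) ω := by
      refine Finset.sum_congr rfl fun ω _ => ?_
      rw [ind_true (reachesSet_univ ω), one_mul]
    have h2 : N.gain κ ψ (t + 1) {N.root} =
        ∑ ω, N.wt ω * (ind (N.ReachesSet ω {N.root}) * ψ ω) := by
      refine Finset.sum_congr rfl fun ω _ => ?_
      by_cases hg : N.ReachesSet ω {N.root}
      · rw [value_good t hg]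
      · rw [ind_false hg, zero_mul, zero_mul]
    rwa [h1, h2] at h
  · intro R
    refine ENNReal.add_ne_top.2 ⟨(ENNReal.sum_lt_top.2 fun ω _ => ?_).ne,
      ENNReal.mul_ne_top hκ (trapCost_ne_top R)⟩
    refine ENNReal.mul_lt_top ((N.wt_le_one ω).trans_lt ENNReal.one_lt_top)
      (ENNReal.mul_lt_top ?_ (value_lt_top hκ hψ _ _))
    unfold ind
    split_ifs <;> simp
  · intro R v hv hr
    have h1 := gain_le (κ := κ) (ψ := ψ) (N := N) (t + 1) hv hr
    have h2 := congrArg (κ * ·) (trapCost_add (N := N) hv)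
    simp only [mul_add, Finset.mul_sum] at h2
    set S := ∑ C ∈ trapsAt v R, N.trapProb C * N.gain κ ψ (t + 1) (R ∪ C)
    have h3 : ∑ C ∈ trapsAt v R, N.trapProb C *
          (κ * N.cost C * N.reachProb (R ∪ C) + N.gain κ ψ (t + 1) (R ∪ C)) =
        (∑ C ∈ trapsAt v R, κ * (N.trapProb C * (N.cost C * N.reachProb (R ∪ C)))) + S := by
      rw [← Finset.sum_add_distrib]
      exact Finset.sum_congr rfl fun C _ => by ring
    have h4 : ∑ C ∈ trapsAt v R, N.trapProb C *
          (N.gain κ ψ (t + 1) (R ∪ C) + κ * N.trapCost (R ∪ C)) =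
        S + ∑ C ∈ trapsAt v R, κ * (N.trapProb C * N.trapCost (R ∪ C)) := by
      rw [← Finset.sum_add_distrib]
      exact Finset.sum_congr rfl fun C _ => by ring
    rw [h3] at h1
    rw [h4]
    calc _ ≤ N.gain κ ψ (t + 1) (R.erase v) + ((∑ C ∈ trapsAt v R,
            κ * (N.trapProb C * (N.cost C * N.reachProb (R ∪ C)))) + S) + κ * N.trapCost R :=
          add_le_add_left h1 _
      _ = N.gain κ ψ (t + 1) (R.erase v) + S + (κ * N.trapCost R + ∑ C ∈ trapsAt v R,
            κ * (N.trapProb C * (N.cost C * N.reachProb (R ∪ C)))) := by ring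
      _ = _ := by rw [h2]; ring

end

end CoinDigraph

/-! ### Bidirected graphs: repairing configurations with one minimal cluster. -/

namespace CoinDigraph

set_option linter.unusedSectionVars false

/-- The arcs come in pairs of opposite arcs with equal laws, except that no arc out of the root is
ever present; every other arc may be present, and the graph is connected. -/
structure Bidirected {V A : Type*} (N : CoinDigraph V A) (rv : A → A) : Prop where
  rv_rv : ∀ a, rv (rv a) = a
  tail_rv : ∀ a, N.tail (rv a) = N.head a
  coin_rv : ∀ a, N.tail a ≠ N.root → N.head a ≠ N.root → N.coin (rv a) = N.coin a
  coin_root : ∀ a, N.tail a = N.root → N.coin a true = 0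
  coin_pos : ∀ a, N.tail a ≠ N.root → N.coin a true ≠ 0
  exists_arc : ∀ U : Finset V, U.Nonempty → N.root ∉ U → ∃ a, N.tail a ∈ U ∧ N.head a ∉ U

section

open scoped Classical

variable {V A : Type*} [Fintype V] [Fintype A] {N : CoinDigraph V A} {rv : A → A}

theorem Bidirected.head_rv (h : N.Bidirected rv) (a : A) : N.head (rv a) = N.tail a := by
  rw [← h.tail_rv, h.rv_rv]

/-- The configuration of all arcs that do not start at the root has positive weight. The vertices
that miss the root in it would be left by some arc, which is present. -/
theorem Bidirected.reachProb_ne_zero (h : N.Bidirected rv) (R : Finset V) (hR : N.root ∈ R) :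
    N.reachProb R ≠ 0 := by
  set ω : A → Bool := fun a => decide (N.tail a ≠ N.root) with hω
  have h1 : N.ReachesSet ω {N.root} := by
    set U : Finset V := Finset.univ.filter fun x => ¬ N.Reach ω x N.root with hU
    have hmem : ∀ x, x ∈ U ↔ ¬ N.Reach ω x N.root := by simp [hU]
    rcases U.eq_empty_or_nonempty with h0 | h0
    · intro x
      refine ⟨N.root, by simp, ?_⟩
      by_contra hx
      simpa [h0] using (hmem x).2 hx
    · obtain ⟨a, ha, ha'⟩ := h.exists_arc U h0 fun h1 => (hmem _).1 h1 .refl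
      rw [hmem] at ha ha'
      rw [not_not] at ha'
      have : N.tail a ≠ N.root := fun h1 => ha (by rw [h1]; exact .refl)
      exact absurd (ha'.head ⟨a, rfl, rfl, by simp [hω, this]⟩) ha
  have h2 : N.wt ω ≠ 0 := by
    refine Finset.prod_ne_zero_iff.2 fun a _ => ?_
    by_cases ha : N.tail a = N.root
    · have := N.coin_sum a
      rw [h.coin_root a ha, zero_add] at this
      simp [hω, ha, this]
    · simpa [hω, ha] using h.coin_pos a ha
  intro h0
  have h3 := (Finset.sum_eq_zero_iff.1 h0) ω (Finset.mem_univ _)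
  rw [ind_true (h1.mono (by simpa using hR)), mul_one] at h3
  exact h2 h3

/-- The vertices reachable from `u`. -/
noncomputable def reachable (N : CoinDigraph V A) (ω : A → Bool) (u : V) : Finset V :=
  Finset.univ.filter fun x => N.Reach ω u x

theorem mem_reachable {ω : A → Bool} {u x : V} : x ∈ N.reachable ω u ↔ N.Reach ω u x := by
  simp [reachable]

theorem closed_reachable (ω : A → Bool) (u : V) : N.Closed ω (N.reachable ω u) :=
  fun a ha h => mem_reachable.2 ((mem_reachable.1 ha).tail ⟨a, rfl, rfl, h⟩)

/-- Reverse the arcs inside `U`. -/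
noncomputable def swapIn (N : CoinDigraph V A) (rv : A → A) (U : Finset V) (a : A) : A :=
  if N.tail a ∈ U ∧ N.head a ∈ U then rv a else a

theorem Bidirected.swapIn_involutive (h : N.Bidirected rv) (U : Finset V) :
    Function.Involutive (N.swapIn rv U) := by
  intro a
  by_cases ha : N.tail a ∈ U ∧ N.head a ∈ U
  · have h1 : N.swapIn rv U a = rv a := if_pos ha
    have h2 : N.swapIn rv U (rv a) = rv (rv a) :=
      if_pos (by rw [h.tail_rv, h.head_rv]; exact ha.symm)
    rw [h1, h2, h.rv_rv]
  · have h1 : N.swapIn rv U a = a := if_neg ha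
    rw [h1, h1]

/-- The reversed pairs stay away from the root, where opposite arcs have different laws. -/
theorem Bidirected.wt_comp_swapIn (h : N.Bidirected rv) (U : Finset V) (hU : N.root ∉ U)
    (ω : A → Bool) : N.wt (ω ∘ N.swapIn rv U) = N.wt ω := by
  unfold wt
  rw [← Equiv.prod_comp (h.swapIn_involutive U).toPerm fun a => N.coin a (ω a)]
  refine Finset.prod_congr rfl fun a _ => ?_
  have : N.coin (N.swapIn rv U a) = N.coin a := by
    unfold swapIn
    split_ifs with ha
    · exact h.coin_rv a (fun h1 => hU (h1 ▸ ha.1)) (fun h1 => hU (h1 ▸ ha.2))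
    · rfl
  simp [this]

theorem wt_update_le (ρ : ENNReal) (ω : A → Bool) (a : A) (hω : ω a = false)
    (ha : N.coin a false ≤ ρ * N.coin a true) :
    N.wt ω ≤ ρ * N.wt (Function.update ω a true) := by
  unfold wt
  rw [← Finset.mul_prod_erase _ _ (Finset.mem_univ a),
    ← Finset.mul_prod_erase _ (fun b => N.coin b (Function.update ω a true b)) (Finset.mem_univ a),
    ← mul_assoc, hω, Function.update_self]
  refine mul_le_mul' ha (Finset.prod_le_prod' fun b hb => ?_)
  rw [Function.update_of_ne (Finset.ne_of_mem_erase hb)]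

/-- Add the arc `a` and reverse all arcs between vertices that were reachable from its tail. -/
noncomputable def repair (N : CoinDigraph V A) (rv : A → A) (ω : A → Bool) (a : A) : A → Bool :=
  Function.update (ω ∘ N.swapIn rv (N.reachable ω (N.tail a))) a true

/-- `c` is in the only minimal cluster of `ω`, and `a` is an absent arc to the vertices that reach
the root from those that do not. -/
structure Repairable (N : CoinDigraph V A) (c : V) (ω : A → Bool) (a : A) : Prop where
  lone : ¬ N.Reach ω c N.root
  reach : ∀ x, N.Reach ω x N.root ∨ N.Reach ω x c
  tail : ¬ N.Reach ω (N.tail a) N.root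
  head : N.Reach ω (N.head a) N.root

namespace Repairable

variable {c : V} {ω : A → Bool} {a : A}

theorem root_notMem (H : N.Repairable c ω a) : N.root ∉ N.reachable ω (N.tail a) :=
  fun h => H.tail (mem_reachable.1 h)

theorem tail_mem (_ : N.Repairable c ω a) : N.tail a ∈ N.reachable ω (N.tail a) :=
  mem_reachable.2 .refl

theorem head_notMem (H : N.Repairable c ω a) : N.head a ∉ N.reachable ω (N.tail a) :=
  fun h => H.tail ((mem_reachable.1 h).trans H.head)

theorem mem_reach (H : N.Repairable c ω a) {x : V} (hx : x ∈ N.reachable ω (N.tail a)) :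
    N.Reach ω x c :=
  (H.reach x).resolve_left fun h => H.tail ((mem_reachable.1 hx).trans h)

theorem mem (H : N.Repairable c ω a) : c ∈ N.reachable ω (N.tail a) :=
  mem_reachable.2 (H.mem_reach H.tail_mem)

theorem apply_eq_false (H : N.Repairable c ω a) : ω a = false := by
  by_contra h
  exact H.tail (H.head.head ⟨a, rfl, rfl, by simpa using h⟩)

theorem repair_of_tail_notMem (H : N.Repairable c ω a) {b : A}
    (hb : N.tail b ∉ N.reachable ω (N.tail a)) : N.repair rv ω a b = ω b := by
  have hab : b ≠ a := fun h => hb (by rw [h]; exact H.tail_mem)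
  rw [repair, Function.update_of_ne hab, Function.comp_apply, swapIn, if_neg fun h => hb h.1]

theorem repair_of_head_notMem {b : A} (hab : b ≠ a)
    (hb : N.head b ∉ N.reachable ω (N.tail a)) : N.repair rv ω a b = ω b := by
  rw [repair, Function.update_of_ne hab, Function.comp_apply, swapIn, if_neg fun h => hb h.2]

theorem repair_of_mem (H : N.Repairable c ω a) {b : A}
    (hb : N.tail b ∈ N.reachable ω (N.tail a)) (hb' : N.head b ∈ N.reachable ω (N.tail a)) :
    N.repair rv ω a b = ω (rv b) := by
  have hab : b ≠ a := fun h => by subst h; exact H.head_notMem hb'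
  rw [repair, Function.update_of_ne hab, Function.comp_apply, swapIn, if_pos ⟨hb, hb'⟩]

/-- The set reachable from the tail of `a` is closed, so the path stays inside it, where all arcs
have been reversed. The new arc is not needed, as its head lies outside. -/
theorem reach_reverse (h : N.Bidirected rv) (H : N.Repairable c ω a) {x y : V}
    (hx : x ∈ N.reachable ω (N.tail a)) (hr : N.Reach ω x y) :
    N.Reach (Function.update (N.repair rv ω a) a false) y x := by
  induction hr with
  | refl => exact .refl
  | @tail b d hxb hs ih =>
    have hb := (closed_reachable ω _).mem_of_reach hx hxb
    obtain ⟨e, rfl, rfl, he⟩ := hs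
    have hd := closed_reachable ω _ e hb he
    refine .head ⟨rv e, h.tail_rv e, h.head_rv e, ?_⟩ ih
    have hea : rv e ≠ a := by
      rintro rfl
      exact H.head_notMem (by rwa [h.head_rv])
    rw [Function.update_of_ne hea, H.repair_of_mem (by rwa [h.tail_rv]) (by rwa [h.head_rv]),
      h.rv_rv, he]

/-- After the reversal everything reachable from the tail of `a` leads back to that tail, and from
there over `a` to a vertex whose old path to the root avoids this closed set. All other vertices
keep their path to the root, or to `c`, at least until it enters the set. -/
theorem reachesSet_repair (h : N.Bidirected rv) (H : N.Repairable c ω a) :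
    N.ReachesSet (N.repair rv ω a) {N.root} := by
  have agree : ∀ b, N.tail b ∉ N.reachable ω (N.tail a) → ω b = N.repair rv ω a b :=
    fun b hb => (H.repair_of_tail_notMem hb).symm
  have h1 : ∀ x, N.Reach ω x N.root → N.Reach (N.repair rv ω a) x N.root := fun x hx =>
    (closed_reachable ω _).reach_of_agree H.root_notMem hx agree
  have h2 : ∀ z ∈ N.reachable ω (N.tail a), N.Reach (N.repair rv ω a) z N.root := by
    intro z hz
    have h3 := H.reach_reverse h H.tail_mem (mem_reachable.1 hz)
    have h4 : N.Reach (N.repair rv ω a) z (N.tail a) := by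
      refine Relation.ReflTransGen.mono (p := N.Step (N.repair rv ω a)) ?_ _ _ h3
      rintro x y ⟨b, hb, hb', hb''⟩
      refine ⟨b, hb, hb', ?_⟩
      by_cases hba : b = a
      · rw [hba, Function.update_self] at hb''
        simp at hb''
      · rwa [Function.update_of_ne hba] at hb''
    exact h4.trans ((h1 _ H.head).head ⟨a, rfl, rfl, by rw [repair, Function.update_self]⟩)
  intro x
  refine ⟨N.root, by simp, ?_⟩
  rcases H.reach x with hx | hx
  · exact h1 x hx
  · rcases hx.until agree with h3 | ⟨z, hz, h3⟩
    · exact h3.trans (h2 c H.mem)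
    · exact h3.trans (h2 z hz)

/-- The reversed region can be read off from the repaired configuration: without `a`, no arc leaves
it, and `c` reaches all of it. -/
theorem mem_reachable_iff (h : N.Bidirected rv) (H : N.Repairable c ω a) (x : V) :
    x ∈ N.reachable ω (N.tail a) ↔
      N.Reach (Function.update (N.repair rv ω a) a false) c x := by
  refine ⟨fun hx => H.reach_reverse h hx (H.mem_reach hx), fun hx => ?_⟩
  refine Closed.mem_of_reach (fun b hb hb' => ?_) H.mem hx
  by_cases hba : b = a
  · rw [hba, Function.update_self] at hb'
    simp at hb'
  · rw [Function.update_of_ne hba] at hb'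
    by_contra hd
    rw [repair_of_head_notMem hba hd] at hb'
    exact hd (closed_reachable ω _ b hb hb')

/-- If the added arcs agree, the reversed region is known by `mem_reachable_iff`, and the repair can
be undone. If they differ but have the same tail, then `a` is present in the repaired configuration
without having been added by the second repair, which forces its head into the second region. But
from this head a path that avoids the first region, and hence `a'`, leads to the root; the second
region cannot be left without `a'`, so it would contain the root. -/
theorem eq_of_repair_eq (h : N.Bidirected rv) {ω' : A → Bool} {a' : A}
    (H : N.Repairable c ω a) (H' : N.Repairable c ω' a') (ht : N.tail a = N.tail a')
    (he : N.repair rv ω a = N.repair rv ω' a') : ω = ω' := by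
  by_cases haa : a = a'
  · subst haa
    have hU : N.reachable ω (N.tail a) = N.reachable ω' (N.tail a) := by
      ext x
      rw [H.mem_reachable_iff h, H'.mem_reachable_iff h, he]
    ext b
    by_cases hb : N.tail b ∈ N.reachable ω (N.tail a) ∧ N.head b ∈ N.reachable ω (N.tail a)
    · have h1 := H.repair_of_mem (rv := rv) (b := rv b) (by rw [h.tail_rv]; exact hb.2)
        (by rw [h.head_rv]; exact hb.1)
      have h2 := H'.repair_of_mem (rv := rv) (b := rv b) (by rw [h.tail_rv, ← hU]; exact hb.2)
        (by rw [h.head_rv, ← hU]; exact hb.1)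
      rw [h.rv_rv] at h1 h2
      rw [← h1, ← h2, he]
    · by_cases hba : b = a
      · rw [hba, H.apply_eq_false, H'.apply_eq_false]
      · rcases not_and_or.1 hb with hb | hb
        · rw [← H.repair_of_tail_notMem (rv := rv) hb,
            ← H'.repair_of_tail_notMem (rv := rv) (by rwa [← hU]), he]
        · rw [← repair_of_head_notMem (rv := rv) hba hb,
            ← repair_of_head_notMem (rv := rv) (ω := ω') hba (by rwa [← hU]), he]
  · exfalso
    have hmem : N.head a ∈ N.reachable ω' (N.tail a') := by
      by_contra hd
      have h1 := repair_of_head_notMem (rv := rv) haa hd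
      rw [← he, repair, Function.update_self] at h1
      exact hd (closed_reachable ω' _ a (by rw [ht]; exact H'.tail_mem) h1.symm)
    set ζ : A → Bool := fun b =>
      if N.tail b ∈ N.reachable ω (N.tail a) then false else N.repair rv ω a b with hζ
    have hr : N.Reach ζ (N.head a) N.root := by
      refine (closed_reachable ω _).reach_of_agree H.root_notMem H.head fun b hb => ?_
      simp [hζ, hb, H.repair_of_tail_notMem hb]
    refine H'.root_notMem (Closed.mem_of_reach (fun b hb hb' => ?_) hmem hr)
    have hb1 : N.tail b ∉ N.reachable ω (N.tail a) := by
      intro h1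
      simp [hζ, h1] at hb'
    have hba : b ≠ a' := fun h1 => hb1 (by rw [h1, ← ht]; exact H.tail_mem)
    have hb2 : N.repair rv ω' a' b = true := by simpa [hζ, hb1, he] using hb'
    by_contra hd
    rw [repair_of_head_notMem hba hd] at hb2
    exact hd (closed_reachable ω' _ b hb hb2)

end Repairable

theorem Bidirected.exists_repairable (h : N.Bidirected rv) {c : V} {ω : A → Bool}
    (hc : ¬ N.Reach ω c N.root) (hr : ∀ x, N.Reach ω x N.root ∨ N.Reach ω x c) :
    ∃ a, N.Repairable c ω a := by
  obtain ⟨a, ha, ha'⟩ := h.exists_arc (Finset.univ.filter fun x => ¬ N.Reach ω x N.root)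
    ⟨c, by simpa using hc⟩ (by
      rw [Finset.mem_filter]
      exact fun h1 => h1.2 .refl)
  exact ⟨a, hc, hr, by simpa using ha, by simpa using ha'⟩

/-- One copy of the good event for each possible tail of the added arc: for a fixed tail the repair
is injective into the good configurations. -/
theorem Bidirected.sum_lone_le (h : N.Bidirected rv) (ρ : ENNReal)
    (hρ : ∀ a, N.tail a ≠ N.root → N.coin a false ≤ ρ * N.coin a true) (c : V) :
    ∑ ω, N.wt ω * ind (¬ N.Reach ω c N.root ∧ ∀ x, N.Reach ω x N.root ∨ N.Reach ω x c) ≤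
      Fintype.card V * (ρ * N.reachProb {N.root}) := by
  have hu : ∀ u : V, ∑ ω, N.wt ω * ind (∃ a, N.Repairable c ω a ∧ N.tail a = u) ≤
      ρ * N.reachProb {N.root} := by
    intro u
    set X : Finset (A → Bool) :=
      Finset.univ.filter fun ω => ∃ a, N.Repairable c ω a ∧ N.tail a = u with hX
    have hmem : ∀ ω, ω ∈ X ↔ ∃ a, N.Repairable c ω a ∧ N.tail a = u := by simp [hX]
    have hch : ∀ ω, ∃ ζ, ω ∈ X → ∃ a, N.Repairable c ω a ∧ N.tail a = u ∧ ζ = N.repair rv ω a := by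
      intro ω
      by_cases hω : ω ∈ X
      · obtain ⟨a, ha, ha'⟩ := (hmem ω).1 hω
        exact ⟨_, fun _ => ⟨a, ha, ha', rfl⟩⟩
      · exact ⟨ω, fun h1 => absurd h1 hω⟩
    choose φ hφ using hch
    calc ∑ ω, N.wt ω * ind (∃ a, N.Repairable c ω a ∧ N.tail a = u)
        = ∑ ω ∈ X, N.wt ω := by
          rw [hX, Finset.sum_filter]
          refine Finset.sum_congr rfl fun ω _ => ?_
          unfold ind
          split_ifs <;> simp
      _ ≤ ∑ ω ∈ X, ρ * (N.wt (φ ω) * ind (N.ReachesSet (φ ω) {N.root})) := by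
          refine Finset.sum_le_sum fun ω hω => ?_
          obtain ⟨a, ha, -, ha'⟩ := hφ ω hω
          -- The reversal preserves the weight; only turning on the absent arc `a` costs a factor
          -- `ρ`.
          rw [ha', ind_true (ha.reachesSet_repair h), mul_one, repair,
            ← h.wt_comp_swapIn _ ha.root_notMem ω]
          refine wt_update_le ρ _ a ?_ (hρ a fun h1 => ha.tail (by rw [h1]; exact .refl))
          rw [Function.comp_apply, swapIn, if_neg fun h1 => ha.head_notMem h1.2]
          exact ha.apply_eq_false
      _ = ρ * ∑ ζ ∈ X.image φ, N.wt ζ * ind (N.ReachesSet ζ {N.root}) := by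
          rw [Finset.mul_sum, Finset.sum_image]
          intro ω hω ω' hω' he
          obtain ⟨a, ha, hau, ha'⟩ := hφ ω hω
          obtain ⟨b, hb, hbu, hb'⟩ := hφ ω' hω'
          exact ha.eq_of_repair_eq h hb (by rw [hau, hbu]) (by rw [← ha', ← hb', he])
      _ ≤ ρ * N.reachProb {N.root} := by
          gcongr
          exact Finset.sum_le_sum_of_subset (Finset.subset_univ _)
  calc ∑ ω, N.wt ω * ind (¬ N.Reach ω c N.root ∧ ∀ x, N.Reach ω x N.root ∨ N.Reach ω x c)
      ≤ ∑ ω, N.wt ω * ∑ u, ind (∃ a, N.Repairable c ω a ∧ N.tail a = u) := by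
        gcongr with ω
        by_cases hω : ¬ N.Reach ω c N.root ∧ ∀ x, N.Reach ω x N.root ∨ N.Reach ω x c
        · obtain ⟨a, ha⟩ := h.exists_repairable hω.1 hω.2
          rw [ind_true hω]
          refine le_trans ?_ (Finset.single_le_sum
            (f := fun u => ind (∃ a, N.Repairable c ω a ∧ N.tail a = u))
            (fun _ _ => zero_le) (Finset.mem_univ (N.tail a)))
          rw [ind_true ⟨a, ha, rfl⟩]
        · rw [ind_false hω]
          exact zero_le
    _ = ∑ u, ∑ ω, N.wt ω * ind (∃ a, N.Repairable c ω a ∧ N.tail a = u) := by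
        simp only [Finset.mul_sum]
        rw [Finset.sum_comm]
    _ ≤ ∑ _u : V, ρ * N.reachProb {N.root} := Finset.sum_le_sum fun u _ => hu u
    _ = _ := by simp

/-- At most one set contributes, namely the vertices reachable from `c`. -/
theorem sum_ind_trap_le (ω : A → Bool) (c : V) :
    ∑ C ∈ Finset.univ.filter (fun C => Disjoint C {N.root}), ind (c ∈ C) *
        (ind (N.IsTrap ω C) * ind (N.ReachesSet ω ({N.root} ∪ C))) ≤
      ind (¬ N.Reach ω c N.root ∧ ∀ x, N.Reach ω x N.root ∨ N.Reach ω x c) := by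
  refine (Finset.sum_le_sum (g := fun C => if C = N.reachable ω c then
    ind (¬ N.Reach ω c N.root ∧ ∀ x, N.Reach ω x N.root ∨ N.Reach ω x c) else 0)
    fun C hC => ?_).trans ?_
  · by_cases h1 : c ∈ C
    swap
    · simp [ind_false h1]
    by_cases h2 : N.IsTrap ω C
    swap
    · simp [ind_false h2]
    by_cases h3 : N.ReachesSet ω ({N.root} ∪ C)
    swap
    · rw [ind_false h3, mul_zero, mul_zero]
      exact zero_le
    have hr : N.root ∉ C := by simpa using (Finset.mem_filter.1 hC).2
    have h4 : C = N.reachable ω c :=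
      Finset.Subset.antisymm (fun x hx => mem_reachable.2 (h2.2.2 c h1 x hx))
        fun x hx => h2.2.1.mem_of_reach h1 (mem_reachable.1 hx)
    have h5 : ¬ N.Reach ω c N.root ∧ ∀ x, N.Reach ω x N.root ∨ N.Reach ω x c := by
      refine ⟨fun h => hr (h2.2.1.mem_of_reach h1 h), fun x => ?_⟩
      obtain ⟨y, hy, hxy⟩ := h3 x
      rcases Finset.mem_union.1 hy with hy | hy
      · rw [Finset.mem_singleton] at hy
        exact Or.inl (hy ▸ hxy)
      · exact Or.inr (hxy.trans (h2.2.2 y hy c h1))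
    rw [if_pos h4, ind_true h1, ind_true h2, ind_true h3, ind_true h5]
    simp
  · rw [Finset.sum_ite_eq']
    split_ifs
    · rfl
    · exact zero_le

/-- `cost C` counts the arcs with tail in `C`. Exchanging sums turns `trapCost` into a sum over the
arcs of the probability that the tail lies in the only minimal cluster that avoids the root. -/
theorem Bidirected.trapCost_root_le (h : N.Bidirected rv) (ρ : ENNReal)
    (hρ : ∀ a, N.tail a ≠ N.root → N.coin a false ≤ ρ * N.coin a true) :
    N.trapCost {N.root} ≤
      Fintype.card A * (Fintype.card V * (ρ * N.reachProb {N.root})) := by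
  have h1 : N.trapCost {N.root} = ∑ a, ∑ ω, N.wt ω *
      ∑ C ∈ Finset.univ.filter (fun C => Disjoint C {N.root}), ind (N.tail a ∈ C) *
        (ind (N.IsTrap ω C) * ind (N.ReachesSet ω ({N.root} ∪ C))) := by
    simp only [Finset.mul_sum]
    rw [Finset.sum_congr rfl fun a _ => Finset.sum_comm, Finset.sum_comm]
    refine Finset.sum_congr rfl fun C _ => ?_
    have h2 := sum_trap_mul (N := N) (C := C) (R := {N.root} ∪ C) Finset.subset_union_right
      (fun _ => 1) (fun _ _ _ => rfl)
    simp only [mul_one] at h2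
    have h3 : N.cost C = ∑ a, ind (N.tail a ∈ C) := by
      simp only [cost, out, ind, Finset.card_filter]
      push_cast
      exact Finset.sum_congr rfl fun a _ => by split_ifs <;> rfl
    rw [mul_assoc, reachProb, ← h2, h3, Finset.sum_mul]
    refine Finset.sum_congr rfl fun a _ => ?_
    rw [Finset.mul_sum]
    exact Finset.sum_congr rfl fun ω _ => by ring
  rw [h1]
  calc _ ≤ ∑ _a : A, (Fintype.card V : ENNReal) * (ρ * N.reachProb {N.root}) := by
        refine Finset.sum_le_sum fun a _ => le_trans ?_ (h.sum_lone_le ρ hρ (N.tail a))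
        gcongr with ω
        exact sum_ind_trap_le ω (N.tail a)
    _ = _ := by simp

variable {κ : ENNReal} {ψ : (A → Bool) → ENNReal}

/-- Without any arcs, all vertices but the root are popped once. -/
theorem value_false_le (t : ℕ) (D : Finset V) (hD : N.root ∉ D) :
    N.value κ ψ t (fun _ => false) ≤
      κ * N.cost D + ∑ η, N.wt η * N.value κ ψ t (mix (N.out D) η fun _ => false) := by
  induction D using Finset.induction_on with
  | empty =>
    have : N.out ∅ = ∅ := by ext a; simp [mem_out]
    have h2 : ∀ η : A → Bool, mix ∅ η (fun _ => false) = fun _ => false := by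
      intro η; ext a; simp [mix]
    simp [this, h2, cost, ← Finset.sum_mul, sum_wt]
  | insert v D hv ih =>
    refine (ih fun h => hD (Finset.mem_insert_of_mem h)).trans ?_
    have htrap : ∀ η, N.IsTrap (mix (N.out D) η fun _ => false) {v} := by
      intro η
      -- The vertex `v` has not been popped yet, so no arc leaves it and `{v}` is a minimal cluster.
      refine ⟨by simp, fun a ha h => ?_, fun x hx y hy => ?_⟩
      · rw [Finset.mem_singleton] at ha
        rw [mix_of_notMem (by rwa [mem_out, ha])] at h
        simp at h
      · rw [Finset.mem_singleton] at hx hy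
        rw [hx, hy]
        exact .refl
    have hr : N.root ∉ ({v} : Finset V) := by
      rw [Finset.mem_singleton]
      exact fun h => hD (Finset.mem_insert.2 (Or.inl h))
    have hcost : N.cost (insert v D) = N.cost D + N.cost {v} := by
      have : N.out (insert v D) = N.out D ∪ N.out {v} := by
        ext a; simp [mem_out, or_comm]
      rw [cost, this, Finset.card_union_of_disjoint
        (disjoint_out (Finset.disjoint_singleton_right.2 hv))]
      simp [cost]
    calc _ ≤ κ * N.cost D + ∑ η, N.wt η * (κ * N.cost {v} + ∑ η', N.wt η' *
            N.value κ ψ t (mix (N.out {v}) η' (mix (N.out D) η fun _ => false))) := by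
          gcongr with η
          exact value_le_pop t (htrap η) hr
      _ = κ * N.cost (insert v D) + ∑ η, N.wt η * ∑ η', N.wt η' *
            N.value κ ψ t (mix (N.out (insert v D)) (mix (N.out {v}) η' η) fun _ => false) := by
          simp only [mul_add, Finset.sum_add_distrib, ← Finset.sum_mul, sum_wt, one_mul]
          rw [hcost, mul_add, add_assoc]
          congr 2
          refine Finset.sum_congr rfl fun η _ => ?_
          congr 1
          refine Finset.sum_congr rfl fun η' _ => ?_
          congr 2
          ext a
          by_cases h1 : N.tail a = v <;> by_cases h2 : N.tail a ∈ D <;> simp [mix, mem_out, h1, h2]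
      _ = _ := by
          rw [N.sum_sum_mix_left (N.out {v})
            (fun η => N.value κ ψ t (mix (N.out (insert v D)) η fun _ => false))]

theorem Bidirected.value_false_le (h : N.Bidirected rv) (ρ : ENNReal)
    (hρ : ∀ a, N.tail a ≠ N.root → N.coin a false ≤ ρ * N.coin a true) (hκ : κ ≠ ⊤)
    (hψ : ∀ ω, ψ ω ≠ ⊤) (t : ℕ) :
    N.value κ ψ t (fun _ => false) ≤
      κ * Fintype.card A + κ * (Fintype.card A * (Fintype.card V * ρ)) +
        (∑ ω, N.wt ω * (ind (N.ReachesSet ω {N.root}) * ψ ω)) / N.reachProb {N.root} := by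
  have hq : N.reachProb {N.root} ≠ 0 := h.reachProb_ne_zero _ (by simp)
  have hq' : N.reachProb {N.root} ≠ ⊤ := ((reachProb_le_one _).trans_lt ENNReal.one_lt_top).ne
  refine (CoinDigraph.value_false_le t (Finset.univ.erase N.root) (by simp)).trans ?_
  rw [add_assoc]
  refine add_le_add ?_ ?_
  · gcongr
    simpa [cost] using Finset.card_le_univ _
  -- Redrawing everything except the arcs out of the root gives a random configuration, because
  -- those arcs are almost surely absent.
  have h1 : ∑ η, N.wt η * N.value κ ψ t
      (mix (N.out (Finset.univ.erase N.root)) η fun _ => false) =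
      ∑ η, N.wt η * N.value κ ψ t η := by
    refine Finset.sum_congr rfl fun η _ => ?_
    by_cases hη : ∀ a, N.tail a = N.root → η a = false
    · congr 2
      ext a
      by_cases ha : N.tail a = N.root
      · simp [mix, mem_out, ha, hη a ha]
      · simp [mix, mem_out, ha]
    · push Not at hη
      obtain ⟨a, ha, ha'⟩ := hη
      have : N.wt η = 0 := Finset.prod_eq_zero (Finset.mem_univ a)
        (by rw [Bool.eq_true_of_not_eq_false ha', h.coin_root a ha])
      rw [this, zero_mul, zero_mul]
  rw [h1]
  refine (sum_value_le h.reachProb_ne_zero hκ hψ t).trans ?_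
  rw [ENNReal.add_div, add_comm]
  gcongr
  rw [ENNReal.div_le_iff hq hq', mul_assoc]
  gcongr
  refine (h.trapCost_root_le ρ hρ).trans (le_of_eq ?_)
  ring

end

end CoinDigraph

/-! ## Expected rewards of programs -/

namespace Program

section

variable (prog : Program) (coin : ℕ → PMF Bool) (τ : ENNReal) (r : Config → ENNReal)

open scoped Classical in
/-- The expected reward collected in `N` steps, when each instruction yields `τ` and halting in the
configuration `c` yields `r c`. -/
noncomputable def reward : ℕ → Config → ENNReal
  | 0, c => if c.Halted prog then r c else 0
  | N + 1, c =>
    if c.Halted prog then r c else τ + ∑' c', prog.step coin c c' * reward N c'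

variable {prog coin τ r} {c : Config}

theorem reward_of_halted (N : ℕ) (h : c.Halted prog) : prog.reward coin τ r N c = r c := by
  cases N <;> rw [reward, if_pos h]

theorem reward_succ (N : ℕ) (h : ¬ c.Halted prog) :
    prog.reward coin τ r (N + 1) c =
      τ + ∑' c', prog.step coin c c' * prog.reward coin τ r N c' := by
  rw [reward, if_neg h]

theorem reward_le_succ (N : ℕ) (c : Config) :
    prog.reward coin τ r N c ≤ prog.reward coin τ r (N + 1) c := by
  induction N generalizing c with
  | zero =>
    by_cases h : c.Halted prog
    · rw [reward_of_halted _ h, reward_of_halted _ h]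
    · rw [reward, if_neg h]; exact zero_le
  | succ N ih =>
    by_cases h : c.Halted prog
    · rw [reward_of_halted _ h, reward_of_halted _ h]
    · rw [reward_succ _ h, reward_succ _ h]
      gcongr with c'
      exact ih c'

theorem run_succ (c : Config) (t : ℕ) :
    prog.run coin c (t + 1) = (prog.step coin c).bind fun c' => prog.run coin c' t := by
  induction t with
  | zero => simp [run]
  | succ t ih => rw [run, ih, PMF.bind_bind]; rfl

theorem step_of_halted (h : c.Halted prog) : prog.step coin c = PMF.pure c := by
  rw [step, List.getElem?_eq_none h]

theorem run_of_halted (h : c.Halted prog) (t : ℕ) : prog.run coin c t = PMF.pure c := by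
  induction t with
  | zero => rfl
  | succ t ih => rw [run, ih, PMF.pure_bind, step_of_halted h]

theorem toOuterMeasure_pure_le_one (μ : PMF Config) (s : Set Config) : μ.toOuterMeasure s ≤ 1 := by
  rw [PMF.toOuterMeasure_apply, ← μ.tsum_coe]
  exact ENNReal.tsum_le_tsum fun c => Set.indicator_le_self _ _ _

/-- With `τ = 1` and `r = 0` the reward counts executed instructions, so bounds on `reward` that are
uniform in the number of steps bound the expected time. -/
theorem sum_run_le_reward (T : ℕ) (c : Config) :
    ∑ t ∈ Finset.range T, (prog.run coin c t).toOuterMeasure {c' | ¬ c'.Halted prog} ≤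
      prog.reward coin 1 0 T c := by
  induction T generalizing c with
  | zero => simp
  | succ T ih =>
    by_cases h : c.Halted prog
    · rw [Finset.sum_eq_zero]
      · exact zero_le
      · intro t _
        rw [run_of_halted h, PMF.toOuterMeasure_pure_apply, if_neg (by simpa using h)]
    · rw [Finset.sum_range_succ', reward_succ _ h, add_comm]
      refine add_le_add (toOuterMeasure_pure_le_one _ _) ?_
      simp only [run_succ, PMF.toOuterMeasure_bind_apply]
      rw [← Summable.tsum_finsetSum fun _ _ => ENNReal.summable]
      refine ENNReal.tsum_le_tsum fun c' => ?_
      rw [← Finset.mul_sum]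
      gcongr
      exact ih c'

theorem expectedTime_le (B : ENNReal) (h : ∀ N, prog.reward coin 1 0 N c ≤ B) :
    prog.expectedTime coin c ≤ B := by
  rw [expectedTime, ENNReal.tsum_eq_iSup_nat]
  exact iSup_le fun T => (sum_run_le_reward T c).trans (h T)

theorem run_le_reward (Q : Config → Prop) (t : ℕ) (c : Config) :
    (prog.run coin c t).toOuterMeasure {c' | c'.Halted prog ∧ Q c'} ≤
      prog.reward coin 0 (fun c => CoinDigraph.ind (Q c)) t c := by
  induction t generalizing c with
  | zero =>
    rw [run, PMF.toOuterMeasure_pure_apply, reward]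
    by_cases h : c.Halted prog
    · by_cases hQ : Q c <;> simp [h, hQ, CoinDigraph.ind]
    · simp [h]
  | succ t ih =>
    by_cases h : c.Halted prog
    · rw [run_of_halted h, reward_of_halted _ h, PMF.toOuterMeasure_pure_apply]
      by_cases hQ : Q c <;> simp [h, hQ, CoinDigraph.ind]
    · rw [run_succ, reward_succ _ h, zero_add, PMF.toOuterMeasure_bind_apply]
      refine ENNReal.tsum_le_tsum fun c' => ?_
      gcongr
      exact ih c'

theorem haltProb_le (Q : Config → Prop) (B : ENNReal)
    (h : ∀ N, prog.reward coin 0 (fun c => CoinDigraph.ind (Q c)) N c ≤ B) :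
    prog.haltProb coin c Q ≤ B :=
  iSup_le fun t => (run_le_reward Q t c).trans (h t)

/-- A program whose expected running time is finite halts. -/
theorem one_le_haltProb_add (Q : Config → Prop) (hT : prog.expectedTime coin c ≠ ⊤) :
    1 ≤ prog.haltProb coin c Q + prog.haltProb coin c fun c => ¬ Q c := by
  -- The expected time is the sum of the probabilities of still running, so these tend to zero.
  have h0 := ENNReal.tendsto_atTop_zero_of_tsum_ne_top hT
  refine ge_of_tendsto (by simpa using (tendsto_const_nhds (x := prog.haltProb coin c Q +
    prog.haltProb coin c fun c => ¬ Q c)).add h0) (Filter.Eventually.of_forall fun t => ?_)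
  have h1 : (prog.run coin c t).toOuterMeasure Set.univ = 1 := by
    rw [PMF.toOuterMeasure_apply]
    simp
  rw [← h1]
  refine (MeasureTheory.measure_mono (t := ({c' | c'.Halted prog ∧ Q c'} ∪
    {c' | c'.Halted prog ∧ ¬ Q c'}) ∪ {c' | ¬ c'.Halted prog}) fun c' _ => ?_).trans ?_
  · simp only [Set.mem_union, Set.mem_ofPred_eq]
    tauto
  · refine (MeasureTheory.measure_union_le _ _).trans (add_le_add_left ?_ _)
    refine (MeasureTheory.measure_union_le _ _).trans (add_le_add ?_ ?_)
    · exact le_iSup (fun t => (prog.run coin c t).toOuterMeasure {c' | c'.Halted prog ∧ Q c'}) t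
    · exact le_iSup (fun t => (prog.run coin c t).toOuterMeasure {c' | c'.Halted prog ∧ ¬ Q c'}) t

theorem tsum_pure_mul (c : Config) (f : Config → ENNReal) :
    ∑' c', (PMF.pure c) c' * f c' = f c := by
  rw [tsum_eq_single c fun c' h => by simp [PMF.pure_apply, h]]
  simp

theorem tsum_map_mul (μ : PMF Bool) (g : Bool → Config) (f : Config → ENNReal) :
    ∑' c', (μ.map g) c' * f c' = μ true * f (g true) + μ false * f (g false) := by
  rw [PMF.map]
  simp only [PMF.bind_apply, Function.comp_apply, ← ENNReal.tsum_mul_right]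
  rw [ENNReal.tsum_comm]
  simp only [mul_assoc, ENNReal.tsum_mul_left, tsum_pure_mul]
  rw [tsum_fintype]
  simp

theorem reward_eq_of_pure (N : ℕ) {c' : Config} {I : Instr} (hI : prog[c.pc]? = some I)
    (h : ∀ coin, I.exec coin c = PMF.pure c') :
    prog.reward coin τ r (N + 1) c = τ + prog.reward coin τ r N c' := by
  have hh : ¬ c.Halted prog := by
    intro h1
    rw [List.getElem?_eq_none h1] at hI
    cases hI
  rw [reward_succ _ hh, step, hI]
  simp only [h]
  rw [tsum_pure_mul]

theorem reward_toss_le (N : ℕ) {d i : ℕ} (hI : prog[c.pc]? = some (.toss d i)) :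
    prog.reward coin τ r N c ≤ τ +
      (coin (c.reg i) true * prog.reward coin τ r N (c.setReg d 1) +
        coin (c.reg i) false * prog.reward coin τ r N (c.setReg d 0)) := by
  have hh : ¬ c.Halted prog := by
    intro h1
    rw [List.getElem?_eq_none h1] at hI
    cases hI
  refine (reward_le_succ N c).trans ?_
  rw [reward_succ _ hh, step, hI]
  simp only [Instr.exec]
  rw [tsum_map_mul]
  simp

end

/-! ### Deterministic blocks of instructions. -/

/-- Write `x` into entry `i` of array `a`. -/
def writeArr (arr : ℕ → ℕ → ℕ) (a i x : ℕ) : ℕ → ℕ → ℕ :=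
  Function.update arr a (Function.update (arr a) i x)

@[simp]
theorem writeArr_self (arr : ℕ → ℕ → ℕ) (a i x : ℕ) :
    writeArr arr a i x a = Function.update (arr a) i x := Function.update_self ..

@[simp]
theorem writeArr_of_ne (arr : ℕ → ℕ → ℕ) {a b : ℕ} (h : b ≠ a) (i x : ℕ) :
    writeArr arr a i x b = arr b := Function.update_of_ne h ..

/-- The program gets from one configuration to another in `k` steps, without tossing a coin. -/
inductive Steps (prog : Program) : ℕ → Config → Config → Prop
  | refl (c : Config) : Steps prog 0 c c
  | head {k : ℕ} {c c' c'' : Config} {I : Instr} (hI : prog[c.pc]? = some I)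
      (h : ∀ coin, I.exec coin c = PMF.pure c') (hs : Steps prog k c' c'') :
      Steps prog (k + 1) c c''

namespace Steps

variable {prog : Program} {k l pc d a i j x : ℕ} {reg : ℕ → ℕ} {arr : ℕ → ℕ → ℕ} {c c' c'' : Config}

theorem trans (h : Steps prog k c c') (h' : Steps prog l c' c'') : Steps prog (k + l) c c'' := by
  induction h with
  | refl => simpa using h'
  | head hI h _ ih => rw [add_right_comm]; exact .head hI h (ih h')

theorem reward_le {coin : ℕ → PMF Bool} {τ : ENNReal} {r : Config → ENNReal}
    (h : Steps prog k c c') (N : ℕ) :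
    prog.reward coin τ r N c ≤ k * τ + prog.reward coin τ r N c' := by
  induction h with
  | refl => simp
  | head hI h _ ih =>
    refine (reward_le_succ N _).trans ?_
    rw [reward_eq_of_pure N hI h]
    push_cast
    rw [add_mul, one_mul, add_comm _ τ, add_assoc]
    gcongr

/-- The whole block is paid for, but only its first instruction is subtracted from the number of
remaining steps. An induction on that number can thus treat a nonempty block as one step. -/
theorem reward_succ_le {coin : ℕ → PMF Bool} {τ : ENNReal} {r : Config → ENNReal}
    (h : Steps prog (k + 1) c c') (N : ℕ) :
    prog.reward coin τ r (N + 1) c ≤ (k + 1 : ℕ) * τ + prog.reward coin τ r N c' := by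
  cases h with
  | head hI h hs =>
    rw [reward_eq_of_pure N hI h]
    push_cast
    rw [add_mul, one_mul, add_comm _ τ, add_assoc]
    gcongr
    exact hs.reward_le N

theorem const (h : prog[pc]? = some (.const d x))
    (hs : Steps prog k ⟨pc + 1, Function.update reg d x, arr⟩ c') :
    Steps prog (k + 1) ⟨pc, reg, arr⟩ c' := .head h (fun _ => rfl) hs

theorem copy (h : prog[pc]? = some (.copy d x))
    (hs : Steps prog k ⟨pc + 1, Function.update reg d (reg x), arr⟩ c') :
    Steps prog (k + 1) ⟨pc, reg, arr⟩ c' := .head h (fun _ => rfl) hs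

theorem succ (h : prog[pc]? = some (.succ d))
    (hs : Steps prog k ⟨pc + 1, Function.update reg d (reg d + 1), arr⟩ c') :
    Steps prog (k + 1) ⟨pc, reg, arr⟩ c' := .head h (fun _ => rfl) hs

theorem pred (h : prog[pc]? = some (.pred d))
    (hs : Steps prog k ⟨pc + 1, Function.update reg d (reg d - 1), arr⟩ c') :
    Steps prog (k + 1) ⟨pc, reg, arr⟩ c' := .head h (fun _ => rfl) hs

theorem load (h : prog[pc]? = some (.load d a i))
    (hs : Steps prog k ⟨pc + 1, Function.update reg d (arr a (reg i)), arr⟩ c') :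
    Steps prog (k + 1) ⟨pc, reg, arr⟩ c' := .head h (fun _ => rfl) hs

theorem store (h : prog[pc]? = some (.store a i x))
    (hs : Steps prog k ⟨pc + 1, reg, writeArr arr a (reg i) (reg x)⟩ c') :
    Steps prog (k + 1) ⟨pc, reg, arr⟩ c' := .head h (fun _ => rfl) hs

theorem jump (h : prog[pc]? = some (.jump l)) (hs : Steps prog k ⟨l, reg, arr⟩ c') :
    Steps prog (k + 1) ⟨pc, reg, arr⟩ c' := .head h (fun _ => rfl) hs

theorem jumpEq_pos (h : prog[pc]? = some (.jumpEq i j l)) (he : reg i = reg j)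
    (hs : Steps prog k ⟨l, reg, arr⟩ c') : Steps prog (k + 1) ⟨pc, reg, arr⟩ c' :=
  .head h (fun _ => by rw [Instr.exec, if_pos he]; rfl) hs

theorem jumpEq_neg (h : prog[pc]? = some (.jumpEq i j l)) (he : reg i ≠ reg j)
    (hs : Steps prog k ⟨pc + 1, reg, arr⟩ c') : Steps prog (k + 1) ⟨pc, reg, arr⟩ c' :=
  .head h (fun _ => by rw [Instr.exec, if_neg he]; rfl) hs

theorem jumpLt_pos (h : prog[pc]? = some (.jumpLt i j l)) (he : reg i < reg j)
    (hs : Steps prog k ⟨l, reg, arr⟩ c') : Steps prog (k + 1) ⟨pc, reg, arr⟩ c' :=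
  .head h (fun _ => by rw [Instr.exec, if_pos he]; rfl) hs

theorem jumpLt_neg (h : prog[pc]? = some (.jumpLt i j l)) (he : ¬ reg i < reg j)
    (hs : Steps prog k ⟨pc + 1, reg, arr⟩ c') : Steps prog (k + 1) ⟨pc, reg, arr⟩ c' :=
  .head h (fun _ => by rw [Instr.exec, if_neg he]; rfl) hs

end Steps

end Program

/-! ## The depth-first search for minimal clusters -/

/-- The state of a path-based depth-first search: the finished vertices, the positions of the
vertices on the path (`0` for the others), the code of the next arc of each vertex, the length of
the path, the numbers of its components and of its active vertices, and the positions of the first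
vertices of the components and of the active vertices. -/
structure Search (V : Type*) where
  done : V → Bool
  pos : V → ℕ
  ptr : V → ℕ
  size : ℕ
  comps : ℕ
  act : ℕ
  start : ℕ → ℕ
  actPos : ℕ → ℕ

namespace Search

set_option linter.unusedSectionVars false

open CoinDigraph

section

variable {V A : Type*}

/-- `x` is the largest code below `bound` of an arc out of `v`, or `0` if there is none. -/
structure IsPrev (N : CoinDigraph V A) (enc : A → ℕ) (v : V) (bound x : ℕ) : Prop where
  lt : x < bound
  arc : x = 0 ∨ ∃ a, N.tail a = v ∧ enc a = x
  le : ∀ a, N.tail a = v → enc a < bound → enc a ≤ x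

/-- Two positions are in the same component. -/
def Same (S : Search V) (i j : ℕ) : Prop :=
  ∀ k, 0 < k → k ≤ S.comps → (S.start k ≤ i ↔ S.start k ≤ j)

/-- The invariants of the search. -/
structure Ok (S : Search V) (N : CoinDigraph V A) (enc : A → ℕ) (ω : A → Bool) : Prop where
  pos_le : ∀ v, S.pos v ≤ S.size
  pos_surj : ∀ i, 0 < i → i ≤ S.size → ∃ v, S.pos v = i
  pos_inj : ∀ u v, S.pos u = S.pos v → 0 < S.pos u → u = v
  pos_done : ∀ v, S.done v = true → S.pos v = 0
  done_root : S.done N.root = true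
  done_reach : ∀ v, S.done v = true → N.Reach ω v N.root
  ptr_arc : ∀ v, S.ptr v = 0 ∨ ∃ a, N.tail a = v ∧ enc a = S.ptr v
  ptr_new : ∀ a, S.pos (N.tail a) = 0 → S.done (N.tail a) = false → enc a ≤ S.ptr (N.tail a)
  comps_pos : 0 < S.size → 0 < S.comps
  comps_one : 0 < S.comps → S.start 1 = 1
  comps_mono : ∀ i j, 0 < i → i < j → j ≤ S.comps → S.start i < S.start j
  act_mono : ∀ i j, 0 < i → i < j → j ≤ S.act → S.actPos i < S.actPos j
  act_range : ∀ i, 0 < i → i ≤ S.act → 0 < S.actPos i ∧ S.actPos i ≤ S.size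
  -- The first vertex of a component stays active until the component is merged or removed.
  comps_act : ∀ j, 0 < j → j ≤ S.comps → ∃ i, 0 < i ∧ i ≤ S.act ∧ S.actPos i = S.start j
  ptr_act : ∀ v, 0 < S.pos v → S.ptr v ≠ 0 → ∃ i, 0 < i ∧ i ≤ S.act ∧ S.actPos i = S.pos v
  -- Arcs are read in decreasing order of their codes; a present arc that has been passed stays
  -- inside a component.
  explored : ∀ a, 0 < S.pos (N.tail a) → S.ptr (N.tail a) < enc a → ω a = true →
    0 < S.pos (N.head a) ∧ S.Same (S.pos (N.tail a)) (S.pos (N.head a))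
  -- A vertex on the path reaches its own component and all later ones.
  conn : ∀ u v, 0 < S.pos u → 0 < S.pos v →
    (∀ j, 0 < j → j ≤ S.comps → S.start j ≤ S.pos u → S.start j ≤ S.pos v) → N.Reach ω u v

namespace Ok

variable {S : Search V} {N : CoinDigraph V A} {enc : A → ℕ} {ω : A → Bool}

theorem start_le (h : S.Ok N enc ω) {i j : ℕ} (hi : 0 < i) (hij : i ≤ j) (hj : j ≤ S.comps) :
    S.start i ≤ S.start j := by
  rcases hij.eq_or_lt with rfl | hij
  · rfl
  · exact (h.comps_mono i j hi hij hj).le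

theorem actPos_le (h : S.Ok N enc ω) {i j : ℕ} (hi : 0 < i) (hij : i ≤ j) (hj : j ≤ S.act) :
    S.actPos i ≤ S.actPos j := by
  rcases hij.eq_or_lt with rfl | hij
  · rfl
  · exact (h.act_mono i j hi hij hj).le

theorem comps_pos_of_act (h : S.Ok N enc ω) (hw : 0 < S.act) : 0 < S.comps := by
  have := h.act_range S.act hw le_rfl
  exact h.comps_pos (by omega)

theorem start_pos (h : S.Ok N enc ω) {j : ℕ} (hj : 0 < j) (hj' : j ≤ S.comps) :
    0 < S.start j := by
  obtain ⟨i, hi, hi', hij⟩ := h.comps_act j hj hj'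
  rw [← hij]
  exact (h.act_range i hi hi').1

theorem start_le_size (h : S.Ok N enc ω) {j : ℕ} (hj : 0 < j) (hj' : j ≤ S.comps) :
    S.start j ≤ S.size := by
  obtain ⟨i, hi, hi', hij⟩ := h.comps_act j hj hj'
  rw [← hij]
  exact (h.act_range i hi hi').2

/-- The last active vertex is in the last component. -/
theorem start_le_actPos (h : S.Ok N enc ω) {j : ℕ} (hj : 0 < j)
    (hj' : j ≤ S.comps) : S.start j ≤ S.actPos S.act := by
  obtain ⟨i, hi, hi', hij⟩ := h.comps_act j hj hj'
  rw [← hij]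
  exact h.actPos_le hi hi' le_rfl

theorem eq_zero_of_act (h : S.Ok N enc ω) (hw : S.act = 0) : S.comps = 0 ∧ S.size = 0 := by
  have h1 : S.comps = 0 := by
    by_contra h1
    obtain ⟨i, hi, hi', -⟩ := h.comps_act 1 one_pos (by omega)
    omega
  refine ⟨h1, ?_⟩
  by_contra h2
  have := h.comps_pos (by omega)
  omega

end Ok

/-- Put a vertex at the end of the path. -/
def push [DecidableEq V] (S : Search V) (y : V) : Search V where
  done := S.done
  pos := Function.update S.pos y (S.size + 1)
  ptr := S.ptr
  size := S.size + 1
  comps := S.comps + 1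
  act := S.act + 1
  start := Function.update S.start (S.comps + 1) (S.size + 1)
  actPos := Function.update S.actPos (S.act + 1) (S.size + 1)

/-- Advance the pointer of a vertex. -/
def advance [DecidableEq V] (S : Search V) (x : V) (p : ℕ) : Search V :=
  { S with ptr := Function.update S.ptr x p }

/-- Deactivate the last active vertex. -/
def exhaust (S : Search V) : Search V := { S with act := S.act - 1 }

/-- Merge the last two components. -/
def merge (S : Search V) : Search V := { S with comps := S.comps - 1 }

/-- Finish all vertices on the path. -/
def finish (S : Search V) : Search V where
  done := fun v => S.done v || decide (0 < S.pos v)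
  pos := fun _ => 0
  ptr := S.ptr
  size := 0
  comps := 0
  act := 0
  start := S.start
  actPos := S.actPos

/-- Remove the last component from the path, and reset its pointers. -/
def popTop (S : Search V) (first : V → ℕ) : Search V where
  done := S.done
  pos := fun v => if S.start S.comps ≤ S.pos v then 0 else S.pos v
  ptr := fun v => if S.start S.comps ≤ S.pos v then first v else S.ptr v
  size := S.start S.comps - 1
  comps := S.comps - 1
  act := S.act - 1
  start := S.start
  actPos := S.actPos

variable {S : Search V} {N : CoinDigraph V A} {enc : A → ℕ} {ω : A → Bool}

/-- The new vertex is a component by itself. All vertices on the path reach the last active one,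
which lies in the last component, and from there the new vertex. -/
theorem Ok.push [DecidableEq V] (h : S.Ok N enc ω) {y : V} (hy : S.pos y = 0)
    (hd : S.done y = false)
    (hstep : S.size = 0 ∨ ∃ x, S.pos x = S.actPos S.act ∧ 0 < S.act ∧ N.Reach ω x y) :
    (S.push y).Ok N enc ω := by
  have pos_y : (S.push y).pos y = S.size + 1 := Function.update_self ..
  have pos_ne : ∀ v, v ≠ y → (S.push y).pos v = S.pos v := fun v hv => Function.update_of_ne hv ..
  have start_new : (S.push y).start (S.comps + 1) = S.size + 1 := Function.update_self ..
  have start_old : ∀ j, j ≤ S.comps → (S.push y).start j = S.start j :=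
    fun j hj => Function.update_of_ne (by omega) ..
  have act_new : (S.push y).actPos (S.act + 1) = S.size + 1 := Function.update_self ..
  have act_old : ∀ j, j ≤ S.act → (S.push y).actPos j = S.actPos j :=
    fun j hj => Function.update_of_ne (by omega) ..
  have hsize : (S.push y).size = S.size + 1 := rfl
  have hcomps : (S.push y).comps = S.comps + 1 := rfl
  have hact : (S.push y).act = S.act + 1 := rfl
  have hdone : (S.push y).done = S.done := rfl
  have hptr : (S.push y).ptr = S.ptr := rfl
  have hle := h.pos_le
  constructor
  · intro v
    by_cases hv : v = y
    · rw [hv, pos_y, hsize]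
    · rw [pos_ne v hv, hsize]; have := hle v; omega
  · intro i hi hi'
    by_cases his : i = S.size + 1
    · exact ⟨y, by rw [pos_y, his]⟩
    · obtain ⟨v, hv⟩ := h.pos_surj i hi (by omega)
      refine ⟨v, ?_⟩
      rw [pos_ne, hv]
      rintro rfl
      omega
  · intro u v huv hu
    by_cases h1 : u = y <;> by_cases h2 : v = y
    · rw [h1, h2]
    · rw [h1, pos_y, pos_ne v h2] at huv; have := hle v; omega
    · rw [h2, pos_y, pos_ne u h1] at huv; have := hle u; omega
    · rw [pos_ne u h1, pos_ne v h2] at huv; rw [pos_ne u h1] at hu; exact h.pos_inj u v huv hu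
  · intro v hv
    have hvy : v ≠ y := by rintro rfl; rw [hdone, hd] at hv; cases hv
    rw [pos_ne v hvy]; exact h.pos_done v hv
  · exact h.done_root
  · exact h.done_reach
  · exact h.ptr_arc
  · intro a ha ha'
    have hvy : N.tail a ≠ y := by intro e; rw [e, pos_y] at ha; omega
    rw [pos_ne _ hvy] at ha
    exact h.ptr_new a ha ha'
  · intro _; omega
  · intro _
    by_cases h1 : S.comps = 0
    · have h2 : S.size = 0 := by
        by_contra h2
        have := h.comps_pos (by omega)
        omega
      have := start_new
      rw [h1] at this
      rw [this, h2]
    · rw [start_old 1 (by omega)]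
      exact h.comps_one (by omega)
  · intro i j hi hij hj
    rw [start_old i (by omega)]
    by_cases h1 : j = S.comps + 1
    · rw [h1, start_new]; have := h.start_le_size hi (by omega); omega
    · rw [start_old j (by omega)]; exact h.comps_mono i j hi hij (by omega)
  · intro i j hi hij hj
    rw [act_old i (by omega)]
    by_cases h1 : j = S.act + 1
    · rw [h1, act_new]; have := h.act_range i hi (by omega); omega
    · rw [act_old j (by omega)]; exact h.act_mono i j hi hij (by omega)
  · intro i hi hi'
    by_cases h1 : i = S.act + 1
    · rw [h1, act_new, hsize]; omega
    · rw [act_old i (by omega), hsize]; have := h.act_range i hi (by omega); omega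
  · intro j hj hj'
    by_cases h1 : j = S.comps + 1
    · exact ⟨S.act + 1, by omega, by omega, by rw [h1, act_new, start_new]⟩
    · obtain ⟨i, hi, hi', hij⟩ := h.comps_act j hj (by omega)
      exact ⟨i, hi, by omega, by rw [act_old i hi', start_old j (by omega), hij]⟩
  · intro v hv hp
    by_cases h1 : v = y
    · exact ⟨S.act + 1, by omega, by omega, by rw [h1, act_new, pos_y]⟩
    · rw [pos_ne v h1] at hv ⊢
      obtain ⟨i, hi, hi', hij⟩ := h.ptr_act v hv hp
      exact ⟨i, hi, by omega, by rw [act_old i hi', hij]⟩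
  · intro a ha hp hω
    by_cases h1 : N.tail a = y
    · have := h.ptr_new a (by rw [h1, hy]) (by rw [h1, hd])
      rw [hptr] at hp
      omega
    · rw [pos_ne _ h1] at ha ⊢
      obtain ⟨h2, h3⟩ := h.explored a ha hp hω
      have h4 : N.head a ≠ y := by intro e; rw [e] at h2; omega
      rw [pos_ne _ h4]
      refine ⟨h2, fun k hk hk' => ?_⟩
      by_cases h5 : k = S.comps + 1
      · rw [h5, start_new]
        have := hle (N.tail a)
        have := hle (N.head a)
        omega
      · rw [start_old k (by omega)]
        exact h3 k hk (by omega)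
  · intro u v hu hv huv
    by_cases h1 : u = y
    · have h2 := huv (S.comps + 1) (by omega) (by omega)
      rw [h1, pos_y, start_new] at h2
      by_cases h3 : v = y
      · rw [h1, h3]; exact .refl
      · rw [pos_ne v h3] at h2
        have := h2 le_rfl
        have := hle v
        omega
    · rw [pos_ne u h1] at hu huv
      by_cases h3 : v = y
      · rcases hstep with h4 | ⟨x, hx, hw, hr⟩
        · have := hle u; omega
        · have h5 := h.act_range S.act hw le_rfl
          refine (h.conn u x hu (by omega) fun j hj hj' _ => ?_).trans (h3 ▸ hr)
          rw [hx]
          exact h.start_le_actPos hj hj'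
      · rw [pos_ne v h3] at hv huv
        refine h.conn u v hu hv fun j hj hj' => ?_
        have := huv j hj (by omega)
        rwa [start_old j hj'] at this

/-- No arc of this vertex has a code strictly between `p` and `enc a`, so `a` is the only arc that
becomes explored. -/
theorem Ok.advance [DecidableEq V] (h : S.Ok N enc ω) {a : A} {p : ℕ}
    (henc : Function.Injective enc)
    (hx : 0 < S.pos (N.tail a)) (ha : S.ptr (N.tail a) = enc a)
    (hp : IsPrev N enc (N.tail a) (enc a) p)
    (hω : ω a = true → 0 < S.pos (N.head a) ∧ S.Same (S.pos (N.tail a)) (S.pos (N.head a))) :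
    (S.advance (N.tail a) p).Ok N enc ω := by
  have ptr_x : (S.advance (N.tail a) p).ptr (N.tail a) = p := Function.update_self ..
  have ptr_ne : ∀ v, v ≠ N.tail a → (S.advance (N.tail a) p).ptr v = S.ptr v :=
    fun v hv => Function.update_of_ne hv ..
  refine { h with ptr_arc := ?_, ptr_new := ?_, ptr_act := ?_, explored := ?_ }
  · intro v
    by_cases hv : v = N.tail a
    · rw [hv, ptr_x]; exact hp.arc
    · rw [ptr_ne v hv]; exact h.ptr_arc v
  · intro b hb hb'
    have h1 : N.tail b ≠ N.tail a := by
      intro e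
      have hb1 : S.pos (N.tail b) = 0 := hb
      rw [e] at hb1
      omega
    rw [ptr_ne _ h1]
    exact h.ptr_new b hb hb'
  · intro v hv hv'
    by_cases h1 : v = N.tail a
    · refine h.ptr_act v hv ?_
      rw [h1, ha]
      have := hp.lt
      omega
    · rw [ptr_ne v h1] at hv'
      exact h.ptr_act v hv hv'
  · intro b hb hb' hω'
    by_cases h1 : N.tail b = N.tail a
    · rw [h1, ptr_x] at hb'
      by_cases h2 : b = a
      · subst h2; exact hω hω'
      · have h3 : ¬ enc b < enc a := fun h3 => by have := hp.le b h1 h3; omega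
        have h4 : enc b ≠ enc a := fun h4 => h2 (henc h4)
        exact h.explored b hb (by rw [h1, ha]; omega) hω'
    · rw [ptr_ne _ h1] at hb'
      exact h.explored b hb hb' hω'

/-- The vertex has no arcs left, and it is not the first of its component, so no invariant needs it
to be active. -/
theorem Ok.exhaust (h : S.Ok N enc ω) (hw : 0 < S.act) {x : V} (hx : S.pos x = S.actPos S.act)
    (hp : S.ptr x = 0) (hne : S.actPos S.act ≠ S.start S.comps) : S.exhaust.Ok N enc ω := by
  have hact : S.exhaust.act = S.act - 1 := rfl
  have hc := h.comps_pos_of_act hw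
  refine { h with act_mono := ?_, act_range := ?_, comps_act := ?_, ptr_act := ?_ }
  · intro i j hi hij hj
    exact h.act_mono i j hi hij (by omega)
  · intro i hi hi'
    exact h.act_range i hi (by omega)
  · intro j hj hj'
    have hj'' : j ≤ S.comps := hj'
    obtain ⟨i, hi, hi', hij⟩ := h.comps_act j hj hj'
    refine ⟨i, hi, ?_, hij⟩
    by_contra h1
    have h2 : i = S.act := by omega
    have h3 := h.start_le hj hj'' le_rfl
    have h4 := h.start_le_actPos hc le_rfl
    rw [h2] at hij
    omega
  · intro v hv hv'
    obtain ⟨i, hi, hi', hij⟩ := h.ptr_act v hv hv'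
    refine ⟨i, hi, ?_, hij⟩
    by_contra h1
    have h2 : i = S.act := by omega
    rw [h2] at hij
    have h3 := h.pos_inj v x (by rw [hx, hij]) hv
    rw [h3] at hv'
    exact hv' hp

/-- The new connections lead from the last component to the one before it: through `x`, over the
path to `y`, which lies no later than that earlier component, and on from `y`. -/
theorem Ok.merge (h : S.Ok N enc ω) {x y : V} (hx : S.start S.comps ≤ S.pos x)
    (hx' : 0 < S.pos x) (hy : 0 < S.pos y) (hy' : S.pos y < S.start S.comps)
    (hr : N.Reach ω x y) : S.merge.Ok N enc ω := by
  have hcomps : S.merge.comps = S.comps - 1 := rfl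
  have hc : 0 < S.comps := h.comps_pos (by have := h.pos_le x; omega)
  have hc2 : 1 < S.comps := by
    by_contra h1
    have h2 := h.comps_one hc
    have h3 : S.comps = 1 := by omega
    rw [h3] at hy'
    omega
  refine { h with
    comps_pos := ?_, comps_one := ?_, comps_mono := ?_, comps_act := ?_, explored := ?_,
    conn := ?_ }
  · intro _; omega
  · intro _; exact h.comps_one hc
  · intro i j hi hij hj; exact h.comps_mono i j hi hij (by omega)
  · intro j hj hj'; exact h.comps_act j hj (by omega)
  · intro a ha ha' hω
    obtain ⟨h1, h2⟩ := h.explored a ha ha' hω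
    exact ⟨h1, fun k hk hk' => h2 k hk (by omega)⟩
  · intro u v hu hv huv
    by_cases h1 : S.start S.comps ≤ S.pos u → S.start S.comps ≤ S.pos v
    · refine h.conn u v hu hv fun j hj hj' => ?_
      by_cases hjc : j = S.comps
      · rw [hjc]; exact h1
      · exact huv j hj (by omega)
    · push Not at h1
      have h2 : N.Reach ω u x := h.conn u x hu hx' fun j hj hj' _ =>
        (h.start_le hj hj' le_rfl).trans hx
      have h3 : N.Reach ω y v := by
        refine h.conn y v hy hv fun j hj hj' h4 => ?_
        by_cases hjc : j = S.comps
        · rw [hjc] at h4; omega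
        · exact huv j hj (by omega) ((h.start_le hj hj' le_rfl).trans h1.1)
      exact (h2.trans hr).trans h3

/-- Every vertex on the path reaches the last active one, hence a finished vertex, hence the root.
-/
theorem Ok.finish (h : S.Ok N enc ω) (hw : 0 < S.act) {x y : V} (hx : S.pos x = S.actPos S.act)
    (hy : S.done y = true) (hr : N.Reach ω x y) : S.finish.Ok N enc ω := by
  have hpos : ∀ v, S.finish.pos v = 0 := fun _ => rfl
  have hsize : S.finish.size = 0 := rfl
  have hcomps : S.finish.comps = 0 := rfl
  have hact : S.finish.act = 0 := rfl
  constructor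
  · intro v; rw [hpos, hsize]
  · intro i hi hi'; omega
  · intro u v _ hu; rw [hpos] at hu; omega
  · intro v _; exact hpos v
  · simp [Search.finish, h.done_root]
  · intro v hv
    rw [Search.finish, Bool.or_eq_true, decide_eq_true_eq] at hv
    rcases hv with hv | hv
    · exact h.done_reach v hv
    · have h5 := h.act_range S.act hw le_rfl
      refine ((h.conn v x hv (by omega) fun j hj hj' _ => ?_).trans hr).trans (h.done_reach y hy)
      rw [hx]
      exact h.start_le_actPos hj hj'
  · exact h.ptr_arc
  · intro a _ ha'
    rw [Search.finish, Bool.or_eq_false_iff, decide_eq_false_iff_not] at ha'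
    exact h.ptr_new a (by omega) ha'.1
  · intro h1; omega
  · intro h1; omega
  · intro i j _ _ h1; omega
  · intro i j _ _ h1; omega
  · intro i _ h1; omega
  · intro i _ h1; omega
  · intro v hv; rw [hpos] at hv; omega
  · intro v hv; rw [hpos] at hv; omega
  · intro v _ hv; rw [hpos] at hv; omega

/-- When all vertices are finished, they all reach the root. -/
theorem Ok.reachesSet (h : S.Ok N enc ω) (hd : ∀ v, S.done v = true) :
    N.ReachesSet ω {N.root} :=
  fun x => ⟨N.root, by simp, h.done_reach x (hd x)⟩

end

section

open scoped Classical

variable {V A : Type*} [Fintype V] [Fintype A]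
variable {S : Search V} {N : CoinDigraph V A} {enc : A → ℕ} {ω : A → Bool}

/-- The vertices of the last component. -/
noncomputable def top (S : Search V) : Finset V :=
  Finset.univ.filter fun v => S.start S.comps ≤ S.pos v

theorem mem_top {v : V} : v ∈ S.top ↔ S.start S.comps ≤ S.pos v := by simp [top]

/-- A vertex with arcs left is active, and no active vertex lies beyond the last one, which here is
the first vertex of the component. -/
theorem Ok.ptr_top (h : S.Ok N enc ω) (hw : 0 < S.act) {x : V} (hx : S.pos x = S.actPos S.act)
    (hp : S.ptr x = 0) (he : S.actPos S.act = S.start S.comps) {v : V} (hv : v ∈ S.top) :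
    S.ptr v = 0 := by
  rw [mem_top] at hv
  have h0 := h.act_range S.act hw le_rfl
  by_contra h1
  obtain ⟨i, hi, hi', hij⟩ := h.ptr_act v (by omega) h1
  have h2 : ¬ i < S.act := fun h2 => by have := h.act_mono i S.act hi h2 le_rfl; omega
  have h3 : i = S.act := by omega
  rw [h3, ← hx] at hij
  exact h1 (by rw [← h.pos_inj x v hij (by omega), hp])

/-- All pointers of the component are zero, so all its arcs have been explored and none of the
present ones leaves it. The root is finished and thus not on the path. -/
theorem Ok.isTrap_top (h : S.Ok N enc ω) (henc : ∀ a, 0 < enc a) (hw : 0 < S.act) {x : V}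
    (hx : S.pos x = S.actPos S.act) (hp : S.ptr x = 0)
    (he : S.actPos S.act = S.start S.comps) : N.IsTrap ω S.top ∧ N.root ∉ S.top := by
  have hc := h.comps_pos_of_act hw
  have h0 := h.start_pos hc le_rfl
  refine ⟨⟨⟨x, by rw [mem_top, hx, he]⟩, fun a ha hω => ?_, fun u hu v hv => ?_⟩, ?_⟩
  · have h1 := h.ptr_top hw hx hp he ha
    rw [mem_top] at ha ⊢
    have := henc a
    exact ((h.explored a (by omega) (by omega) hω).2 _ hc le_rfl).1 ha
  · rw [mem_top] at hu hv
    exact h.conn u v (by omega) (by omega) fun j hj hj' _ =>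
      (h.start_le hj hj' le_rfl).trans hv
  · rw [mem_top, h.pos_done _ h.done_root]
    omega

/-- Only arcs out of the popped set change. Paths that end outside of it avoid it because it was
closed, and the explored arcs of the remaining vertices stay within their own components. Hence the
rest of the search is still valid and need not be restarted. -/
theorem Ok.popTop (h : S.Ok N enc ω) (henc : ∀ a, 0 < enc a) (hw : 0 < S.act) {x : V}
    (hx : S.pos x = S.actPos S.act) (hp : S.ptr x = 0)
    (he : S.actPos S.act = S.start S.comps) {ω' : A → Bool}
    (hω : ∀ a, N.tail a ∉ S.top → ω a = ω' a) {first : V → ℕ} {M : ℕ} (hM : ∀ a, enc a < M)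
    (hf : ∀ v, IsPrev N enc v M (first v)) : (S.popTop first).Ok N enc ω' := by
  have hc := h.comps_pos_of_act hw
  have h0 := h.start_pos hc le_rfl
  have htrap := h.isTrap_top henc hw hx hp he
  have hmem : ∀ v, v ∈ S.top ↔ S.start S.comps ≤ S.pos v := fun v => mem_top
  have pos_in : ∀ v, v ∈ S.top → (S.popTop first).pos v = 0 := fun v hv => if_pos ((hmem v).1 hv)
  have pos_out : ∀ v, v ∉ S.top → (S.popTop first).pos v = S.pos v :=
    fun v hv => if_neg (by rwa [← hmem])
  have pos_pos : ∀ v, 0 < (S.popTop first).pos v → v ∉ S.top := by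
    intro v hv hv'
    rw [pos_in v hv'] at hv
    omega
  have ptr_in : ∀ v, v ∈ S.top → (S.popTop first).ptr v = first v :=
    fun v hv => if_pos ((hmem v).1 hv)
  have ptr_out : ∀ v, v ∉ S.top → (S.popTop first).ptr v = S.ptr v :=
    fun v hv => if_neg (by rwa [← hmem])
  have hsize : (S.popTop first).size = S.start S.comps - 1 := rfl
  have hcomps : (S.popTop first).comps = S.comps - 1 := rfl
  have hact : (S.popTop first).act = S.act - 1 := rfl
  have hdone : (S.popTop first).done = S.done := rfl
  have hstart : (S.popTop first).start = S.start := rfl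
  have hactPos : (S.popTop first).actPos = S.actPos := rfl
  have hss := h.start_le_size hc le_rfl
  constructor
  · intro v
    by_cases hv : v ∈ S.top
    · rw [pos_in v hv]; omega
    · rw [pos_out v hv, hsize]; rw [hmem] at hv; omega
  · intro i hi hi'
    obtain ⟨v, hv⟩ := h.pos_surj i hi (by omega)
    exact ⟨v, by rw [pos_out v (by rw [hmem]; omega), hv]⟩
  · intro u v huv hu
    have hv : 0 < (S.popTop first).pos v := by omega
    rw [pos_out u (pos_pos u hu), pos_out v (pos_pos v hv)] at huv
    rw [pos_out u (pos_pos u hu)] at hu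
    exact h.pos_inj u v huv hu
  · intro v hv
    have h1 := h.pos_done v hv
    rw [pos_out v (by rw [hmem]; omega), h1]
  · exact h.done_root
  · intro v hv
    exact htrap.1.2.1.reach_of_agree htrap.2 (h.done_reach v hv) hω
  · intro v
    by_cases hv : v ∈ S.top
    · rw [ptr_in v hv]; exact (hf v).arc
    · rw [ptr_out v hv]; exact h.ptr_arc v
  · intro a ha ha'
    by_cases hv : N.tail a ∈ S.top
    · rw [ptr_in _ hv]; exact (hf _).le a rfl (hM a)
    · rw [pos_out _ hv] at ha
      rw [ptr_out _ hv]; exact h.ptr_new a ha ha'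
  · intro hs
    by_contra h1
    have h2 : S.comps = 1 := by omega
    have h3 := h.comps_one hc
    rw [hsize, h2] at hs
    omega
  · intro _; exact h.comps_one hc
  · intro i j hi hij hj; exact h.comps_mono i j hi hij (by omega)
  · intro i j hi hij hj; exact h.act_mono i j hi hij (by omega)
  · intro i hi hi'
    have h1 := h.act_mono i S.act hi (by omega) le_rfl
    have h2 := h.act_range i hi (by omega)
    rw [hsize, hactPos]
    omega
  · intro j hj hj'
    obtain ⟨i, hi, hi', hij⟩ := h.comps_act j hj (by omega)
    refine ⟨i, hi, ?_, hij⟩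
    by_contra h1
    have h2 : i = S.act := by omega
    have h3 := h.comps_mono j S.comps hj (by omega) le_rfl
    rw [h2] at hij
    omega
  · intro v hv hv'
    have hvt := pos_pos v hv
    rw [pos_out v hvt] at hv ⊢
    rw [ptr_out v hvt] at hv'
    obtain ⟨i, hi, hi', hij⟩ := h.ptr_act v hv hv'
    refine ⟨i, hi, ?_, hij⟩
    by_contra h1
    have h2 : i = S.act := by omega
    rw [hmem] at hvt
    rw [h2] at hij
    omega
  · intro a ha ha' hωa
    have hvt := pos_pos _ ha
    rw [pos_out _ hvt] at ha ⊢
    rw [ptr_out _ hvt] at ha'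
    obtain ⟨h1, h2⟩ := h.explored a ha ha' (by rw [hω a hvt, hωa])
    have h3 : N.head a ∉ S.top := by
      rw [hmem] at hvt ⊢
      rwa [← h2 S.comps hc le_rfl]
    rw [pos_out _ h3]
    exact ⟨h1, fun k hk hk' => h2 k hk (by omega)⟩
  · intro u v hu hv huv
    have hut := pos_pos u hu
    have hvt := pos_pos v hv
    rw [pos_out u hut] at hu huv
    rw [pos_out v hvt] at hv huv
    refine htrap.1.2.1.reach_of_agree hvt (h.conn u v hu hv fun j hj hj' => ?_) hω
    by_cases hjc : j = S.comps
    · rw [hjc]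
      rw [hmem] at hut
      omega
    · exact huv j hj (by omega)

end

end Search

/-! ## The program -/

/-- Cluster popping. Registers: `0` number of vertices, `1` number of edges, `2` zero, `9` one,
`10` length of the path, `11` number of components, `12` number of active vertices, `13` first
vertex that may be unfinished. Arrays: `3` head, `4` kind, `5` opposite and `6` successor of an
arc, `7` first arc of a vertex, `8` state of an arc, `9` next arc of a vertex, `10` position,
`11` finished vertices, `12` path, `13` components, `14` active vertices, `15` queue,
`16` queued vertices, `17` expanded vertices. -/
def popProgram : Program := [
  -- adjacency lists
  .jumpEq 3 1 23, .copy 4 5, .succ 4, .copy 5 4, .succ 5, .load 6 0 3, .load 7 1 3,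
  .store 3 4 7, .store 3 5 6, .store 4 4 3, .store 4 5 3, .store 5 4 5, .store 5 5 4,
  .load 8 7 6, .store 6 4 8, .store 7 6 4, .load 8 7 7, .store 6 5 8, .store 7 7 5,
  .store 9 6 4, .store 9 7 5, .succ 3, .jump 0, .const 9 1, .store 11 2 9,
  -- 25: next unfinished vertex
  .jumpEq 13 0 86, .load 8 11 13, .jumpEq 8 2 30, .succ 13, .jump 25, .copy 14 13,
  -- 31: put a vertex on the path
  .succ 10, .store 12 10 14, .store 10 14 10, .succ 11, .store 13 11 10, .succ 12,
  .store 14 12 10,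
  -- 38: next arc of the last active vertex
  .load 17 14 12, .load 15 12 17, .load 16 9 15, .jumpEq 16 2 56, .load 8 8 16, .jumpEq 8 2 51,
  .load 14 3 16, .load 8 11 14, .jumpEq 8 9 77, .load 17 10 14, .jumpEq 17 2 31,
  -- 49: merge components
  .load 8 13 11, .jumpLt 17 8 54, .load 8 6 16, .store 9 15 8, .jump 38, .pred 11, .jump 49,
  -- 56: no arcs left
  .load 8 13 11, .jumpEq 17 8 60, .pred 12, .jump 38,
  -- 60: pop the last component
  .jumpLt 10 17 73, .load 14 12 10, .store 10 14 2, .load 16 7 14, .store 9 14 16,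
  .jumpEq 16 2 71, .load 8 4 16, .toss 8 8, .store 8 16 8, .load 16 6 16, .jump 65,
  .pred 10, .jump 60, .pred 11, .pred 12, .jumpEq 12 2 25, .jump 38,
  -- 77: finish the path
  .jumpEq 10 2 83, .load 14 12 10, .store 11 14 9, .store 10 14 2, .pred 10, .jump 77,
  .const 11 0, .const 12 0, .jump 25,
  -- 86: output the edges in breadth-first order
  .store 16 2 9, .succ 19, .jumpEq 18 19 109, .load 14 15 18, .succ 18, .store 17 14 9,
  .load 16 7 14, .jumpEq 16 2 88, .load 6 3 16, .load 8 17 6, .jumpEq 8 9 107, .load 8 5 16,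
  .load 8 8 8, .load 7 4 16, .store 2 7 8, .jumpEq 8 2 107, .load 8 16 6, .jumpEq 8 9 107,
  .store 16 6 9, .store 15 19 6, .succ 19, .load 16 6 16, .jump 93]

/-! ### The search in the memory of the machine. -/

namespace Search

open CoinDigraph Program

section

variable {n : ℕ} {A : Type*}

/-- The arrays that describe the arcs: head, kind, opposite arc, successor, and first arc. -/
structure Adj (N : CoinDigraph (Fin n) A) (enc kind : A → ℕ) (rv : A → A) (M : ℕ)
    (hd kd rev link first : ℕ → ℕ) : Prop where
  head : ∀ a, hd (enc a) = N.head a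
  kind : ∀ a, kd (enc a) = kind a
  rev : ∀ a, rev (enc a) = enc (rv a)
  link : ∀ a, IsPrev N enc (N.tail a) (enc a) (link (enc a))
  first : ∀ v : Fin n, IsPrev N enc v M (first v)

/-- The memory in the state `S` of the search. -/
structure Mem (N : CoinDigraph (Fin n) A) (enc kind : A → ℕ) (rv : A → A) (M : ℕ)
    (S : Search (Fin n)) (cur : ℕ) (ω : A → Bool) (reg : ℕ → ℕ) (arr : ℕ → ℕ → ℕ) : Prop where
  adj : Adj N enc kind rv M (arr 3) (arr 4) (arr 5) (arr 6) (arr 7)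
  bit : ∀ a, arr 8 (enc a) = (ω a).toNat
  num : reg 0 = n
  zero : reg 2 = 0
  one : reg 9 = 1
  size : reg 10 = S.size
  comps : reg 11 = S.comps
  act : reg 12 = S.act
  cur : reg 13 = cur
  bfs_head : reg 18 = 0
  bfs_tail : reg 19 = 0
  ptr : ∀ v : Fin n, arr 9 v = S.ptr v
  pos : ∀ v : Fin n, arr 10 v = S.pos v
  done : ∀ v : Fin n, arr 11 v = (S.done v).toNat
  path : ∀ v : Fin n, 0 < S.pos v → arr 12 (S.pos v) = v
  start : ∀ i, 0 < i → i ≤ S.comps → arr 13 i = S.start i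
  actPos : ∀ i, 0 < i → i ≤ S.act → arr 14 i = S.actPos i
  out : arr 2 = fun _ => 0
  queue : arr 15 = fun _ => 0
  queued : arr 16 = fun _ => 0
  expanded : arr 17 = fun _ => 0

variable {N : CoinDigraph (Fin n) A} {enc kind : A → ℕ} {rv : A → A} {M : ℕ}
  {S : Search (Fin n)} {cur : ℕ} {ω : A → Bool} {reg : ℕ → ℕ} {arr : ℕ → ℕ → ℕ}

theorem Mem.exists_push (hM : Mem N enc kind rv M S cur ω reg arr) (hle : ∀ v, S.pos v ≤ S.size)
    {y : Fin n} (hy : reg 14 = y) (hpos : S.pos y = 0) :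
    ∃ reg' arr', Steps popProgram 7 ⟨31, reg, arr⟩ ⟨38, reg', arr'⟩ ∧
      Mem N enc kind rv M (S.push y) cur ω reg' arr' := by
  refine ⟨_, _, .succ rfl <| .store rfl <| .store rfl <| .succ rfl <| .store rfl <| .succ rfl <|
    .store rfl <| .refl _, ?_⟩
  have h1 : ∀ v, v ≠ y → (v : ℕ) ≠ y := fun v hv h => hv (Fin.ext h)
  constructor
  case path =>
    intro v hv
    by_cases hvy : v = y
    · subst hvy
      simp [Search.push, hM.size, hy]
    · have hv : 0 < S.pos v := by simpa [Search.push, hvy] using hv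
      have h2 := hle v
      have h3 : S.pos v ≠ S.size + 1 := by omega
      simp [Search.push, hM.size, hvy, h3, hM.path v hv]
  case ptr => intro v; simp [Search.push, hM.ptr]
  case pos =>
    intro v
    by_cases hvy : v = y
    · subst hvy
      simp [Search.push, hM.size, hy]
    · simp [Search.push, hvy, h1, hy, hM.pos]
  case done => intro v; simp [Search.push, hM.done]
  case start =>
    intro i hi hi'
    by_cases h : i = S.comps + 1
    · simp [Search.push, hM.comps, hM.size, h]
    · simp only [Search.push] at hi' ⊢
      simp [h, hM.comps, hM.start i hi (by omega)]
  case actPos =>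
    intro i hi hi'
    by_cases h : i = S.act + 1
    · simp [Search.push, hM.act, hM.size, h]
    · simp only [Search.push] at hi' ⊢
      simp [h, hM.act, hM.actPos i hi (by omega)]
  all_goals simp [Search.push, hM.adj, hM.bit, hM.num, hM.zero, hM.one, hM.size, hM.comps, hM.act,
    hM.cur, hM.bfs_head, hM.bfs_tail, hM.out, hM.queue, hM.queued, hM.expanded]

theorem Mem.congr_reg (hM : Mem N enc kind rv M S cur ω reg arr) {reg' : ℕ → ℕ}
    (h : ∀ i ∈ [0, 2, 9, 10, 11, 12, 13, 18, 19], reg' i = reg i) :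
    Mem N enc kind rv M S cur ω reg' arr := by
  simp only [List.forall_mem_cons, List.not_mem_nil, false_implies, implies_true, and_true] at h
  obtain ⟨h0, h2, h9, h10, h11, h12, h13, h18, h19⟩ := h
  exact { hM with
    num := h0.trans hM.num, zero := h2.trans hM.zero, one := h9.trans hM.one,
    size := h10.trans hM.size, comps := h11.trans hM.comps, act := h12.trans hM.act,
    cur := h13.trans hM.cur, bfs_head := h18.trans hM.bfs_head, bfs_tail := h19.trans hM.bfs_tail }

theorem Mem.exists_fetch (hM : Mem N enc kind rv M S cur ω reg arr) (hw : 0 < S.act) {x : Fin n}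
    (hx : S.pos x = S.actPos S.act) (hx' : 0 < S.pos x) :
    ∃ reg', Steps popProgram 3 ⟨38, reg, arr⟩ ⟨41, reg', arr⟩ ∧
      Mem N enc kind rv M S cur ω reg' arr ∧ reg' 15 = x ∧ reg' 16 = S.ptr x ∧
      reg' 17 = S.actPos S.act := by
  have h1 := hM.path x hx'
  refine ⟨_, .load rfl <| .load rfl <| .load rfl <| .refl _, hM.congr_reg (by simp), ?_⟩
  simp [hM.act, hM.actPos _ hw le_rfl, ← hx, h1, hM.ptr]

theorem Mem.exists_fetch_arc (hM : Mem N enc kind rv M S cur ω reg arr) {a : A}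
    (ha : reg 16 = enc a) (ha' : 0 < enc a) (hω : ω a = true) :
    ∃ reg', Steps popProgram 5 ⟨41, reg, arr⟩ ⟨46, reg', arr⟩ ∧
      Mem N enc kind rv M S cur ω reg' arr ∧ reg' 14 = N.head a ∧
      reg' 8 = (S.done (N.head a)).toNat ∧ reg' 15 = reg 15 ∧ reg' 16 = reg 16 := by
  refine ⟨_, .jumpEq_neg rfl (by rw [ha, hM.zero]; omega) <| .load rfl <| .jumpEq_neg rfl
    (by simp [ha, hM.bit, hω, hM.zero]) <| .load rfl <| .load rfl <| .refl _,
    hM.congr_reg (by simp), ?_⟩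
  simp [ha, hM.adj.head, hM.done]

theorem Mem.exists_advance (hM : Mem N enc kind rv M S cur ω reg arr) {a : A}
    (hx : reg 15 = N.tail a) (ha : reg 16 = enc a) :
    ∃ p reg' arr', Steps popProgram 3 ⟨51, reg, arr⟩ ⟨38, reg', arr'⟩ ∧
      IsPrev N enc (N.tail a) (enc a) p ∧
      Mem N enc kind rv M (S.advance (N.tail a) p) cur ω reg' arr' := by
  refine ⟨_, _, _, .load rfl <| .store rfl <| .jump rfl <| .refl _, hM.adj.link a, ?_⟩
  constructor
  case ptr =>
    intro v
    by_cases hv : v = N.tail a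
    · subst hv
      simp [Search.advance, hx, ha]
    · have h1 : (v : ℕ) ≠ N.tail a := fun h => hv (Fin.ext h)
      simp [Search.advance, hx, hv, h1, hM.ptr]
  case path => intro v hv; simpa [Search.advance] using hM.path v hv
  case start => intro i hi hi'; simpa [Search.advance] using hM.start i hi hi'
  case actPos => intro i hi hi'; simpa [Search.advance] using hM.actPos i hi hi'
  all_goals simp [Search.advance, hM.adj, hM.bit, hM.num, hM.zero, hM.one, hM.size, hM.comps,
    hM.act, hM.cur, hM.bfs_head, hM.bfs_tail, hM.out, hM.queue, hM.queued, hM.expanded, hM.pos,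
    hM.done]

theorem Mem.exists_merge_step (hM : Mem N enc kind rv M S cur ω reg arr) (hc : 0 < S.comps)
    (hlt : reg 17 < S.start S.comps) :
    ∃ reg', Steps popProgram 4 ⟨49, reg, arr⟩ ⟨49, reg', arr⟩ ∧
      Mem N enc kind rv M S.merge cur ω reg' arr ∧ reg' 17 = reg 17 ∧ reg' 15 = reg 15 ∧
      reg' 16 = reg 16 := by
  refine ⟨_, .load rfl <| .jumpLt_pos rfl
    (by simp [hlt, hM.comps, hM.start S.comps hc le_rfl]) <| .pred rfl <| .jump rfl <| .refl _,
    ?_, by simp, by simp, by simp⟩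
  constructor
  case start =>
    intro i hi hi'
    simp only [Search.merge] at hi' ⊢
    exact hM.start i hi (by omega)
  case path => intro v hv; exact hM.path v hv
  case actPos => intro i hi hi'; exact hM.actPos i hi hi'
  all_goals simp [Search.merge, hM.adj, hM.bit, hM.num, hM.zero, hM.one, hM.size, hM.comps,
    hM.act, hM.cur, hM.bfs_head, hM.bfs_tail, hM.out, hM.queue, hM.queued, hM.expanded, hM.pos,
    hM.done, hM.ptr]

/-- Components are merged one by one until the last one starts no later than `y`. Each round takes
four instructions and removes a component, and the final test takes two, which is the bound on `k`.
-/
theorem Mem.exists_merge (hO : S.Ok N enc ω) (hM : Mem N enc kind rv M S cur ω reg arr)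
    {x y : Fin n} (hx : S.start S.comps ≤ S.pos x) (hx' : 0 < S.pos x) (hy : reg 17 = S.pos y)
    (hy' : 0 < S.pos y) (hr : N.Reach ω x y) :
    ∃ k c reg', Steps popProgram k ⟨49, reg, arr⟩ ⟨51, reg', arr⟩ ∧ c ≤ S.comps ∧ 0 < c ∧
      k + 4 * c ≤ 4 * S.comps + 2 ∧ ({ S with comps := c } : Search (Fin n)).Ok N enc ω ∧
      Mem N enc kind rv M { S with comps := c } cur ω reg' arr ∧ S.start c ≤ S.pos y ∧
      reg' 15 = reg 15 ∧ reg' 16 = reg 16 := by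
  obtain ⟨b, hb⟩ : ∃ b, b = S.comps := ⟨_, rfl⟩
  induction b generalizing S reg with
  | zero =>
    have := hO.comps_pos (by have := hO.pos_le x; omega)
    omega
  | succ b ih =>
    have hc : 0 < S.comps := by omega
    have hst := hM.start S.comps hc le_rfl
    by_cases hlt : S.pos y < S.start S.comps
    · have hO' := hO.merge hx hx' hy' hlt hr
      obtain ⟨reg₁, hstep, hM', h17, h15, h16⟩ := hM.exists_merge_step hc (by rw [hy]; exact hlt)
      have hcm : S.merge.comps = S.comps - 1 := rfl
      have hx2 : S.merge.start S.merge.comps ≤ S.merge.pos x := by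
        have := hO.start_le (i := S.merge.comps) (j := S.comps)
          (hO'.comps_pos (by have := hO.pos_le x; exact this.trans_lt' hx')) (by omega) le_rfl
        exact this.trans hx
      obtain ⟨k, c, reg', h1, h2, h3, h4, h5, h6, h7, h8, h9⟩ :=
        ih hO' hM' hx2 hx' (h17.trans hy) hy' (by omega)
      refine ⟨4 + k, c, reg', hstep.trans h1, by omega, h3, by omega, h5, h6, h7, ?_, ?_⟩
      · rw [h8, h15]
      · rw [h9, h16]
    · refine ⟨2, S.comps, _, .load rfl <| .jumpLt_neg rfl (by simp [hy, hM.comps, hst, hlt]) <|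
        .refl _, le_rfl, hc, by omega, hO, hM.congr_reg (by simp), by omega, by simp, by simp⟩

theorem exists_finish_loop {pos : Fin n → ℕ} (hinj : ∀ u v, pos u = pos v → 0 < pos u → u = v)
    (s : ℕ) (hsurj : ∀ i, 0 < i → i ≤ s → ∃ v, pos v = i)
    (hpath : ∀ v : Fin n, 0 < pos v → arr 12 (pos v) = v) (hs : reg 10 = s) (h2 : reg 2 = 0)
    (h9 : reg 9 = 1) :
    ∃ reg' arr', Steps popProgram (6 * s + 1) ⟨77, reg, arr⟩ ⟨83, reg', arr'⟩ ∧ reg' 10 = 0 ∧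
      (∀ i, i ≠ 10 → i ≠ 14 → reg' i = reg i) ∧ (∀ i, i ≠ 10 → i ≠ 11 → arr' i = arr i) ∧
      (∀ v : Fin n, arr' 10 v = if 0 < pos v ∧ pos v ≤ s then 0 else arr 10 v) ∧
      ∀ v : Fin n, arr' 11 v = if 0 < pos v ∧ pos v ≤ s then 1 else arr 11 v := by
  induction s generalizing reg arr with
  | zero =>
    refine ⟨_, _, .jumpEq_pos rfl (by rw [hs, h2]) <| .refl _, hs, fun _ _ _ => rfl,
      fun _ _ _ => rfl, fun v => (if_neg (by omega)).symm, fun v => (if_neg (by omega)).symm⟩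
  | succ s ih =>
    obtain ⟨y, hy⟩ := hsurj (s + 1) (by omega) le_rfl
    have hp : arr 12 (s + 1) = y := by rw [← hy]; exact hpath y (by omega)
    have hstep : Steps popProgram 6 ⟨77, reg, arr⟩ ⟨77, _, _⟩ :=
      .jumpEq_neg rfl (by rw [hs, h2]; omega) <| .load rfl <| .store rfl <| .store rfl <|
        .pred rfl <| .jump rfl <| .refl _
    obtain ⟨reg', arr', h3, h4, h5, h6, h7, h8⟩ := ih
      (arr := writeArr (writeArr arr 11 (Function.update reg 14 (arr 12 (reg 10)) 14)
        (Function.update reg 14 (arr 12 (reg 10)) 9)) 10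
        (Function.update reg 14 (arr 12 (reg 10)) 14) (Function.update reg 14 (arr 12 (reg 10)) 2))
      (reg := Function.update (Function.update reg 14 (arr 12 (reg 10))) 10
        (Function.update reg 14 (arr 12 (reg 10)) 10 - 1))
      (fun i hi hi' => hsurj i hi (by omega))
      (fun v hv => by simpa using hpath v hv) (by simp [hs]) (by simp [h2]) (by simp [h9])
    have key : ∀ v : Fin n, v ≠ y → ((0 < pos v ∧ pos v ≤ s) ↔ (0 < pos v ∧ pos v ≤ s + 1)) := by
      intro v hv
      have : pos v ≠ s + 1 := fun h => hv (hinj v y (by rw [h, hy]) (by omega))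
      omega
    have hne : ∀ v : Fin n, v ≠ y → (v : ℕ) ≠ y := fun v hv h => hv (Fin.ext h)
    refine ⟨reg', arr', by rw [show 6 * (s + 1) + 1 = 6 + (6 * s + 1) by ring]; exact hstep.trans h3,
      h4, ?_, ?_, ?_, ?_⟩
    · intro i hi hi'
      rw [h5 i hi hi']
      simp [hi, hi']
    · intro i hi hi'
      rw [h6 i hi hi']
      simp [hi, hi']
    · intro v
      rw [h7]
      by_cases hv : v = y
      · subst hv
        simp [hs, hp, h2, hy]
      · simp [hs, hp, hne v hv, key v hv]
    · intro v
      rw [h8]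
      by_cases hv : v = y
      · subst hv
        simp [hs, hp, h9, hy]
      · simp [hs, hp, hne v hv, key v hv]

theorem Mem.exists_finish (hO : S.Ok N enc ω) (hM : Mem N enc kind rv M S cur ω reg arr) :
    ∃ reg' arr', Steps popProgram (6 * S.size + 4) ⟨77, reg, arr⟩ ⟨25, reg', arr'⟩ ∧
      Mem N enc kind rv M S.finish cur ω reg' arr' := by
  obtain ⟨reg', arr', h1, h2, h3, h4, h5, h6⟩ := exists_finish_loop hO.pos_inj S.size hO.pos_surj
    hM.path hM.size hM.zero hM.one
  refine ⟨_, _, h1.trans (k := 6 * S.size + 1) (l := 3) <| .const rfl <| .const rfl <|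
    .jump rfl <| .refl _, ?_⟩
  have hle : ∀ v, (0 < S.pos v ∧ S.pos v ≤ S.size) ↔ 0 < S.pos v :=
    fun v => and_iff_left (hO.pos_le v)
  constructor
  case pos =>
    intro v
    simp only [h5, hle, hM.pos]
    simp only [Search.finish]
    split_ifs <;> omega
  case done =>
    intro v
    simp only [h6, hle, hM.done]
    by_cases hv : 0 < S.pos v
    · simp [Search.finish, hv]
    · simp [Search.finish, hv]
  case path => intro v hv; simp [Search.finish] at hv
  case start => intro i hi hi'; simp only [Search.finish] at hi'; omega
  case actPos => intro i hi hi'; simp only [Search.finish] at hi'; omega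
  all_goals simp [Search.finish, h2, h3, h4, hM.adj, hM.bit, hM.num, hM.zero, hM.one, hM.cur,
    hM.bfs_head, hM.bfs_tail, hM.out, hM.queue, hM.queued, hM.expanded, hM.ptr]

end

end Search

/-! ### Averages over redrawn arcs. -/

namespace CoinDigraph

set_option linter.unusedSectionVars false

section

open scoped Classical

variable {V A : Type*} [Fintype V] [Fintype A] (N : CoinDigraph V A)

/-- The expectation of `F` after resampling the arcs in `X`. -/
noncomputable def avg (X : Finset A) (F : (A → Bool) → ENNReal) (ω : A → Bool) : ENNReal :=
  ∑ η, N.wt η * F (mix X η ω)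

variable {N} {X Y : Finset A} {F : (A → Bool) → ENNReal} {ω : A → Bool}

theorem avg_empty : N.avg ∅ F ω = F ω := by
  have : ∀ η : A → Bool, mix ∅ η ω = ω := fun η => by ext a; simp [mix]
  simp [avg, this, ← Finset.sum_mul, sum_wt]

theorem avg_avg (h : Disjoint X Y) : N.avg X (N.avg Y F) ω = N.avg (X ∪ Y) F ω := by
  have h1 := N.sum_sum_mix_left Y (fun η => F (mix (X ∪ Y) η ω))
  rw [avg, avg, ← h1]
  refine Finset.sum_congr rfl fun η _ => ?_
  rw [avg]
  congr 1
  refine Finset.sum_congr rfl fun η' _ => ?_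
  congr 2
  ext a
  by_cases hX : a ∈ X
  · simp [mix, hX, Finset.disjoint_left.1 h hX]
  · by_cases hY : a ∈ Y <;> simp [mix, hX, hY]

theorem sum_wt_mul_apply (a : A) (f : Bool → ENNReal) :
    ∑ η, N.wt η * f (η a) = N.coin a true * f true + N.coin a false * f false := by
  have h : ∀ η : A → Bool, N.wt η * f (η a) =
      ∏ b, N.coin b (η b) * (if b = a then f (η b) else 1) := by
    intro η
    rw [Finset.prod_mul_distrib, Finset.prod_ite_eq' Finset.univ a fun b => f (η b)]
    simp [wt]
  simp only [h]
  rw [← Fintype.prod_sum fun b x => N.coin b x * (if b = a then f x else 1),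
    Finset.prod_eq_single a]
  · simp
  · intro b _ hb
    simp [hb, N.coin_sum]
  · simp

/-- The average over a set of arcs is built up by single coin tosses, in the way the machine redraws
them. -/
theorem avg_insert {a : A} (ha : a ∉ X) :
    N.avg (insert a X) F ω = N.coin a true * N.avg X F (Function.update ω a true) +
      N.coin a false * N.avg X F (Function.update ω a false) := by
  have h1 : N.avg {a} (N.avg X F) ω = N.avg (insert a X) F ω := by
    rw [avg_avg (Finset.disjoint_singleton_left.2 ha), Finset.insert_eq]
  have h2 : ∀ η : A → Bool, mix {a} η ω = Function.update ω a (η a) := by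
    intro η
    ext b
    by_cases hb : b = a
    · subst hb; simp [mix]
    · simp [mix, hb]
  rw [← h1, avg]
  simp only [h2]
  exact N.sum_wt_mul_apply a fun b => N.avg X F (Function.update ω a b)

variable (N) in
/-- The limit of `value`. -/
noncomputable def limValue (κ : ENNReal) (ψ : (A → Bool) → ENNReal) (ω : A → Bool) : ENNReal :=
  ⨆ t, N.value κ ψ t ω

variable {κ : ENNReal} {ψ : (A → Bool) → ENNReal} {C : Finset V}

theorem le_limValue (h : N.ReachesSet ω {N.root}) : ψ ω ≤ N.limValue κ ψ ω :=
  (value_good (κ := κ) (ψ := ψ) 0 h).ge.trans (le_iSup (fun t => N.value κ ψ t ω) 1)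

/-- The values increase with the number of rounds, so the supremum commutes with the finite average.
-/
theorem add_avg_le_limValue (hC : N.IsTrap ω C) (hr : N.root ∉ C) :
    κ * N.cost C + N.avg (N.out C) (N.limValue κ ψ) ω ≤ N.limValue κ ψ ω := by
  have h : N.avg (N.out C) (N.limValue κ ψ) ω =
      ⨆ t, ∑ η, N.wt η * N.value κ ψ t (mix (N.out C) η ω) := by
    rw [avg]
    simp only [limValue, ENNReal.mul_iSup]
    exact ENNReal.finsetSum_iSup_of_monotone fun η =>
      fun s t hst => mul_le_mul_right (value_mono hst) _
  rw [h, ENNReal.add_iSup]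
  exact iSup_le fun t => (le_value_succ t hC hr).trans
    (le_iSup (fun t => N.value κ ψ t ω) (t + 1))

end

end CoinDigraph

/-! ### Popping a component on the machine. -/

namespace Search

set_option linter.unusedSectionVars false

open CoinDigraph Program

section

open scoped Classical

variable {n : ℕ} {A : Type*} [Fintype A]

/-- Reset all vertices from position `t` on. -/
def cut (S : Search (Fin n)) (first : Fin n → ℕ) (t : ℕ) : Search (Fin n) :=
  { S with
    pos := fun v => if t ≤ S.pos v then 0 else S.pos v
    ptr := fun v => if t ≤ S.pos v then first v else S.ptr v
    size := t - 1 }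

variable {N : CoinDigraph (Fin n) A} {enc kind : A → ℕ} {rv : A → A} {M : ℕ}
  {S : Search (Fin n)} {cur : ℕ} {ω : A → Bool} {reg : ℕ → ℕ} {arr : ℕ → ℕ → ℕ}
  {coin : ℕ → PMF Bool} {τ : ENNReal} {r : Config → ENNReal}

variable (N enc) in
/-- The arcs out of `y` with codes below `bound`. -/
noncomputable def arcsBelow (y : Fin n) (bound : ℕ) : Finset A :=
  Finset.univ.filter fun a => N.tail a = y ∧ enc a < bound

theorem IsPrev.arcsBelow_eq_insert {y : Fin n} {bound x : ℕ} (hx : IsPrev N enc y bound x)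
    (henc : Function.Injective enc) {a : A} (ha : N.tail a = y) (hax : enc a = x) :
    arcsBelow N enc y bound = insert a (arcsBelow N enc y (enc a)) := by
  have hlt : enc a < bound := by rw [hax]; exact hx.lt
  ext b
  simp only [arcsBelow, Finset.mem_filter, Finset.mem_univ, true_and, Finset.mem_insert]
  constructor
  · rintro ⟨h1, h2⟩
    have h3 := hx.le b h1 h2
    by_cases hba : b = a
    · exact Or.inl hba
    · have : enc b ≠ enc a := fun h => hba (henc h)
      exact Or.inr ⟨h1, by omega⟩
  · rintro (rfl | ⟨h1, h2⟩)
    · exact ⟨ha, hlt⟩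
    · exact ⟨h1, by omega⟩

/-- Whatever follows the loop enters through the bound `F` on its continuation, and each toss
becomes one use of `avg_insert`. A round has six instructions (test, kind, toss, store, link, jump);
leaving takes one. -/
theorem reward_toss_loop (henc : Function.Injective enc) (hpos : ∀ a, 0 < enc a) {y : Fin n}
    (hcoin : ∀ a, N.tail a = y → ∀ b, coin (kind a) b = N.coin a b) (T : ℕ)
    {F : (A → Bool) → ENNReal} (bound : ℕ)
    (hadj : Adj N enc kind rv M (arr 3) (arr 4) (arr 5) (arr 6) (arr 7))
    (hbit : ∀ a, arr 8 (enc a) = (ω a).toNat) (hzero : reg 2 = 0)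
    (hx : IsPrev N enc y bound (reg 16))
    (hpost : ∀ ω' reg' arr', (∀ i, i ≠ 8 → i ≠ 16 → reg' i = reg i) →
      (∀ i, i ≠ 8 → arr' i = arr i) → (∀ a, arr' 8 (enc a) = (ω' a).toNat) →
      (∀ a, a ∉ arcsBelow N enc y bound → ω' a = ω a) →
      popProgram.reward coin τ r T ⟨71, reg', arr'⟩ ≤ F ω') :
    popProgram.reward coin τ r T ⟨65, reg, arr⟩ ≤
      ((6 * (arcsBelow N enc y bound).card + 1 : ℕ) : ENNReal) * τ +
        N.avg (arcsBelow N enc y bound) F ω := by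
  induction bound using Nat.strong_induction_on generalizing ω reg arr with
  | _ bound ih =>
    rcases hx.arc with h0 | ⟨a, ha, hax⟩
    · have hempty : arcsBelow N enc y bound = ∅ := by
        refine Finset.filter_eq_empty_iff.2 fun a _ h => ?_
        have := hx.le a h.1 h.2
        have := hpos a
        omega
      rw [hempty, avg_empty]
      have hs : Steps popProgram 1 ⟨65, reg, arr⟩ ⟨71, reg, arr⟩ :=
        .jumpEq_pos rfl (by rw [h0, hzero]) <| .refl _
      refine (hs.reward_le T).trans ?_
      simp only [Finset.card_empty, mul_zero, zero_add]
      gcongr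
      exact hpost ω reg arr (fun _ _ _ => rfl) (fun _ _ => rfl) hbit (fun _ _ => rfl)
    · have hlt : enc a < bound := by rw [hax]; exact hx.lt
      have hnot : a ∉ arcsBelow N enc y (enc a) := by simp [arcsBelow]
      have hins := hx.arcsBelow_eq_insert henc ha hax
      have hs : Steps popProgram 2 ⟨65, reg, arr⟩ ⟨67, Function.update reg 8 (kind a), arr⟩ := by
        have := hadj.kind a
        rw [hax] at this
        exact .jumpEq_neg rfl (by rw [← hax, hzero]; have := hpos a; omega) <| .load rfl <| by
          rw [this]; exact .refl _
      have key : ∀ b : Bool, popProgram.reward coin τ r T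
          ((⟨67, Function.update reg 8 (kind a), arr⟩ : Config).setReg 8 b.toNat) ≤
          (3 : ℕ) * τ + (((6 * (arcsBelow N enc y (enc a)).card + 1 : ℕ) : ENNReal) * τ +
            N.avg (arcsBelow N enc y (enc a)) F (Function.update ω a b)) := by
        intro b
        have hs' : Steps popProgram 3
            ((⟨67, Function.update reg 8 (kind a), arr⟩ : Config).setReg 8 b.toNat)
            ⟨65, _, _⟩ := Steps.store rfl <| .load rfl <| .jump rfl <| .refl _
        refine (hs'.reward_le T).trans ?_
        gcongr
        refine ih (enc a) hlt ?_ ?_ ?_ ?_ ?_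
        · simpa using hadj
        · intro c
          by_cases hc : c = a
          · subst hc; simp [← hax]
          · have : enc c ≠ enc a := fun h => hc (henc h)
            simp [← hax, hc, this, hbit]
        · simp [hzero]
        · have := hadj.link a
          rw [ha] at this
          simpa [← hax] using this
        · intro ω' reg' arr' h1 h2 h3 h4
          refine hpost ω' reg' arr' (fun i hi hi' => ?_) (fun i hi => ?_) h3 fun c hc => ?_
          · rw [h1 i hi hi']; simp [hi, hi']
          · rw [h2 i hi]; simp [hi]
          · rw [hins, Finset.mem_insert, not_or] at hc
            rw [h4 c hc.2, Function.update_of_ne hc.1]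
      refine (hs.reward_le T).trans ?_
      have htoss := reward_toss_le (prog := popProgram) (coin := coin) (τ := τ) (r := r)
        (c := ⟨67, Function.update reg 8 (kind a), arr⟩) T (d := 8) (i := 8) rfl
      simp only [Function.update_self, hcoin a ha] at htoss
      have h1 : popProgram.reward coin τ r T ⟨67, Function.update reg 8 (kind a), arr⟩ ≤ τ +
          (N.coin a true * ((3 : ℕ) * τ +
            (((6 * (arcsBelow N enc y (enc a)).card + 1 : ℕ) : ENNReal) * τ +
            N.avg (arcsBelow N enc y (enc a)) F (Function.update ω a true))) +
          N.coin a false * ((3 : ℕ) * τ +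
            (((6 * (arcsBelow N enc y (enc a)).card + 1 : ℕ) : ENNReal) * τ +
            N.avg (arcsBelow N enc y (enc a)) F (Function.update ω a false)))) := by
        refine htoss.trans ?_
        gcongr
        · exact key true
        · exact key false
      refine (add_le_add_right h1 _).trans (le_of_eq ?_)
      rw [hins, avg_insert hnot, Finset.card_insert_of_notMem hnot]
      have hsum := N.coin_sum a
      set P := N.coin a true
      set Q := N.coin a false
      set X := N.avg (arcsBelow N enc y (enc a)) F (Function.update ω a true)
      set Y := N.avg (arcsBelow N enc y (enc a)) F (Function.update ω a false)
      set D := ((6 * (arcsBelow N enc y (enc a)).card + 1 : ℕ) : ENNReal) * τ with hD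
      have h3 : P * ((3 : ℕ) * τ + (D + X)) + Q * ((3 : ℕ) * τ + (D + Y)) =
          (P + Q) * ((3 : ℕ) * τ + D) + (P * X + Q * Y) := by ring
      rw [h3, hsum, hD]
      push_cast
      ring

/-- The arcs out of the vertices at the positions from `q` to `s`. -/
noncomputable def arcsAt (N : CoinDigraph (Fin n) A) (S : Search (Fin n)) (q s : ℕ) : Finset A :=
  Finset.univ.filter fun a => q ≤ S.pos (N.tail a) ∧ S.pos (N.tail a) ≤ s

/-- Positions are removed from the end of the path, and `cut` describes the states in between. Apart
from six instructions per arc, each vertex costs five instructions before the tosses, one to leave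
the toss loop and two after it. The root is never among these vertices since finished vertices have
position zero, so all tosses follow the law of the digraph. -/
theorem reward_pop_loop {ω₀ : A → Bool} (hO : S.Ok N enc ω₀) (henc : Function.Injective enc)
    (hpos : ∀ a, 0 < enc a) (hencM : ∀ a, enc a < M)
    (hcoin : ∀ a, N.tail a ≠ N.root → ∀ b, coin (kind a) b = N.coin a b) (T : ℕ)
    {F : (A → Bool) → ENNReal} {first : Fin n → ℕ} {q : ℕ} (hq : 0 < q) (s : ℕ) (hs : q ≤ s + 1)
    (hsize : s ≤ S.size) (hfirst : ∀ v : Fin n, arr 7 v = first v)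
    (hM : Mem N enc kind rv M (S.cut first (s + 1)) cur ω reg arr) (hreg : reg 17 = q)
    (hpost : ∀ ω' reg' arr', Mem N enc kind rv M (S.cut first q) cur ω' reg' arr' →
      (∀ a, a ∉ arcsAt N S q s → ω' a = ω a) →
      popProgram.reward coin τ r T ⟨73, reg', arr'⟩ ≤ F ω') :
    popProgram.reward coin τ r T ⟨60, reg, arr⟩ ≤
      ((8 * (s + 1 - q) + 6 * (arcsAt N S q s).card + 1 : ℕ) : ENNReal) * τ +
        N.avg (arcsAt N S q s) F ω := by
  obtain ⟨d, hd⟩ : ∃ d, s + 1 = q + d := ⟨s + 1 - q, by omega⟩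
  have hrs : reg 10 = s := by rw [hM.size]; rfl
  induction d generalizing s ω reg arr with
  | zero =>
    have hempty : arcsAt N S q s = ∅ := by
      refine Finset.filter_eq_empty_iff.2 fun a _ h => ?_
      omega
    rw [hempty, avg_empty]
    have hs : Steps popProgram 1 ⟨60, reg, arr⟩ ⟨73, reg, arr⟩ :=
      .jumpLt_pos rfl (by rw [hrs, hreg]; omega) <| .refl _
    refine (hs.reward_le T).trans ?_
    have hqs : s + 1 = q := by omega
    rw [hqs] at hM ⊢
    simp only [Finset.card_empty, mul_zero, zero_add, Nat.sub_self]
    gcongr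
    exact hpost ω reg arr hM fun _ _ => rfl
  | succ d ih =>
    obtain ⟨y, hy⟩ := hO.pos_surj s (by omega) hsize
    have hypath : arr 12 s = y := by
      have := hM.path y (by simp only [Search.cut]; rw [if_neg (by omega)]; omega)
      simp only [Search.cut] at this
      rwa [if_neg (by omega), hy] at this
    have hyr : y ≠ N.root := by
      rintro rfl
      have := hO.pos_done _ hO.done_root
      omega
    have hs1 : Steps popProgram 5 ⟨60, reg, arr⟩ ⟨65, _, _⟩ :=
      .jumpLt_neg rfl (by rw [hrs, hreg]; omega) <| .load rfl <| .store rfl <| .load rfl <|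
        .store rfl <| .refl _
    refine (hs1.reward_le T).trans ?_
    have hsplit : arcsAt N S q s = arcsBelow N enc y M ∪ arcsAt N S q (s - 1) := by
      ext a
      simp only [arcsAt, arcsBelow, Finset.mem_filter, Finset.mem_univ, true_and,
        Finset.mem_union, hencM a, and_true]
      constructor
      · rintro ⟨h1, h2⟩
        by_cases h3 : S.pos (N.tail a) = s
        · exact Or.inl (hO.pos_inj _ _ (by rw [h3, hy]) (by omega))
        · exact Or.inr ⟨h1, by omega⟩
      · rintro (h1 | ⟨h1, h2⟩)
        · rw [h1, hy]; omega
        · omega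
    have hdisj : Disjoint (arcsBelow N enc y M) (arcsAt N S q (s - 1)) := by
      rw [Finset.disjoint_left]
      intro a ha ha'
      simp only [arcsAt, arcsBelow, Finset.mem_filter, Finset.mem_univ, true_and] at ha ha'
      rw [ha.1, hy] at ha'
      omega
    have hloop := reward_toss_loop (N := N) (enc := enc) (kind := kind) (rv := rv) (M := M)
      (coin := coin) (τ := τ) (r := r) (ω := ω) henc hpos (y := y)
      (fun a ha => hcoin a (by rw [ha]; exact hyr)) T
      -- The continuation of the toss loop is the jump back together with the pops of all smaller
      -- positions.
      (F := fun ω' => ((2 + (8 * (s - q) + 6 * (arcsAt N S q (s - 1)).card + 1) : ℕ) : ENNReal) *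
        τ + N.avg (arcsAt N S q (s - 1)) F ω') M
      (reg := Function.update (Function.update reg 14 (arr 12 (reg 10))) 16
        (writeArr arr 10 (Function.update reg 14 (arr 12 (reg 10)) 14)
          (Function.update reg 14 (arr 12 (reg 10)) 2) 7
          (Function.update reg 14 (arr 12 (reg 10)) 14)))
      (arr := writeArr (writeArr arr 10 (Function.update reg 14 (arr 12 (reg 10)) 14)
          (Function.update reg 14 (arr 12 (reg 10)) 2)) 9
          (Function.update (Function.update reg 14 (arr 12 (reg 10))) 16
            (writeArr arr 10 (Function.update reg 14 (arr 12 (reg 10)) 14)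
              (Function.update reg 14 (arr 12 (reg 10)) 2) 7
              (Function.update reg 14 (arr 12 (reg 10)) 14)) 14)
          (Function.update (Function.update reg 14 (arr 12 (reg 10))) 16
            (writeArr arr 10 (Function.update reg 14 (arr 12 (reg 10)) 14)
              (Function.update reg 14 (arr 12 (reg 10)) 2) 7
              (Function.update reg 14 (arr 12 (reg 10)) 14)) 16))
      (by simpa using hM.adj) (by simpa using hM.bit) (by simp [hM.zero])
      (by simpa [hrs, hypath] using hM.adj.first y) ?_
    · refine (add_le_add_right hloop _).trans (le_of_eq ?_)
      rw [hsplit, ← avg_avg hdisj, Finset.card_union_of_disjoint hdisj]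
      have h1 : N.avg (arcsBelow N enc y M) (fun ω' =>
          ((2 + (8 * (s - q) + 6 * (arcsAt N S q (s - 1)).card + 1) : ℕ) : ENNReal) *
            τ + N.avg (arcsAt N S q (s - 1)) F ω') ω =
          ((2 + (8 * (s - q) + 6 * (arcsAt N S q (s - 1)).card + 1) : ℕ) : ENNReal) * τ +
            N.avg (arcsBelow N enc y M) (N.avg (arcsAt N S q (s - 1)) F) ω := by
        rw [avg]
        simp only [mul_add, Finset.sum_add_distrib, ← Finset.sum_mul, sum_wt, one_mul]
        rfl
      rw [h1, show s + 1 - q = s - q + 1 by omega]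
      push_cast
      ring
    · intro ω' reg' arr' h1 h2 h3 hag
      have hs2 : Steps popProgram 2 ⟨71, reg', arr'⟩ ⟨60, _, arr'⟩ :=
        .pred rfl <| .jump rfl <| .refl _
      refine (hs2.reward_le T).trans ?_
      rw [Nat.cast_add, add_mul, add_assoc]
      gcongr
      have hs' : s - 1 + 1 - q = s - q := by omega
      have hpos0 : ∀ v, S.pos v = s → v = y := fun v hv =>
        hO.pos_inj _ _ (by rw [hv, hy]) (by omega)
      have hne : ∀ v : Fin n, v ≠ y → (v : ℕ) ≠ y := fun v hv h => hv (Fin.ext h)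
      have hcut : ∀ v : Fin n, v ≠ y → (s ≤ S.pos v ↔ s + 1 ≤ S.pos v) := by
        intro v hv
        have : S.pos v ≠ s := fun h => hv (hpos0 v h)
        omega
      rw [← hs']
      refine ih (s - 1) (by omega) (by omega) ?_ ?_ ?_ ?_ (by omega) ?_
      · intro v; simp [h2, hfirst]
      · rw [show s - 1 + 1 = s by omega]
        constructor
        case bit => exact h3
        case pos =>
          intro v
          have h4 := hM.pos v
          by_cases hv : v = y
          · subst hv
            simp [h2, hrs, hypath, hM.zero, Search.cut, hy]
          · simp only [Search.cut] at h4 ⊢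
            simp [h2, hrs, hypath, hne v hv, h4, hcut v hv]
        case ptr =>
          intro v
          have h4 := hM.ptr v
          by_cases hv : v = y
          · subst hv
            simp [h2, hrs, hypath, Search.cut, hy, hfirst]
          · simp only [Search.cut] at h4 ⊢
            simp [h2, hrs, hypath, hne v hv, h4, hcut v hv]
        case path =>
          intro v hv
          have h4 := hM.path v
          simp only [Search.cut] at h4 hv ⊢
          have h5 : ¬ s ≤ S.pos v := fun h => by rw [if_pos h] at hv; omega
          rw [if_neg h5] at hv ⊢
          rw [if_neg (by omega)] at h4
          simpa [h2] using h4 hv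
        case start =>
          intro i hi hi'
          have := hM.start i hi hi'
          simpa [h2, Search.cut] using this
        case actPos =>
          intro i hi hi'
          have := hM.actPos i hi hi'
          simpa [h2, Search.cut] using this
        case done =>
          intro v
          have := hM.done v
          simpa [h2, Search.cut] using this
        case comps => simpa [h1, Search.cut] using hM.comps
        case act => simpa [h1, Search.cut] using hM.act
        all_goals simp [Search.cut, h1, h2, hM.adj, hM.num, hM.zero, hM.one, hrs,
          hM.cur, hM.bfs_head, hM.bfs_tail, hM.out, hM.queue, hM.queued, hM.expanded]
      · simp [h1, hreg]
      · intro ω'' reg'' arr'' hM'' h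
        refine hpost ω'' reg'' arr'' hM'' fun a ha => ?_
        rw [hsplit, Finset.mem_union, not_or] at ha
        rw [h a ha.2, hag a ha.1]
      · simp [h1, hrs]

theorem Mem.exists_pop_end {first : Fin n → ℕ}
    (hM : Mem N enc kind rv M (S.cut first (S.start S.comps)) cur ω reg arr) (hw : 0 < S.act) :
    ∃ k reg' arr', k ≤ 4 ∧ Steps popProgram k ⟨73, reg, arr⟩
        ⟨if S.act - 1 = 0 then 25 else 38, reg', arr'⟩ ∧
      Mem N enc kind rv M (S.popTop first) cur ω reg' arr' := by
  have hact : reg 12 = S.act := hM.act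
  have hcomps : reg 11 = S.comps := hM.comps
  have hM' : Mem N enc kind rv M (S.popTop first) cur ω (Function.update
      (Function.update reg 11 (reg 11 - 1)) 12 (Function.update reg 11 (reg 11 - 1) 12 - 1))
      arr := by
    constructor
    case comps => simp [hcomps, Search.popTop]
    case act => simp [hact, Search.popTop]
    case size => simpa [Search.popTop, Search.cut] using hM.size
    case start =>
      intro i hi hi'
      simp only [Search.popTop] at hi' ⊢
      exact hM.start i hi (by simp only [Search.cut]; omega)
    case actPos =>
      intro i hi hi'
      simp only [Search.popTop] at hi' ⊢
      exact hM.actPos i hi (by simp only [Search.cut]; omega)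
    case path => exact hM.path
    case pos => exact hM.pos
    case ptr => exact hM.ptr
    case done => exact hM.done
    all_goals simp [hM.adj, hM.bit, hM.num, hM.zero, hM.one,
      hM.cur, hM.bfs_head, hM.bfs_tail, hM.out, hM.queue, hM.queued, hM.expanded]
  by_cases h : S.act - 1 = 0
  · rw [if_pos h]
    exact ⟨3, _, _, by omega, .pred rfl <| .pred rfl <|
      .jumpEq_pos rfl (by simp [hact, hM.zero, h]) <| .refl _, hM'⟩
  · rw [if_neg h]
    exact ⟨4, _, _, by omega, .pred rfl <| .pred rfl <|
      .jumpEq_neg rfl (by simp only [Function.update_self]; simpa [hact, hM.zero] using h) <|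
      .jump rfl <| .refl _, hM'⟩

end

end Search

/-! ### Amortised analysis of the search. -/

namespace Search

set_option linter.unusedSectionVars false

open CoinDigraph Program

section

open scoped Classical

variable {n : ℕ} {A : Type*} [Fintype A]

/-- A bound on the number of instructions until the next pop. -/
noncomputable def pot (S : Search (Fin n)) (N : CoinDigraph (Fin n) A) (enc : A → ℕ) (cur : ℕ) :
    ℕ :=
  -- An unread arc pays for its reading. An unvisited vertex pays 60 for its later share of `comps`,
  -- `act` and `size`, which leaves 40 for the push itself.
  20 * (Finset.univ.filter fun a => enc a ≤ S.ptr (N.tail a)).card +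
    100 * (Finset.univ.filter fun v => S.pos v = 0 ∧ S.done v = false).card +
    20 * S.comps + 20 * S.act + 20 * S.size + 10 * (n - cur)

variable {N : CoinDigraph (Fin n) A} {enc kind : A → ℕ} {rv : A → A} {M : ℕ}
  {S : Search (Fin n)} {cur : ℕ} {ω : A → Bool} {reg : ℕ → ℕ} {arr : ℕ → ℕ → ℕ}
  {coin : ℕ → PMF Bool} {τ : ENNReal} {r : Config → ENNReal}

theorem pot_push {y : Fin n} (hy : S.pos y = 0) (hd : S.done y = false) :
    (S.push y).pot N enc cur + 40 ≤ S.pot N enc cur := by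
  have h : (Finset.univ.filter fun v => (S.push y).pos v = 0 ∧ (S.push y).done v = false).card + 1
      ≤ (Finset.univ.filter fun v => S.pos v = 0 ∧ S.done v = false).card := by
    rw [← Finset.card_insert_of_notMem (a := y) fun h => by
      have h1 := (Finset.mem_filter.1 h).2.1
      rw [show (S.push y).pos y = S.size + 1 from Function.update_self ..] at h1
      omega]
    refine Finset.card_le_card fun v hv => ?_
    rcases Finset.mem_insert.1 hv with rfl | hv
    · simp [hy, hd]
    · simp only [Finset.mem_filter, Finset.mem_univ, true_and] at hv ⊢
      by_cases hvy : v = y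
      · subst hvy; exact ⟨hy, hd⟩
      · rwa [show (S.push y).pos v = S.pos v from Function.update_of_ne hvy ..] at hv
  have h1 : (S.push y).ptr = S.ptr := rfl
  have h2 : (S.push y).comps = S.comps + 1 := rfl
  have h3 : (S.push y).act = S.act + 1 := rfl
  have h4 : (S.push y).size = S.size + 1 := rfl
  unfold pot
  rw [h1, h2, h3, h4]
  omega

theorem pot_advance {a : A} {p : ℕ} (ha : S.ptr (N.tail a) = enc a) (hp : p < enc a) :
    (S.advance (N.tail a) p).pot N enc cur + 20 ≤ S.pot N enc cur := by
  have h : (Finset.univ.filter fun b => enc b ≤ (S.advance (N.tail a) p).ptr (N.tail b)).card + 1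
      ≤ (Finset.univ.filter fun b => enc b ≤ S.ptr (N.tail b)).card := by
    rw [← Finset.card_insert_of_notMem (a := a) fun h => by
      have h1 := (Finset.mem_filter.1 h).2
      rw [show (S.advance (N.tail a) p).ptr (N.tail a) = p from Function.update_self ..] at h1
      omega]
    refine Finset.card_le_card fun b hb => ?_
    rcases Finset.mem_insert.1 hb with rfl | hb
    · simp [ha]
    · simp only [Finset.mem_filter, Finset.mem_univ, true_and] at hb ⊢
      by_cases hab : N.tail b = N.tail a
      · rw [hab, show (S.advance (N.tail a) p).ptr (N.tail a) = p from
          Function.update_self ..] at hb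
        rw [hab, ha]
        omega
      · rwa [show (S.advance (N.tail a) p).ptr (N.tail b) = S.ptr (N.tail b) from
          Function.update_of_ne hab ..] at hb
  have h1 : (S.advance (N.tail a) p).pos = S.pos := rfl
  have h2 : (S.advance (N.tail a) p).comps = S.comps := rfl
  have h3 : (S.advance (N.tail a) p).act = S.act := rfl
  have h4 : (S.advance (N.tail a) p).size = S.size := rfl
  have h5 : (S.advance (N.tail a) p).done = S.done := rfl
  unfold pot
  rw [h1, h2, h3, h4, h5]
  omega

theorem pot_finish (h1 : 0 < S.act) :
    S.finish.pot N enc cur + (20 + 20 * S.size) ≤ S.pot N enc cur := by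
  have h : (Finset.univ.filter fun v => S.finish.pos v = 0 ∧ S.finish.done v = false).card
      ≤ (Finset.univ.filter fun v => S.pos v = 0 ∧ S.done v = false).card := by
    refine Finset.card_le_card fun v hv => ?_
    simp only [Finset.mem_filter, Finset.mem_univ, true_and] at hv ⊢
    have hv2 : (S.done v || decide (0 < S.pos v)) = false := hv.2
    rw [Bool.or_eq_false_iff, decide_eq_false_iff_not] at hv2
    exact ⟨by omega, hv2.1⟩
  have h2 : S.finish.comps = 0 := rfl
  have h3 : S.finish.act = 0 := rfl
  have h4 : S.finish.size = 0 := rfl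
  have h5 : S.finish.ptr = S.ptr := rfl
  unfold pot
  rw [h2, h3, h4, h5]
  omega

/-- A pop makes the vertices of the component unvisited and their arcs unread again; this is the
only way in which the potential grows. -/
theorem pot_popTop {first : Fin n → ℕ} (hw : 0 < S.act) (hs : S.start S.comps ≤ S.size + 1) :
    (S.popTop first).pot N enc cur + 20 ≤
      S.pot N enc cur + 20 * (N.out S.top).card + 100 * S.top.card := by
  have h : (Finset.univ.filter fun v =>
        (S.popTop first).pos v = 0 ∧ (S.popTop first).done v = false).card
      ≤ (Finset.univ.filter fun v => S.pos v = 0 ∧ S.done v = false).card + S.top.card := by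
    refine (Finset.card_le_card fun v hv => ?_).trans (Finset.card_union_le _ _)
    simp only [Finset.mem_filter, Finset.mem_univ, true_and, Finset.mem_union, mem_top] at hv ⊢
    by_cases h1 : S.start S.comps ≤ S.pos v
    · exact Or.inr h1
    · rw [show (S.popTop first).pos v = S.pos v from if_neg h1] at hv
      exact Or.inl hv
  have h' : (Finset.univ.filter fun a => enc a ≤ (S.popTop first).ptr (N.tail a)).card
      ≤ (Finset.univ.filter fun a => enc a ≤ S.ptr (N.tail a)).card + (N.out S.top).card := by
    refine (Finset.card_le_card fun a ha => ?_).trans (Finset.card_union_le _ _)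
    simp only [Finset.mem_filter, Finset.mem_univ, true_and, Finset.mem_union, mem_top,
      mem_out] at ha ⊢
    by_cases h1 : S.start S.comps ≤ S.pos (N.tail a)
    · exact Or.inr h1
    · rw [show (S.popTop first).ptr (N.tail a) = S.ptr (N.tail a) from if_neg h1] at ha
      exact Or.inl ha
  have h2 : (S.popTop first).comps = S.comps - 1 := rfl
  have h3 : (S.popTop first).act = S.act - 1 := rfl
  have h4 : (S.popTop first).size = S.start S.comps - 1 := rfl
  unfold pot
  rw [h2, h3, h4]
  omega

theorem pot_exhaust (hw : 0 < S.act) : S.exhaust.pot N enc cur + 20 = S.pot N enc cur := by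
  have h1 : S.exhaust.ptr = S.ptr := rfl
  have h2 : S.exhaust.pos = S.pos := rfl
  have h3 : S.exhaust.done = S.done := rfl
  have h4 : S.exhaust.comps = S.comps := rfl
  have h5 : S.exhaust.act = S.act - 1 := rfl
  have h6 : S.exhaust.size = S.size := rfl
  unfold pot
  rw [h1, h2, h3, h4, h5, h6]
  omega

theorem pot_comps {c : ℕ} (hc : c ≤ S.comps) :
    ({ S with comps := c } : Search (Fin n)).pot N enc cur + 20 * (S.comps - c) =
      S.pot N enc cur := by
  have h1 : ({ S with comps := c } : Search (Fin n)).ptr = S.ptr := rfl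
  have h2 : ({ S with comps := c } : Search (Fin n)).pos = S.pos := rfl
  have h3 : ({ S with comps := c } : Search (Fin n)).done = S.done := rfl
  have h4 : ({ S with comps := c } : Search (Fin n)).comps = c := rfl
  have h5 : ({ S with comps := c } : Search (Fin n)).act = S.act := rfl
  have h6 : ({ S with comps := c } : Search (Fin n)).size = S.size := rfl
  unfold pot
  rw [h1, h2, h3, h4, h5, h6]
  omega

theorem Ok.size_le_card_top (hO : S.Ok N enc ω) (h0 : 0 < S.start S.comps) :
    S.size + 1 - S.start S.comps ≤ S.top.card := by
  rw [← Nat.card_Icc]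
  refine (Finset.card_le_card fun i hi => ?_).trans (Finset.card_image_le (f := S.pos))
  rw [Finset.mem_Icc] at hi
  obtain ⟨v, hv⟩ := hO.pos_surj i (by omega) hi.2
  exact Finset.mem_image.2 ⟨v, by rw [mem_top, hv]; exact hi.1, hv⟩

/-- Every vertex but the root has an outgoing arc, so work per popped vertex can be charged to
redrawn arcs. -/
theorem card_le_card_out (hdeg : ∀ v, v ≠ N.root → ∃ a, N.tail a = v) {C : Finset (Fin n)}
    (hC : N.root ∉ C) : C.card ≤ (N.out C).card := by
  refine (Finset.card_le_card fun v hv => ?_).trans (Finset.card_image_le (f := N.tail))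
  obtain ⟨a, ha⟩ := hdeg v fun h => hC (h ▸ hv)
  exact Finset.mem_image.2 ⟨a, by rw [mem_out, ha]; exact hv, ha⟩

/-- A block is paid for by the drop of the potential; `K` carries the cost of the output phase
along. -/
theorem Steps.reward_succ_le_of_pot {k p p' T : ℕ} {c c' : Config} {K : ℕ} {U : ENNReal}
    (h : Steps popProgram (k + 1) c c') (hp : k + 1 + p' ≤ p)
    (hc : popProgram.reward coin τ r T c' ≤ ((p' + K : ℕ) : ENNReal) * τ + U) :
    popProgram.reward coin τ r (T + 1) c ≤ ((p + K : ℕ) : ENNReal) * τ + U := by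
  refine (h.reward_succ_le T).trans ((add_le_add_right hc _).trans ?_)
  rw [← add_assoc, ← add_mul, ← Nat.cast_add]
  exact add_le_add_left (mul_le_mul_left (Nat.cast_le.2 (by omega)) _) _

/-- The reward of the search, whatever the rewards of the breadth-first search at its end. -/
theorem reward_le (henc : Function.Injective enc) (hpos : ∀ a, 0 < enc a)
    (hencM : ∀ a, enc a < M) (hcoin : ∀ a, N.tail a ≠ N.root → ∀ b, coin (kind a) b = N.coin a b)
    (hdeg : ∀ v, v ≠ N.root → ∃ a, N.tail a = v) {K : ℕ} {ψ : (A → Bool) → ENNReal}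
    (hbfs : ∀ (S : Search (Fin n)) ω reg arr, Mem N enc kind rv M S n ω reg arr →
      N.ReachesSet ω {N.root} → ∃ k c', Steps popProgram k ⟨86, reg, arr⟩ c' ∧ k ≤ K ∧
        c'.Halted popProgram ∧ r c' ≤ ψ ω)
    (T : ℕ) (S : Search (Fin n)) (cur : ℕ) (ω : A → Bool) (reg : ℕ → ℕ) (arr : ℕ → ℕ → ℕ)
    (hO : S.Ok N enc ω) (hM : Mem N enc kind rv M S cur ω reg arr) (hcur : cur ≤ n)
    (hfin : ∀ v : Fin n, (v : ℕ) < cur → S.done v = true) :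
    popProgram.reward coin τ r T ⟨if S.act = 0 then 25 else 38, reg, arr⟩ ≤
      ((S.pot N enc cur + (K + 1) : ℕ) : ENNReal) * τ + N.limValue (200 * τ) ψ ω := by
  induction T generalizing S cur ω reg arr with
  | zero =>
    have : ¬ Config.Halted popProgram ⟨if S.act = 0 then 25 else 38, reg, arr⟩ := by
      have : popProgram.length = 109 := rfl
      simp only [Config.Halted, this]
      split_ifs <;> omega
    rw [reward, if_neg this]
    exact zero_le
  | succ T ih =>
    by_cases hw : S.act = 0
    · rw [if_pos hw]
      by_cases hcn : cur = n
      · -- all vertices are finished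
        subst hcn
        obtain ⟨k, c', h1, h2, h3, h4⟩ := hbfs S ω reg arr hM
          (hO.reachesSet fun v => hfin v v.2)
        have hs : Steps popProgram 1 ⟨25, reg, arr⟩ ⟨86, reg, arr⟩ :=
          .jumpEq_pos rfl (by rw [hM.cur, hM.num]) <| .refl _
        refine ((hs.trans h1).reward_le _).trans ?_
        rw [reward_of_halted _ h3]
        gcongr ?_ * τ + ?_
        · exact_mod_cast (by omega)
        · exact h4.trans (le_limValue (hO.reachesSet fun v => hfin v v.2))
      · have hlt : cur < n := by omega
        have hd := hM.done ⟨cur, hlt⟩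
        by_cases hdone : S.done ⟨cur, hlt⟩ = true
        · -- the vertex is finished
          rw [hdone] at hd
          have hs : Steps popProgram 5 ⟨25, reg, arr⟩ ⟨25, _, arr⟩ :=
            .jumpEq_neg rfl (by rw [hM.cur, hM.num]; omega) <| .load rfl <|
              .jumpEq_neg rfl (by simp [hM.cur, hd, hM.zero]) <| .succ rfl <| .jump rfl <| .refl _
          refine Steps.reward_succ_le_of_pot hs (p' := S.pot N enc (cur + 1)) ?_ ?_
          · unfold pot; omega
          · have := ih S (cur + 1) ω (Function.update (Function.update reg 8 (arr 11 (reg 13))) 13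
              (Function.update reg 8 (arr 11 (reg 13)) 13 + 1)) arr hO ?_ hlt ?_
            · rwa [if_pos hw] at this
            · have := hM
              constructor
              case cur => simp [hM.cur]
              case path => exact hM.path
              case start => exact hM.start
              case actPos => exact hM.actPos
              all_goals simp [hM.adj, hM.bit, hM.num, hM.zero, hM.one, hM.size, hM.comps,
                hM.act, hM.cur, hM.bfs_head, hM.bfs_tail, hM.out, hM.queue, hM.queued,
                hM.expanded, hM.pos, hM.done, hM.ptr]
            · intro v hv
              by_cases hvc : (v : ℕ) = cur
              · have : v = ⟨cur, hlt⟩ := Fin.ext hvc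
                rwa [this]
              · exact hfin v (by omega)
        · -- start a new path
          have hdone' : S.done ⟨cur, hlt⟩ = false := by simpa using hdone
          rw [hdone'] at hd
          obtain ⟨-, hsize⟩ := hO.eq_zero_of_act hw
          have hp : S.pos ⟨cur, hlt⟩ = 0 := by have := hO.pos_le ⟨cur, hlt⟩; omega
          have hs : Steps popProgram 4 ⟨25, reg, arr⟩ ⟨31, _, arr⟩ :=
            .jumpEq_neg rfl (by rw [hM.cur, hM.num]; omega) <| .load rfl <|
              .jumpEq_pos rfl (by simp [hM.cur, hd, hM.zero]) <| .copy rfl <| .refl _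
          obtain ⟨reg', arr', hs', hM'⟩ := (hM.congr_reg
            (reg' := Function.update (Function.update reg 8 (arr 11 (reg 13))) 14
              (Function.update reg 8 (arr 11 (reg 13)) 13)) (by simp)).exists_push hO.pos_le
            (y := ⟨cur, hlt⟩) (by simp [hM.cur]) hp
          refine Steps.reward_succ_le_of_pot (k := 10) (hs.trans hs')
            (p' := (S.push ⟨cur, hlt⟩).pot N enc cur) ?_ ?_
          · have := pot_push (N := N) (enc := enc) (cur := cur) hp hdone'
            omega
          · have := ih _ cur ω reg' arr' (hO.push hp hdone' (Or.inl hsize)) hM' hcur hfin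
            rwa [if_neg (by simp [Search.push])] at this
    · rw [if_neg hw]
      have hw' : 0 < S.act := by omega
      have hrange := hO.act_range S.act hw' le_rfl
      have hc := hO.comps_pos_of_act hw'
      obtain ⟨x, hx⟩ := hO.pos_surj _ hrange.1 hrange.2
      have hx' : 0 < S.pos x := by omega
      obtain ⟨reg₁, hs₁, hM₁, h15, h16, h17⟩ := hM.exists_fetch hw' hx hx'
      rcases hO.ptr_arc x with hp0 | ⟨a, hax, hap⟩
      · rw [hp0] at h16
        have hst := hM₁.start S.comps hc le_rfl
        by_cases he : S.actPos S.act = S.start S.comps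
        · -- pop the last component
          have htrap := hO.isTrap_top hpos hw' hx hp0 he
          have hs : Steps popProgram 3 ⟨41, reg₁, arr⟩ ⟨60, _, arr⟩ :=
            .jumpEq_pos rfl (by rw [h16, hM₁.zero]) <| .load rfl <|
              .jumpEq_pos rfl (by simp [h17, hM₁.comps, hst, he]) <| .refl _
          have h0 := hO.start_pos hc le_rfl
          have hsz := hO.start_le_size hc le_rfl
          refine ((hs₁.trans hs).reward_succ_le (k := 5) T).trans ?_
          have harcs : arcsAt N S (S.start S.comps) S.size = N.out S.top := by
            ext a
            simp [arcsAt, mem_out, mem_top, hO.pos_le]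
          have hloop := reward_pop_loop (N := N) (enc := enc) (kind := kind) (rv := rv) (M := M)
            (S := S) (cur := cur) (ω := ω) (coin := coin) (τ := τ) (r := r) (arr := arr)
            (reg := Function.update reg₁ 8 (arr 13 (reg₁ 11))) hO henc hpos hencM hcoin T
            (F := fun ω' => ((4 + ((S.pot N enc cur + 20 * (N.out S.top).card +
              100 * S.top.card - 20) + (K + 1)) : ℕ) : ENNReal) * τ +
                N.limValue (200 * τ) ψ (mix (N.out S.top) ω' ω))
            (first := fun v => arr 7 v) (q := S.start S.comps) h0 S.size (by omega) le_rfl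
            (fun _ => rfl) ?_ (by simp [h17, he]) ?_
          · refine (add_le_add_right hloop _).trans ?_
            rw [harcs]
            have h1 : N.avg (N.out S.top) (fun ω' => ((4 + ((S.pot N enc cur +
                20 * (N.out S.top).card + 100 * S.top.card - 20) + (K + 1)) : ℕ) : ENNReal) * τ +
                N.limValue (200 * τ) ψ (mix (N.out S.top) ω' ω)) ω =
                ((4 + ((S.pot N enc cur + 20 * (N.out S.top).card + 100 * S.top.card - 20) +
                  (K + 1)) : ℕ) : ENNReal) * τ +
                N.avg (N.out S.top) (N.limValue (200 * τ) ψ) ω := by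
              rw [avg]
              simp only [mul_add, Finset.sum_add_distrib, ← Finset.sum_mul, sum_wt, one_mul]
              congr 1
              refine Finset.sum_congr rfl fun η _ => ?_
              congr 2
              ext a
              by_cases ha : a ∈ N.out S.top <;> simp [mix, ha]
            rw [h1, ← add_assoc, ← add_assoc, ← add_mul, ← add_mul, ← Nat.cast_add,
              ← Nat.cast_add]
            have hv := add_avg_le_limValue (κ := 200 * τ) (ψ := ψ) htrap.1 htrap.2
            have hcard := card_le_card_out hdeg htrap.2
            have hcard' := hO.size_le_card_top h0
            have hpp := pot_popTop (N := N) (enc := enc) (cur := cur) (S := S)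
              (first := fun v => arr 7 v) hw' (by omega)
            have htop : 0 < S.top.card := Finset.card_pos.2 htrap.1.1
            -- A popped vertex costs 8 instructions and adds at most 100 to the potential; a redrawn
            -- arc costs 6 and adds at most 20. There are no more popped vertices than redrawn arcs,
            -- so 200 per arc is more than enough, and the drop of 20 covers the remaining
            -- instructions.
            calc _ ≤ ((S.pot N enc cur + (K + 1) + 200 * (N.out S.top).card : ℕ) : ENNReal) * τ +
                  N.avg (N.out S.top) (N.limValue (200 * τ) ψ) ω := by
                  refine add_le_add_left (mul_le_mul_left (Nat.cast_le.2 ?_) _) _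
                  omega
              _ = ((S.pot N enc cur + (K + 1) : ℕ) : ENNReal) * τ + (200 * τ * N.cost S.top +
                  N.avg (N.out S.top) (N.limValue (200 * τ) ψ) ω) := by
                  rw [cost]
                  push_cast
                  ring
              _ ≤ _ := by gcongr
          · have hcut : ∀ v, ¬ S.size + 1 ≤ S.pos v := fun v => by have := hO.pos_le v; omega
            have hM₂ := hM₁.congr_reg (reg' := Function.update reg₁ 8 (arr 13 (reg₁ 11))) (by simp)
            exact { hM₂ with
              pos := fun v => by simp only [Search.cut, if_neg (hcut v)]; exact hM₂.pos v
              ptr := fun v => by simp only [Search.cut, if_neg (hcut v)]; exact hM₂.ptr v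
              path := fun v hv => by
                simp only [Search.cut, if_neg (hcut v)] at hv ⊢
                exact hM₂.path v hv }
          · intro ω' reg' arr' hM' hag
            rw [harcs] at hag
            obtain ⟨k, reg₂, arr₂, hk, hs₂, hM₂⟩ := hM'.exists_pop_end hw'
            refine (hs₂.reward_le T).trans ?_
            have hmix : mix (N.out S.top) ω' ω = ω' := by
              ext a
              by_cases ha : a ∈ N.out S.top
              · rw [mix_of_mem ha]
              · rw [mix_of_notMem ha, hag a ha]
            have hO' : (S.popTop fun v => arr 7 v).Ok N enc ω' :=
              hO.popTop hpos hw' hx hp0 he (fun a ha => (hag a (by rwa [mem_out])).symm) hencM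
                hM.adj.first
            have hpp := pot_popTop (N := N) (enc := enc) (cur := cur) (S := S)
              (first := fun v => arr 7 v) hw' (by omega)
            refine (add_le_add_right (ih _ cur ω' reg₂ arr₂ hO' hM₂ hcur hfin) _).trans ?_
            rw [hmix, ← add_assoc, ← add_mul, ← Nat.cast_add]
            exact add_le_add_left (mul_le_mul_left (Nat.cast_le.2 (by omega)) _) _
        · -- deactivate the last active vertex
          have hs : Steps popProgram 5 ⟨41, reg₁, arr⟩ ⟨38, _, arr⟩ :=
            .jumpEq_pos rfl (by rw [h16, hM₁.zero]) <| .load rfl <|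
              .jumpEq_neg rfl (by simpa [h17, hM₁.comps, hst] using he) <| .pred rfl <|
              .jump rfl <| .refl _
          have hO' := hO.exhaust hw' hx hp0 he
          have hM' : Mem N enc kind rv M S.exhaust cur ω (Function.update (Function.update reg₁ 8
              (arr 13 (reg₁ 11))) 12 (Function.update reg₁ 8 (arr 13 (reg₁ 11)) 12 - 1)) arr := by
            have hM := hM₁
            constructor
            case act => simp [Search.exhaust, hM.act]
            case path => exact hM.path
            case start => exact hM.start
            case actPos => exact fun i hi hi' => hM.actPos i hi (hi'.trans (Nat.sub_le _ _))
            all_goals simp [Search.exhaust, hM.adj, hM.bit, hM.num, hM.zero, hM.one, hM.size,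
              hM.comps, hM.cur, hM.bfs_head, hM.bfs_tail, hM.out, hM.queue, hM.queued,
              hM.expanded, hM.pos, hM.done, hM.ptr]
          refine Steps.reward_succ_le_of_pot (k := 7) (hs₁.trans hs)
            (p' := S.exhaust.pot N enc cur) ?_ ?_
          · have := pot_exhaust (N := N) (enc := enc) (cur := cur) hw'
            omega
          -- The first vertex of the last component is still active.
          · have hact : S.exhaust.act ≠ 0 := by
              intro h0
              obtain ⟨i, hi, hi', hij⟩ := hO'.comps_act S.comps hc le_rfl
              omega
            have := ih _ cur ω _ arr hO' hM' hcur hfin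
            rwa [if_neg hact] at this
      · subst hax
        rw [← hap] at h16
        have hpa := hpos a
        rcases hbit : ω a with _ | _
        · -- the arc is absent
          have hs : Steps popProgram 3 ⟨41, reg₁, arr⟩ ⟨51, _, arr⟩ :=
            .jumpEq_neg rfl (by rw [h16, hM₁.zero]; omega) <| .load rfl <|
              .jumpEq_pos rfl (by simp [h16, hM₁.bit, hbit, hM₁.zero]) <| .refl _
          obtain ⟨p, reg', arr', hs', hp, hM'⟩ := (hM₁.congr_reg (reg' := Function.update reg₁ 8
            (arr 8 (reg₁ 16))) (by simp)).exists_advance (a := a) (by simp [h15]) (by simp [h16])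
          have hO' := hO.advance henc hx' hap.symm hp fun h => by simp [hbit] at h
          refine Steps.reward_succ_le_of_pot (k := 8) ((hs₁.trans hs).trans hs')
            (p' := (S.advance (N.tail a) p).pot N enc cur) ?_ ?_
          · have := pot_advance (N := N) (enc := enc) (cur := cur) hap.symm hp.lt
            omega
          · have := ih _ cur ω _ arr' hO' hM' hcur hfin
            rwa [if_neg (by simpa [Search.advance] using hw)] at this
        · have hreach : N.Reach ω (N.tail a) (N.head a) := .single ⟨a, rfl, rfl, hbit⟩
          obtain ⟨reg₂, hs₂, hM₂, h14, h8, h15', h16'⟩ := hM₁.exists_fetch_arc h16 hpa hbit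
          have hs₂' := hs₁.trans hs₂
          by_cases hdone : S.done (N.head a) = true
          · -- the path reaches a finished vertex
            have hs : Steps popProgram 1 ⟨46, reg₂, arr⟩ ⟨77, _, arr⟩ :=
              .jumpEq_pos rfl (by rw [h8, hM₂.one, hdone]; rfl) <| .refl _
            obtain ⟨reg', arr', hs', hM'⟩ := hM₂.exists_finish hO
            have hO' := hO.finish hw' hx hdone hreach
            have hs4 : Steps popProgram (12 + 6 * S.size + 1) ⟨38, reg, arr⟩ ⟨25, reg', arr'⟩ := by
              have h := (hs₂'.trans hs).trans hs'
              rwa [show 3 + 5 + 1 + (6 * S.size + 4) = 12 + 6 * S.size + 1 by omega] at h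
            refine Steps.reward_succ_le_of_pot hs4
              (p' := S.finish.pot N enc cur) ?_ ?_
            · have := pot_finish (N := N) (enc := enc) (cur := cur) hw'
              omega
            · have := ih _ cur ω _ arr' hO' hM' hcur fun v hv => by simp [Search.finish, hfin v hv]
              rwa [if_pos (show S.finish.act = 0 from rfl)] at this
          · have hdone' : S.done (N.head a) = false := by simpa using hdone
            have hs : Steps popProgram 2 ⟨46, reg₂, arr⟩ ⟨48, _, arr⟩ :=
              .jumpEq_neg rfl (by rw [h8, hM₂.one, hdone']; simp) <| .load rfl <| .refl _
            have hM₃ := hM₂.congr_reg (reg' := Function.update reg₂ 17 (arr 10 (reg₂ 14)))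
              (by simp)
            have h17' : Function.update reg₂ 17 (arr 10 (reg₂ 14)) 17 = S.pos (N.head a) := by
              simp [h14, hM₂.pos]
            by_cases hp0 : S.pos (N.head a) = 0
            · -- extend the path
              have hs3 : Steps popProgram 1 ⟨48, Function.update reg₂ 17 (arr 10 (reg₂ 14)), arr⟩
                  ⟨31, _, arr⟩ :=
                .jumpEq_pos rfl (by rw [h17', hM₃.zero, hp0]) <| .refl _
              obtain ⟨reg', arr', hs', hM'⟩ := hM₃.exists_push hO.pos_le (y := N.head a)
                (by simpa using h14) hp0
              have hO' := hO.push hp0 hdone' (Or.inr ⟨_, hx, hw', hreach⟩)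
              refine Steps.reward_succ_le_of_pot (k := 17)
                (((hs₂'.trans hs).trans hs3).trans hs')
                (p' := (S.push (N.head a)).pot N enc cur) ?_ ?_
              · have := pot_push (N := N) (enc := enc) (cur := cur) hp0 hdone'
                omega
              · have := ih _ cur ω reg' arr' hO' hM' hcur hfin
                rwa [if_neg (by simp [Search.push])] at this
            · -- the arc closes a cycle
              have hs3 : Steps popProgram 1 ⟨48, Function.update reg₂ 17 (arr 10 (reg₂ 14)), arr⟩
                  ⟨49, _, arr⟩ :=
                .jumpEq_neg rfl (by rw [h17', hM₃.zero]; exact hp0) <| .refl _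
              have hsx : S.start S.comps ≤ S.pos (N.tail a) := by
                rw [hx]; exact hO.start_le_actPos hc le_rfl
              obtain ⟨k, c, reg₄, hs4, hc1, hc2, hk, hO4, hM4, hcy, h15'', h16''⟩ :=
                hM₃.exists_merge hO hsx hx' h17' (by omega) hreach
              obtain ⟨p, reg', arr', hs', hp, hM'⟩ := hM4.exists_advance (a := a)
                (by rw [h15'', Function.update_of_ne (by decide), h15', h15])
                (by rw [h16'', Function.update_of_ne (by decide), h16', h16])
              -- After the merges both ends of the arc lie in the last component, so the arc may
              -- count as explored.
              have hO' := hO4.advance henc hx' hap.symm hp fun _ =>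
                ⟨(by omega : 0 < S.pos (N.head a)), fun i hi hi' =>
                  iff_of_true ((hO4.start_le hi hi' le_rfl).trans
                    ((hO.start_le hc2 hc1 le_rfl).trans hsx))
                    ((hO4.start_le hi hi' le_rfl).trans hcy)⟩
              have hs5 : Steps popProgram (13 + k + 1) ⟨38, reg, arr⟩ ⟨38, reg', arr'⟩ := by
                have h := (((hs₂'.trans hs).trans hs3).trans hs4).trans hs'
                rwa [show 3 + 5 + 2 + 1 + k + 3 = 13 + k + 1 by omega] at h
              refine Steps.reward_succ_le_of_pot hs5
                (p' := (({ S with comps := c } : Search (Fin n)).advance (N.tail a) p).pot N enc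
                  cur) ?_ ?_
              · have h1 := pot_advance (S := { S with comps := c }) (N := N) (enc := enc)
                  (cur := cur) hap.symm hp.lt
                have h2 := pot_comps (S := S) (N := N) (enc := enc) (cur := cur) hc1
                omega
              · have := ih _ cur ω reg' arr' hO' hM' hcur hfin
                rwa [if_neg (by simpa [Search.advance] using hw)] at this

end

end Search

/-! ## Breadth-first search -/

namespace CoinDigraph

set_option linter.unusedSectionVars false

open Search

section

open scoped Classical

variable {n : ℕ} {A : Type*} (N : CoinDigraph (Fin n) A) (enc : A → ℕ) (rv : A → A)
  (ω : A → Bool)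

/-- Append the head of an arc to the queue if the opposite arc is present. -/
def visit (q : List (Fin n)) (a : A) : List (Fin n) :=
  if ω (rv a) = true ∧ N.head a ∉ q then q ++ [N.head a] else q

/-- Visit the arcs out of `u` whose codes are below a bound, in decreasing order. -/
noncomputable def visitBelow (u : Fin n) : ℕ → List (Fin n) → List (Fin n)
  | 0, q => q
  | b + 1, q => if h : ∃ a, N.tail a = u ∧ enc a = b then
      visitBelow u b (N.visit rv ω q h.choose) else visitBelow u b q

/-- The queue after `k` vertices have been expanded. -/
noncomputable def bfs (M : ℕ) : ℕ → List (Fin n)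
  | 0 => [N.root]
  | k + 1 => if h : k < (bfs M k).length then
      N.visitBelow enc rv ω (bfs M k)[k] M (bfs M k) else bfs M k

/-- The vertices in breadth-first order. -/
noncomputable def bfsOrder (M : ℕ) : List (Fin n) := N.bfs enc rv ω M n

variable {N enc rv ω} {u v : Fin n} {q : List (Fin n)} {a : A} {b k l M x : ℕ}

theorem visitBelow_of_notMem (h : ¬ ∃ a, N.tail a = u ∧ enc a = b) :
    N.visitBelow enc rv ω u (b + 1) q = N.visitBelow enc rv ω u b q := by
  rw [visitBelow, dif_neg h]

theorem visitBelow_succ (henc : Function.Injective enc) (ha : N.tail a = u) :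
    N.visitBelow enc rv ω u (enc a + 1) q =
      N.visitBelow enc rv ω u (enc a) (N.visit rv ω q a) := by
  have h : ∃ a', N.tail a' = u ∧ enc a' = enc a := ⟨a, ha, rfl⟩
  rw [visitBelow, dif_pos h, henc h.choose_spec.2]

/-- The model scans all codes downwards, whereas the machine follows links; the skipped codes carry
no arc out of `u`. -/
theorem visitBelow_of_isPrev (h : IsPrev N enc u b x) :
    N.visitBelow enc rv ω u b q = N.visitBelow enc rv ω u (x + 1) q := by
  have hlt := h.lt
  obtain ⟨d, rfl⟩ : ∃ d, b = x + 1 + d := ⟨b - (x + 1), by omega⟩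
  clear hlt
  induction d with
  | zero => rfl
  | succ d ih =>
    rw [← add_assoc, visitBelow_of_notMem]
    · exact ih ⟨by omega, h.arc, fun a ha hb => h.le a ha (by omega)⟩
    · rintro ⟨a, ha, hb⟩
      have := h.le a ha (by omega)
      omega

/-- An induction principle for the loop over the arcs out of a vertex. -/
theorem visitBelow_induction (henc : Function.Injective enc) (P : ℕ → List (Fin n) → Prop)
    (hP : ∀ a q, N.tail a = u → P (enc a + 1) q → P (enc a) (N.visit rv ω q a))
    (hP' : ∀ b q, (¬ ∃ a, N.tail a = u ∧ enc a = b) → P (b + 1) q → P b q) (b : ℕ)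
    (q : List (Fin n)) (h : P b q) : P 0 (N.visitBelow enc rv ω u b q) := by
  induction b generalizing q with
  | zero => exact h
  | succ b ih =>
    by_cases ha : ∃ a, N.tail a = u ∧ enc a = b
    · obtain ⟨a, ha, rfl⟩ := ha
      rw [visitBelow_succ henc ha]
      exact ih _ (hP a q ha h)
    · rw [visitBelow_of_notMem ha]
      exact ih _ (hP' b q ha h)

theorem prefix_visit : q <+: N.visit rv ω q a := by
  rw [visit]
  split_ifs
  · exact List.prefix_append _ _
  · exact List.prefix_rfl

theorem nodup_visit (h : q.Nodup) : (N.visit rv ω q a).Nodup := by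
  rw [visit]
  split_ifs with h1
  · exact List.Nodup.append h (List.nodup_singleton _) (by simpa using h1.2)
  · exact h

theorem mem_visit : v ∈ N.visit rv ω q a ↔ v ∈ q ∨ v = N.head a ∧ ω (rv a) = true := by
  rw [visit]
  split_ifs with h1
  · simp [h1.1]
  · rw [not_and_or, not_not] at h1
    constructor
    · exact Or.inl
    · rintro (h | ⟨rfl, h⟩)
      · exact h
      · exact h1.resolve_left fun h' => h' h

theorem prefix_visitBelow (henc : Function.Injective enc) :
    q <+: N.visitBelow enc rv ω u b q :=
  visitBelow_induction henc (fun _ q' => q <+: q') (fun _ _ _ h => h.trans prefix_visit)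
    (fun _ _ _ h => h) b q List.prefix_rfl

theorem nodup_visitBelow (henc : Function.Injective enc) (h : q.Nodup) :
    (N.visitBelow enc rv ω u b q).Nodup :=
  visitBelow_induction henc (fun _ q' => q'.Nodup) (fun _ _ _ h => nodup_visit h)
    (fun _ _ _ h => h) b q h

theorem mem_visitBelow (henc : Function.Injective enc) :
    v ∈ N.visitBelow enc rv ω u b q ↔
      v ∈ q ∨ ∃ a, N.tail a = u ∧ enc a < b ∧ v = N.head a ∧ ω (rv a) = true := by
  have := visitBelow_induction (N := N) (rv := rv) (ω := ω) (u := u) henc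
    (fun c q' => (v ∈ q' ∨ ∃ a, N.tail a = u ∧ enc a < c ∧ v = N.head a ∧ ω (rv a) = true) ↔
      (v ∈ q ∨ ∃ a, N.tail a = u ∧ enc a < b ∧ v = N.head a ∧ ω (rv a) = true))
    (fun a q' ha h => ?_) (fun c q' hc h => ?_) b q Iff.rfl
  · simpa using this
  · rw [← h, mem_visit, or_assoc]
    refine or_congr_right ⟨?_, ?_⟩
    · rintro (h1 | ⟨a', h1, h2, h3⟩)
      · exact ⟨a, ha, by omega, h1⟩
      · exact ⟨a', h1, by omega, h3⟩
    · rintro ⟨a', h1, h2, h3⟩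
      by_cases haa : a' = a
      · subst haa; exact Or.inl h3
      · have : enc a' ≠ enc a := fun h => haa (henc h)
        exact Or.inr ⟨a', h1, by omega, h3⟩
  · rw [← h]
    refine or_congr_right ⟨?_, ?_⟩
    · rintro ⟨a', h1, h2, h3⟩
      exact ⟨a', h1, by omega, h3⟩
    · rintro ⟨a', h1, h2, h3⟩
      have : enc a' ≠ c := fun h => hc ⟨a', h1, h⟩
      exact ⟨a', h1, by omega, h3⟩

theorem bfs_succ (h : (N.bfs enc rv ω M k)[k]? = some u) :
    N.bfs enc rv ω M (k + 1) = N.visitBelow enc rv ω u M (N.bfs enc rv ω M k) := by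
  obtain ⟨h1, rfl⟩ := List.getElem?_eq_some_iff.1 h
  rw [bfs, dif_pos h1]

/-- Once every queued vertex has been expanded, the queue is final. As it never exceeds length `n`,
`n` rounds always suffice. -/
theorem bfs_of_length_le (h : (N.bfs enc rv ω M k).length ≤ k) (hl : k ≤ l) :
    N.bfs enc rv ω M l = N.bfs enc rv ω M k := by
  induction l, hl using Nat.le_induction with
  | base => rfl
  | succ l hl ih => rw [bfs, dif_neg (by rw [ih]; omega), ih]

theorem bfs_prefix (henc : Function.Injective enc) (hl : k ≤ l) :
    N.bfs enc rv ω M k <+: N.bfs enc rv ω M l := by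
  induction l, hl using Nat.le_induction with
  | base => exact List.prefix_rfl
  | succ l hl ih =>
    rw [bfs]
    split_ifs
    · exact ih.trans (prefix_visitBelow henc)
    · exact ih

theorem bfs_nodup (henc : Function.Injective enc) (k : ℕ) : (N.bfs enc rv ω M k).Nodup := by
  induction k with
  | zero => exact List.nodup_singleton _
  | succ k ih =>
    rw [bfs]
    split_ifs
    · exact nodup_visitBelow henc ih
    · exact ih

theorem length_bfs_le (henc : Function.Injective enc) (k : ℕ) :
    (N.bfs enc rv ω M k).length ≤ n := by
  simpa using (bfs_nodup henc k).length_le_card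

theorem bfs_eq_bfsOrder (henc : Function.Injective enc)
    (h : (N.bfs enc rv ω M k).length ≤ k) : N.bfs enc rv ω M k = N.bfsOrder enc rv ω M := by
  rcases le_total k n with hk | hk
  · exact (bfs_of_length_le h hk).symm
  · exact bfs_of_length_le (length_bfs_le henc n) hk

theorem bfs_prefix_bfsOrder (henc : Function.Injective enc) (k : ℕ) :
    N.bfs enc rv ω M k <+: N.bfsOrder enc rv ω M := by
  rcases le_total k n with hk | hk
  · exact bfs_prefix henc hk
  · rw [bfsOrder, bfs_of_length_le (length_bfs_le henc n) hk]

theorem getElem?_bfs (henc : Function.Injective enc) (hu : (N.bfsOrder enc rv ω M)[k]? = some u) :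
    (N.bfs enc rv ω M k)[k]? = some u := by
  obtain ⟨h1, h2⟩ := List.getElem?_eq_some_iff.1 hu
  have hlt : k < (N.bfs enc rv ω M k).length := by
    by_contra h
    rw [bfs_eq_bfsOrder henc (by omega)] at h
    exact h h1
  rw [List.getElem?_eq_getElem hlt, ← h2]
  congr 1
  exact (bfs_prefix_bfsOrder henc k).getElem hlt

theorem root_mem_bfs (henc : Function.Injective enc) (k : ℕ) : N.root ∈ N.bfs enc rv ω M k :=
  (bfs_prefix henc (Nat.zero_le k)).subset (by simp [bfs])

theorem idxOf_root (henc : Function.Injective enc) :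
    (N.bfsOrder enc rv ω M).idxOf N.root = 0 := by
  rw [← (bfs_prefix_bfsOrder henc 0).idxOf_eq_of_mem (root_mem_bfs henc 0)]
  simp [bfs]

/-- The arcs out of an expanded vertex serve only to find their opposites, so the search follows
present arcs backwards from the root. -/
theorem mem_bfsOrder_iff (henc : Function.Injective enc) (hencM : ∀ a, enc a < M)
    (hrv : ∀ a, rv (rv a) = a) (hh : ∀ a, N.head (rv a) = N.tail a)
    (ht : ∀ a, N.tail (rv a) = N.head a) :
    v ∈ N.bfsOrder enc rv ω M ↔ N.Reach ω v N.root := by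
  constructor
  · suffices ∀ k, ∀ v ∈ N.bfs enc rv ω M k, N.Reach ω v N.root from this n v
    intro k
    induction k with
    | zero =>
      intro v hv
      rw [bfs, List.mem_singleton] at hv
      rw [hv]
      exact .refl
    | succ k ih =>
      intro v hv
      rw [bfs] at hv
      split_ifs at hv with h
      · rcases (mem_visitBelow henc).1 hv with hv | ⟨a, ha, -, rfl, hω⟩
        · exact ih v hv
        · exact Relation.ReflTransGen.head ⟨rv a, ht a, (hh a).trans ha, hω⟩
            (ih _ (List.getElem_mem h))
      · exact ih v hv
  · intro h
    induction h using Relation.ReflTransGen.head_induction_on with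
    | refl => exact root_mem_bfs henc n
    | head hs _ ih =>
      obtain ⟨a, rfl, rfl, hω⟩ := hs
      have h1 := getElem?_bfs henc (List.getElem?_idxOf ih)
      refine (bfs_prefix_bfsOrder henc ((N.bfsOrder enc rv ω M).idxOf (N.head a) + 1)).subset ?_
      rw [bfs_succ h1, mem_visitBelow henc]
      exact Or.inr ⟨rv a, ht a, hencM _, (hh a).symm, by rw [hrv, hω]⟩

/-- The breadth-first order depends only on the arcs that lead to earlier vertices. -/
theorem bfsOrder_congr (henc : Function.Injective enc) (hh : ∀ a, N.head (rv a) = N.tail a)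
    (ht : ∀ a, N.tail (rv a) = N.head a) {ω' : A → Bool}
    (h : ∀ a, (N.bfsOrder enc rv ω M).idxOf (N.head a) <
      (N.bfsOrder enc rv ω M).idxOf (N.tail a) → ω a = ω' a) :
    N.bfsOrder enc rv ω' M = N.bfsOrder enc rv ω M := by
  suffices ∀ k, N.bfs enc rv ω' M k = N.bfs enc rv ω M k from this n
  intro k
  induction k with
  | zero => rfl
  | succ k ih =>
    rw [bfs, bfs, ih]
    by_cases hk : k < (N.bfs enc rv ω M k).length
    · rw [dif_pos hk, dif_pos hk]
      set u := (N.bfs enc rv ω M k)[k]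
      have hnext : N.bfs enc rv ω M (k + 1) = N.visitBelow enc rv ω u M (N.bfs enc rv ω M k) := by
        rw [bfs, dif_pos hk]
      have hrank : (N.bfsOrder enc rv ω M).idxOf u = k := by
        rw [← (bfs_prefix_bfsOrder henc k).idxOf_eq_of_mem (List.getElem_mem hk)]
        exact List.Nodup.idxOf_getElem (bfs_nodup henc k) k hk
      have hpre : N.visitBelow enc rv ω u M (N.bfs enc rv ω M k) <+: N.bfsOrder enc rv ω M := by
        rw [← hnext]; exact bfs_prefix_bfsOrder henc _
      suffices ∀ (b : ℕ) (q : List (Fin n)), N.visitBelow enc rv ω u b q <+: N.bfsOrder enc rv ω M →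
          k < q.length → N.visitBelow enc rv ω' u b q = N.visitBelow enc rv ω u b q from
        this M _ hpre hk
      intro b
      induction b with
      | zero => intro q _ _; rfl
      | succ b ihb =>
        intro q hq hkq
        by_cases ha : ∃ a, N.tail a = u ∧ enc a = b
        · obtain ⟨a, ha, rfl⟩ := ha
          rw [visitBelow_succ henc ha] at hq ⊢
          rw [visitBelow_succ henc ha]
          have hv : N.visit rv ω' q a = N.visit rv ω q a := by
            by_cases hw : N.head a ∈ q
            · simp [visit, hw]
            -- A vertex that is not yet queued comes after `u` in the final order. So the arc that
            -- is tested here leads to the earlier vertex, where `ω` and `ω'` agree.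
            · have hq' : q <+: N.bfsOrder enc rv ω M :=
                (prefix_visit.trans (prefix_visitBelow henc)).trans hq
              have h1 := (hq'.mem_iff_idxOf_lt_length (N.head a)).not.1 hw
              have := h (rv a) (by rw [hh, ht, ha, hrank]; omega)
              simp [visit, this]
          rw [hv]
          exact ihb _ hq (hkq.trans_le prefix_visit.length_le)
        · rw [visitBelow_of_notMem ha] at hq ⊢
          rw [visitBelow_of_notMem ha]
          exact ihb q hq hkq
    · rw [dif_neg hk, dif_neg hk]

end

end CoinDigraph

/-! ### The breadth-first search and the output on the machine. -/

namespace Search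

set_option linter.unusedSectionVars false

open CoinDigraph Program

section

open scoped Classical

variable {n : ℕ} {A : Type*} [Fintype A]

/-- The memory during the breadth-first search, with queue `q` and expanded vertices `X`. -/
structure QueueMem (N : CoinDigraph (Fin n) A) (enc kind : A → ℕ) (rv : A → A) (M : ℕ)
    (ω : A → Bool) (q X : List (Fin n)) (reg : ℕ → ℕ) (arr : ℕ → ℕ → ℕ) : Prop where
  adj : Adj N enc kind rv M (arr 3) (arr 4) (arr 5) (arr 6) (arr 7)
  bit : ∀ a, arr 8 (enc a) = (ω a).toNat
  zero : reg 2 = 0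
  one : reg 9 = 1
  head : reg 18 = X.length
  tail : reg 19 = q.length
  queue : ∀ (i : ℕ) (v : Fin n), q[i]? = some v → arr 15 i = v
  queued : ∀ v : Fin n, arr 16 v = if v ∈ q then 1 else 0
  expanded : ∀ v : Fin n, arr 17 v = if v ∈ X then 1 else 0

variable {N : CoinDigraph (Fin n) A} {enc kind : A → ℕ} {rv : A → A} {M : ℕ}
  {ω : A → Bool} {q X : List (Fin n)} {reg : ℕ → ℕ} {arr : ℕ → ℕ → ℕ}

theorem QueueMem.congr (hM : QueueMem N enc kind rv M ω q X reg arr) {reg' : ℕ → ℕ}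
    {arr' : ℕ → ℕ → ℕ} (h : ∀ i ∈ [2, 9, 18, 19], reg' i = reg i)
    (h' : ∀ i, i ≠ 2 → arr' i = arr i) : QueueMem N enc kind rv M ω q X reg' arr' := by
  simp only [List.forall_mem_cons, List.not_mem_nil, false_implies, implies_true, and_true] at h
  obtain ⟨h2, h9, h18, h19⟩ := h
  constructor
  case queue => intro i v hv; rw [h' 15 (by decide)]; exact hM.queue i v hv
  all_goals simp only [h2, h9, h18, h19, ne_eq, Nat.reduceEqDiff,
    not_false_eq_true, h', hM.adj, hM.bit, hM.zero, hM.one, hM.head, hM.tail, hM.queued,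
    hM.expanded, implies_true]

/-- The bit of an edge is written only if the other endpoint has not been expanded, so it comes from
the endpoint that is expanded first. -/
theorem QueueMem.exists_visit (hM : QueueMem N enc kind rv M ω q X reg arr) {a : A}
    (ha : reg 16 = enc a) (ha' : 0 < enc a) (hX : ∀ v ∈ X, v ∈ q) :
    ∃ k reg' arr', Steps popProgram k ⟨93, reg, arr⟩ ⟨107, reg', arr'⟩ ∧ k ≤ 14 ∧
      QueueMem N enc kind rv M ω (N.visit rv ω q a) X reg' arr' ∧ reg' 16 = enc a ∧
      arr' 2 = if N.head a ∈ X then arr 2 else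
        Function.update (arr 2) (kind a) (ω (rv a)).toNat := by
  have hne : enc a ≠ 0 := ha'.ne'
  have hrev : reg 16 ≠ reg 2 := by rw [ha, hM.zero]; exact hne
  by_cases hX' : N.head a ∈ X
  · refine ⟨4, _, _, .jumpEq_neg rfl hrev <| .load rfl <| .load rfl <| .jumpEq_pos rfl
      (by simp [ha, hM.adj.head, hM.expanded, hX', hM.one]) <| .refl _, by omega, ?_,
      by simp [ha], by rw [if_pos hX']⟩
    rw [visit, if_neg (by simp [hX _ hX'])]
    exact hM.congr (by simp) fun _ _ => rfl
  · rw [if_neg hX']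
    have hs : Steps popProgram 8 ⟨93, reg, arr⟩ ⟨101, _, _⟩ :=
      .jumpEq_neg rfl hrev <| .load rfl <| .load rfl <| .jumpEq_neg rfl
        (by simp [ha, hM.adj.head, hM.expanded, hX', hM.one]) <| .load rfl <| .load rfl <|
        .load rfl <| .store rfl <| .refl _
    simp only [Function.update_self, ne_eq, Nat.reduceEqDiff,
      not_false_eq_true, Function.update_of_ne, ha, hM.adj.head, hM.adj.rev, hM.adj.kind,
      hM.bit] at hs
    obtain ⟨reg₁, hreg₁⟩ : ∃ reg₁, reg₁ = Function.update (Function.update (Function.update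
      (Function.update (Function.update reg 6 (N.head a : ℕ)) 8 (arr 17 (N.head a))) 8
      (enc (rv a))) 8 (ω (rv a)).toNat) 7 (kind a) := ⟨_, rfl⟩
    rw [← hreg₁] at hs
    have hM₁ : QueueMem N enc kind rv M ω q X reg₁
        (writeArr arr 2 (kind a) (ω (rv a)).toNat) :=
      hM.congr (by simp [hreg₁]) fun i hi => by simp [hi]
    have h6 : reg₁ 6 = N.head a := by simp [hreg₁]
    have h8 : reg₁ 8 = (ω (rv a)).toNat := by simp [hreg₁]
    have h16 : reg₁ 16 = enc a := by simp [hreg₁, ha]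
    rcases hb : ω (rv a) with _ | _
    · refine ⟨8 + 1, _, _, hs.trans <| .jumpEq_pos rfl (by rw [h8, hM₁.zero, hb]; rfl) <| .refl _,
        by omega, ?_, h16, by simp [hb]⟩
      rw [visit, if_neg (by simp [hb])]
      exact hM₁
    · have hs' : Steps popProgram 2 ⟨101, reg₁, writeArr arr 2 (kind a) (ω (rv a)).toNat⟩
          ⟨103, _, _⟩ :=
        .jumpEq_neg rfl (by rw [h8, hM₁.zero, hb]; simp) <| .load rfl <| .refl _
      have hM₂ := hM₁.congr (reg' := Function.update reg₁ 8
        (writeArr arr 2 (kind a) (ω (rv a)).toNat 16 (reg₁ 6))) (by simp) fun _ _ => rfl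
      by_cases hq : N.head a ∈ q
      · refine ⟨8 + 2 + 1, _, _, (hs.trans hs').trans <|
          .jumpEq_pos rfl (by simp [h6, hM.queued, hq, hM₁.one]) <| .refl _, by omega, ?_,
          by simp [h16], by simp [hb]⟩
        rw [visit, if_neg (by simp [hq])]
        exact hM₂
      · refine ⟨8 + 2 + 4, _, _, (hs.trans hs').trans <|
          .jumpEq_neg rfl (by simp [h6, hM.queued, hq, hM₁.one]) <| .store rfl <| .store rfl <|
          .succ rfl <| .refl _, by omega, ?_, by simp [h16], by simp [hb]⟩
        rw [visit, if_pos ⟨hb, hq⟩]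
        have h19 := hM₁.tail
        constructor
        case queue =>
          intro i v hv
          rw [List.getElem?_append] at hv
          split_ifs at hv with hi
          · have : i ≠ q.length := hi.ne
            simp [h19, this, hM.queue i v hv]
          · have hi' : i = q.length := by
              by_contra h
              rw [List.getElem?_eq_none (by simp; omega)] at hv
              cases hv
            subst hi'
            have : N.head a = v := by simpa using hv
            simp [h19, h6, this]
        case queued =>
          intro v
          by_cases hv : v = N.head a
          · subst hv; simp [h6, hM₁.one]
          · have : (v : ℕ) ≠ N.head a := fun h => hv (Fin.ext h)
            simp [h6, this, hM.queued, hv]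
        all_goals simp [hM.adj, hM.bit, hM₁.zero, hM₁.one, hM₁.head, h19, hM.expanded]

/-- No bit is overwritten within a scan: the only other arc of the same edge is the opposite one,
whose head would be `u`, and `u` already counts as expanded. -/
theorem QueueMem.exists_scan (henc : Function.Injective enc) (hpos : ∀ a, 0 < enc a)
    (hkind : ∀ a b, kind a = kind b → b = a ∨ b = rv a) (rv_rv : ∀ a, rv (rv a) = a) (ht : ∀ a, N.tail (rv a) = N.head a)
    {u : Fin n} (hu : u ∈ X) (b : ℕ) (hM : QueueMem N enc kind rv M ω q X reg arr)
    (hx : IsPrev N enc u b (reg 16)) (hX : ∀ v ∈ X, v ∈ q) :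
    ∃ k reg' arr', Steps popProgram k ⟨93, reg, arr⟩ ⟨88, reg', arr'⟩ ∧
      k ≤ 16 * (arcsBelow N enc u b).card + 1 ∧
      QueueMem N enc kind rv M ω (N.visitBelow enc rv ω u b q) X reg' arr' ∧
      (∀ a, N.tail a = u → enc a < b → N.head a ∉ X → arr' 2 (kind a) = (ω (rv a)).toNat) ∧
      ∀ i, (∀ a, N.tail a = u → enc a < b → N.head a ∉ X → kind a ≠ i) → arr' 2 i = arr 2 i := by
  induction b using Nat.strong_induction_on generalizing q reg arr with
  | _ b ih =>
    rcases hx.arc with h0 | ⟨a, ha, hax⟩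
    · have hno : ∀ a, N.tail a = u → ¬ enc a < b := fun a h1 h2 => by
        have := hx.le a h1 h2
        have := hpos a
        omega
      refine ⟨1, reg, arr, .jumpEq_pos rfl (by rw [h0, hM.zero]) <| .refl _, by omega, ?_,
        fun a h1 h2 => absurd h2 (hno a h1), fun _ _ => rfl⟩
      rw [visitBelow_of_isPrev hx, h0, visitBelow_of_notMem]
      · exact hM
      · rintro ⟨a, -, h⟩
        exact (hpos a).ne' h
    · have hnot : a ∉ arcsBelow N enc u (enc a) := by simp [arcsBelow]
      rw [visitBelow_of_isPrev hx, ← hax, visitBelow_succ henc ha,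
        hx.arcsBelow_eq_insert henc ha hax, Finset.card_insert_of_notMem hnot]
      obtain ⟨k₁, reg₁, arr₁, hs₁, hk₁, hM₁, h16, hout₁⟩ :=
        hM.exists_visit hax.symm (hpos a) hX
      have hs₂ : Steps popProgram 2 ⟨107, reg₁, arr₁⟩ ⟨93, _, arr₁⟩ :=
        .load rfl <| .jump rfl <| .refl _
      obtain ⟨k₃, reg₃, arr₃, hs₃, hk₃, hM₃, hout₃, hout₃'⟩ := ih (enc a)
        (by rw [hax]; exact hx.lt)
        (hM₁.congr (reg' := Function.update reg₁ 16 (arr₁ 6 (reg₁ 16))) (by simp)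
          fun _ _ => rfl)
        (by simpa [h16, ha] using hM₁.adj.link a) fun v hv => prefix_visit.subset (hX v hv)
      refine ⟨k₁ + 2 + k₃, reg₃, arr₃, (hs₁.trans hs₂).trans hs₃, by omega, hM₃, ?_, ?_⟩
      · intro a' h1 h2 h3
        by_cases haa : a' = a
        · subst haa
          rw [hout₃', hout₁, if_neg h3, Function.update_self]
          intro a h4 h5 _ h6
          rcases hkind a a' h6 with rfl | rfl
          · omega
          · rw [← ht, rv_rv, h4] at h3
            exact h3 hu
        · have : enc a' ≠ enc a := fun h => haa (henc h)
          have := hx.le a' h1 h2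
          exact hout₃ a' h1 (by omega) h3
      · intro i hi
        have hlt := hx.lt
        rw [hout₃' i fun a' h1 h2 => hi a' h1 (by omega), hout₁]
        split_ifs with h
        · rfl
        · exact Function.update_of_ne (hi a ha (by omega) h).symm ..

/-- Before round `k` the output is correct for all edges whose earlier endpoint has rank below `k`.
A round takes five instructions, one for leaving the scan, and at most sixteen for each arc out of
the expanded vertex. -/
theorem QueueMem.exists_output (henc : Function.Injective enc) (hpos : ∀ a, 0 < enc a)
    (hencM : ∀ a, enc a < M) (hkind : ∀ a b, kind a = kind b → b = a ∨ b = rv a)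
    (hkind_rv : ∀ a, kind (rv a) = kind a) (rv_rv : ∀ a, rv (rv a) = a)
    (ht : ∀ a, N.tail (rv a) = N.head a) (hh : ∀ a, N.head (rv a) = N.tail a) (d k : ℕ)
    (hd : (N.bfsOrder enc rv ω M).length = k + d)
    (hM : QueueMem N enc kind rv M ω (N.bfs enc rv ω M k) ((N.bfsOrder enc rv ω M).take k) reg arr)
    (hout : ∀ a, (N.bfsOrder enc rv ω M).idxOf (N.head a) < k →
      (N.bfsOrder enc rv ω M).idxOf (N.head a) < (N.bfsOrder enc rv ω M).idxOf (N.tail a) →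
      arr 2 (kind a) = (ω a).toNat) :
    ∃ t c', Steps popProgram t ⟨88, reg, arr⟩ c' ∧ c'.Halted popProgram ∧
      t ≤ 6 * d + 16 * (Finset.univ.filter fun a =>
        k ≤ (N.bfsOrder enc rv ω M).idxOf (N.tail a)).card + 1 ∧
      ∀ a, (N.bfsOrder enc rv ω M).idxOf (N.head a) <
          (N.bfsOrder enc rv ω M).idxOf (N.tail a) → c'.arr 2 (kind a) = (ω a).toNat := by
  have hpre := fun k => bfs_prefix_bfsOrder (N := N) (rv := rv) (ω := ω) (M := M) henc k
  have hnodup : (N.bfsOrder enc rv ω M).Nodup := bfs_nodup henc n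
  have hX : ∀ k, ∀ v, v ∈ (N.bfsOrder enc rv ω M).take k ↔ v ∈ N.bfsOrder enc rv ω M ∧
      (N.bfsOrder enc rv ω M).idxOf v < k := by
    intro k v
    by_cases hv : v ∈ N.bfsOrder enc rv ω M
    · rw [List.mem_take_iff_idxOf_lt hv, and_iff_right hv]
    · exact iff_of_false (fun h => hv (List.mem_of_mem_take h)) fun h => hv h.1
  induction d generalizing k reg arr with
  | zero =>
    have hlen : (N.bfs enc rv ω M k).length = (N.bfsOrder enc rv ω M).length := by
      have h1 := (hpre k).length_le
      rw [bfs_eq_bfsOrder henc (by omega)]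
    refine ⟨1, _, .jumpEq_pos rfl (by rw [hM.head, hM.tail, hlen, List.length_take]; omega) <|
      .refl _, le_refl 109, by omega, fun a ha => hout a (ha.trans_le ?_) ha⟩
    rw [← add_zero k, ← hd]
    exact List.idxOf_le_length
  | succ d ih =>
    obtain ⟨u, hu⟩ : ∃ u, (N.bfsOrder enc rv ω M)[k]? = some u :=
      ⟨_, List.getElem?_eq_getElem (by omega)⟩
    have hu' := getElem?_bfs henc hu
    have hlt : k < (N.bfs enc rv ω M k).length := (List.getElem?_eq_some_iff.1 hu').1
    have huF : u ∈ N.bfsOrder enc rv ω M := List.mem_of_getElem? hu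
    have hrank : (N.bfsOrder enc rv ω M).idxOf u = k := by
      obtain ⟨h1, h2⟩ := List.getElem?_eq_some_iff.1 hu
      rw [← h2]
      exact hnodup.idxOf_getElem k h1
    have hlenX : ((N.bfsOrder enc rv ω M).take k).length = k := by
      rw [List.length_take]; omega
    have hsucc : (N.bfsOrder enc rv ω M).take (k + 1) =
        (N.bfsOrder enc rv ω M).take k ++ [u] := by
      rw [List.take_add_one, hu]; rfl
    have hq : arr 15 (reg 18) = u := by rw [hM.head, hlenX]; exact hM.queue k u hu'
    have hs : Steps popProgram 5 ⟨88, reg, arr⟩ ⟨93, _, _⟩ :=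
      .jumpEq_neg rfl (by rw [hM.head, hM.tail, hlenX]; omega) <| .load rfl <| .succ rfl <|
        .store rfl <| .load rfl <| .refl _
    simp only [Function.update_self, ne_eq, Nat.reduceEqDiff, not_false_eq_true,
      Function.update_of_ne, hq, hM.one, writeArr_of_ne] at hs
    have hM₁ : QueueMem N enc kind rv M ω (N.bfs enc rv ω M k)
        ((N.bfsOrder enc rv ω M).take (k + 1))
        (Function.update (Function.update (Function.update reg 14 (u : ℕ)) 18 (reg 18 + 1)) 16
          (arr 7 u)) (writeArr arr 17 u 1) := by
      constructor
      case queue => intro i v hv; simpa using hM.queue i v hv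
      case expanded =>
        intro v
        rw [hsucc]
        by_cases hv : v = u
        · subst hv; simp
        · have : (v : ℕ) ≠ u := fun h => hv (Fin.ext h)
          simp [this, hM.expanded, hv]
      case head => rw [hsucc]; simp [hM.head]
      all_goals simp [hM.adj, hM.bit, hM.zero, hM.one, hM.tail, hM.queued]
    obtain ⟨k₂, reg₂, arr₂, hs₂, hk₂, hM₂, hout₂, hout₂'⟩ :=
      hM₁.exists_scan henc hpos hkind rv_rv ht (u := u) (by simp [hsucc]) M
        (by simpa using hM.adj.first u) (fun v hv => by
          rw [hX] at hv
          rw [(hpre k).mem_iff_idxOf_lt_length]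
          omega)
    rw [← bfs_succ hu'] at hM₂
    have key := ih (k + 1) (by omega) hM₂ ?_
    · obtain ⟨t, c', h1, h2, h3, h4⟩ := key
      refine ⟨5 + k₂ + t, c', (hs.trans hs₂).trans h1, h2, ?_, h4⟩
      have hsplit : (Finset.univ.filter fun a => k ≤ (N.bfsOrder enc rv ω M).idxOf (N.tail a)).card =
          (arcsBelow N enc u M).card + (Finset.univ.filter fun a =>
            k + 1 ≤ (N.bfsOrder enc rv ω M).idxOf (N.tail a)).card := by
        rw [← Finset.card_union_of_disjoint]
        · congr 1
          ext a
          simp only [arcsBelow, Finset.mem_filter, Finset.mem_univ, true_and, Finset.mem_union,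
            hencM a, and_true]
          constructor
          · intro h
            rcases h.eq_or_lt with h | h
            · left
              rw [← hrank] at h
              exact ((List.idxOf_inj huF).1 h).symm
            · exact Or.inr h
          · rintro (h | h)
            · rw [h, hrank]
            · omega
        · rw [Finset.disjoint_left]
          intro a ha ha'
          simp only [arcsBelow, Finset.mem_filter, Finset.mem_univ, true_and] at ha ha'
          rw [ha.1, hrank] at ha'
          omega
      omega
    · intro a ha hlt'
      -- If the earlier endpoint was expanded in a previous round, this scan leaves the bit alone.
      -- If it is `u`, the bit is written now, through the opposite arc, which starts at `u`.
      rcases Nat.lt_succ_iff_lt_or_eq.1 ha with ha | ha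
      · rw [hout₂', writeArr_of_ne _ (by decide), hout a ha hlt']
        intro b h1 _ h3 h4
        rw [hX] at h3
        rcases hkind _ _ h4.symm with rfl | rfl
        · refine h3 ⟨?_, by omega⟩
          by_contra h
          rw [List.idxOf_of_notMem h] at ha
          omega
        · rw [ht] at h1
          rw [h1, hrank] at ha
          omega
      · have hau : N.head a = u := ((List.idxOf_inj huF).1 (hrank.trans ha.symm)).symm
        rw [← hkind_rv, hout₂ (rv a) ((ht a).trans hau) (hencM _), rv_rv]
        rw [hh, hX]
        omega

/-- From the end of the search on, the machine outputs the edges that lead to earlier vertices. -/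
theorem Mem.exists_output {S : Search (Fin n)} {cur : ℕ} (henc : Function.Injective enc)
    (hpos : ∀ a, 0 < enc a) (hencM : ∀ a, enc a < M)
    (hkind : ∀ a b, kind a = kind b → b = a ∨ b = rv a) (hkind_rv : ∀ a, kind (rv a) = kind a)
    (rv_rv : ∀ a, rv (rv a) = a) (ht : ∀ a, N.tail (rv a) = N.head a)
    (hh : ∀ a, N.head (rv a) = N.tail a) (hroot : (N.root : ℕ) = 0)
    (hM : Mem N enc kind rv M S cur ω reg arr) :
    ∃ t c', Steps popProgram t ⟨86, reg, arr⟩ c' ∧ c'.Halted popProgram ∧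
      t ≤ 6 * n + 16 * Fintype.card A + 3 ∧
      ∀ a, (N.bfsOrder enc rv ω M).idxOf (N.head a) <
          (N.bfsOrder enc rv ω M).idxOf (N.tail a) → c'.arr 2 (kind a) = (ω a).toNat := by
  have hs : Steps popProgram 2 ⟨86, reg, arr⟩ ⟨88, _, _⟩ := .store rfl <| .succ rfl <| .refl _
  have key := QueueMem.exists_output (N := N) (enc := enc) (kind := kind)
    (rv := rv) (M := M) (ω := ω) (arr := writeArr arr 16 (reg 2) (reg 9))
    (reg := Function.update reg 19 (reg 19 + 1)) henc hpos hencM hkind hkind_rv rv_rv ht hh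
    (N.bfsOrder enc rv ω M).length 0 (by omega) ?_ (fun a h => absurd h (Nat.not_lt_zero _))
  · obtain ⟨t, c', h1, h2, h3, h4⟩ := key
    refine ⟨2 + t, c', hs.trans h1, h2, ?_, h4⟩
    have h5 : (N.bfsOrder enc rv ω M).length ≤ n := length_bfs_le henc n
    have h6 := Finset.card_le_univ (Finset.univ.filter fun a =>
      0 ≤ (N.bfsOrder enc rv ω M).idxOf (N.tail a))
    omega
  · constructor
    case queue =>
      intro i v hv
      rcases i with _ | i
      · have : N.root = v := by simpa [bfs] using hv
        simp [hM.queue, ← this, hroot]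
      · simp [bfs] at hv
    case queued =>
      intro v
      by_cases hv : v = N.root
      · subst hv; simp [hM.zero, hM.one, hroot, bfs]
      · have : (v : ℕ) ≠ 0 := fun h => hv (Fin.ext (h.trans hroot.symm))
        simp [hM.zero, hM.queued, this, bfs, hv]
    all_goals simp [hM.adj, hM.bit, hM.zero, hM.one, hM.bfs_head, hM.bfs_tail, hM.expanded, bfs]

end

end Search

/-! ## The digraph of a list of edges -/

section

open scoped Classical

variable {n m : ℕ} [NeZero n] (ends : Fin m → Fin n × Fin n) (coin : ℕ → PMF Bool)

theorem PMF.apply_true_add_apply_false (μ : PMF Bool) : μ true + μ false = 1 := by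
  rw [← μ.tsum_coe, tsum_fintype]
  simp

/-- Both orientations of the listed edges, where the arcs out of vertex `0` are never present. -/
noncomputable def edgeDigraph : CoinDigraph (Fin n) (Fin m × Bool) where
  tail a := if a.2 then (ends a.1).2 else (ends a.1).1
  head a := if a.2 then (ends a.1).1 else (ends a.1).2
  root := 0
  coin a x := if (if a.2 then (ends a.1).2 else (ends a.1).1) = 0 then (if x then 0 else 1)
    else coin a.1 x
  coin_sum a := by
    by_cases h : (if a.2 then (ends a.1).2 else (ends a.1).1) = 0
    · simp [h]
    · simp only [h, if_false]
      exact PMF.apply_true_add_apply_false _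

/-- The code of an arc. -/
def arcCode (a : Fin m × Bool) : ℕ := 2 * a.1 + 1 + a.2.toNat

/-- The opposite arc. -/
def arcRev (a : Fin m × Bool) : Fin m × Bool := (a.1, !a.2)

variable {ends coin}

theorem arcCode_injective : Function.Injective (arcCode (m := m)) := by
  rintro ⟨e, b⟩ ⟨e', b'⟩ h
  simp only [arcCode] at h
  have h1 := Bool.toNat_le b
  have h2 := Bool.toNat_le b'
  have h3 : e = e' := Fin.ext (by omega)
  subst h3
  cases b <;> cases b' <;> simp_all

theorem arcCode_pos (a : Fin m × Bool) : 0 < arcCode a := by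
  unfold arcCode; omega

theorem arcCode_lt (a : Fin m × Bool) : arcCode a < 2 * m + 1 := by
  have := a.1.2
  have := Bool.toNat_le a.2
  unfold arcCode
  omega

theorem arcRev_arcRev (a : Fin m × Bool) : arcRev (arcRev a) = a := by simp [arcRev]

theorem tail_arcRev (a : Fin m × Bool) :
    (edgeDigraph ends coin).tail (arcRev a) = (edgeDigraph ends coin).head a := by
  rcases a with ⟨e, _ | _⟩ <;> simp [edgeDigraph, arcRev]

theorem head_arcRev (a : Fin m × Bool) :
    (edgeDigraph ends coin).head (arcRev a) = (edgeDigraph ends coin).tail a := by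
  rcases a with ⟨e, _ | _⟩ <;> simp [edgeDigraph, arcRev]

theorem eq_or_eq_arcRev (a b : Fin m × Bool) (h : (a.1 : ℕ) = b.1) : b = a ∨ b = arcRev a := by
  obtain ⟨e, x⟩ := a
  obtain ⟨e', y⟩ := b
  obtain rfl : e = e' := Fin.ext h
  cases x <;> cases y <;> simp [arcRev]

/-! ### Building the adjacency lists. -/

namespace Search

set_option linter.unusedSectionVars false

open CoinDigraph Program

theorem IsPrev.succ_of_tail_eq {V A : Type*} {N : CoinDigraph V A} {enc : A → ℕ} {v : V} {a : A}
    (ha : N.tail a = v) : IsPrev N enc v (enc a + 1) (enc a) :=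
  ⟨by omega, Or.inr ⟨a, ha, rfl⟩, fun _ _ _ => by omega⟩

theorem IsPrev.succ_of_tail_ne {V A : Type*} {N : CoinDigraph V A} {enc : A → ℕ}
    (henc : Function.Injective enc) {v : V} {a : A} {x : ℕ} (h : IsPrev N enc v (enc a) x)
    (ha : N.tail a ≠ v) : IsPrev N enc v (enc a + 1) x := by
  refine ⟨by have := h.lt; omega, h.arc, fun b hb hlt => h.le b hb ?_⟩
  have : enc b ≠ enc a := fun h => ha (henc h ▸ hb)
  omega

variable (ends coin) in
/-- The memory when `i` edges have been put into the adjacency lists. -/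
structure BuildMem (i : ℕ) (reg : ℕ → ℕ) (arr : ℕ → ℕ → ℕ) : Prop where
  edge : reg 3 = i
  code : reg 5 = 2 * i
  num : reg 0 = n
  edges : reg 1 = m
  regs : ∀ j, j = 2 ∨ 9 ≤ j → reg j = 0
  left : ∀ e : Fin m, arr 0 e = (ends e).1
  right : ∀ e : Fin m, arr 1 e = (ends e).2
  head : ∀ a : Fin m × Bool, a.1 < i → arr 3 (arcCode a) = (edgeDigraph ends coin).head a
  kind : ∀ a : Fin m × Bool, a.1 < i → arr 4 (arcCode a) = a.1
  rev : ∀ a : Fin m × Bool, a.1 < i → arr 5 (arcCode a) = arcCode (arcRev a)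
  link : ∀ a : Fin m × Bool, a.1 < i → IsPrev (edgeDigraph ends coin) arcCode
    ((edgeDigraph ends coin).tail a) (arcCode a) (arr 6 (arcCode a))
  first : ∀ v : Fin n, IsPrev (edgeDigraph ends coin) arcCode v (2 * i + 1) (arr 7 v)
  ptr : ∀ v : Fin n, arr 9 v = arr 7 v
  arrs : ∀ j, j = 2 ∨ j = 8 ∨ 10 ≤ j → arr j = fun _ => 0

theorem buildMem_inputConfig :
    BuildMem ends coin 0 (inputConfig ends).reg (inputConfig ends).arr := by
  have h : ∀ j, j ≠ 0 → j ≠ 1 → (inputConfig ends).arr j = fun _ => 0 := by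
    intro j h0 h1
    ext i
    simp [inputConfig, h0, h1]
  constructor
  case regs =>
    intro j hj
    simp only [inputConfig]
    rw [if_neg (by omega), if_neg (by omega)]
  case arrs => intro j hj; exact h j (by omega) (by omega)
  case first =>
    intro v
    rw [h 7 (by omega) (by omega)]
    exact ⟨Nat.one_pos, Or.inl rfl, fun a _ ha => by have := arcCode_pos a; omega⟩
  case ptr => intro v; rw [h 7 (by omega) (by omega), h 9 (by omega) (by omega)]
  all_goals simp [inputConfig]

variable {i : ℕ} {reg : ℕ → ℕ} {arr : ℕ → ℕ → ℕ}

theorem BuildMem.exists_step (hM : BuildMem ends coin i reg arr) (hi : i < m) :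
    ∃ reg' arr', Steps popProgram 23 ⟨0, reg, arr⟩ ⟨0, reg', arr'⟩ ∧
      BuildMem ends coin (i + 1) reg' arr' := by
  obtain ⟨e, rfl⟩ : ∃ e : Fin m, (e : ℕ) = i := ⟨⟨i, hi⟩, rfl⟩
  have hs : Steps popProgram 23 ⟨0, reg, arr⟩ ⟨0, _, _⟩ :=
    .jumpEq_neg rfl (by rw [hM.edge, hM.edges]; omega) <| .copy rfl <| .succ rfl <| .copy rfl <|
      .succ rfl <| .load rfl <| .load rfl <| .store rfl <| .store rfl <| .store rfl <|
      .store rfl <| .store rfl <| .store rfl <| .load rfl <| .store rfl <| .store rfl <|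
      .load rfl <| .store rfl <| .store rfl <| .store rfl <| .store rfl <| .succ rfl <|
      .jump rfl <| .refl _
  simp only [Function.update_self, ne_eq, Nat.reduceEqDiff, not_false_eq_true,
    Function.update_of_ne, writeArr_self, writeArr_of_ne, hM.edge, hM.code, hM.left,
    hM.right] at hs
  have hF : 2 * (e : ℕ) + 1 = arcCode (e, false) := by simp [arcCode]
  have hT : 2 * (e : ℕ) + 1 + 1 = arcCode (e, true) := by simp [arcCode]
  have hne : arcCode (e, false) ≠ arcCode (e, true) := by rw [← hF, ← hT]; omega
  have hcase : ∀ a : Fin m × Bool, (a.1 : ℕ) < e + 1 → a = (e, false) ∨ a = (e, true) ∨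
      (a.1 : ℕ) < e ∧ arcCode a ≠ arcCode (e, false) ∧ arcCode a ≠ arcCode (e, true) := by
    rintro ⟨e', b⟩ h
    rcases Nat.lt_succ_iff_lt_or_eq.1 h with h | h
    · have h1 : ∀ x, ((e', b) : Fin m × Bool) ≠ (e, x) := fun x hx => by
        have : e' = e := congrArg Prod.fst hx
        simp [this] at h
      exact Or.inr (Or.inr ⟨h, fun h' => h1 _ (arcCode_injective h'),
        fun h' => h1 _ (arcCode_injective h')⟩)
    · obtain rfl : e' = e := Fin.ext h
      cases b <;> simp
  have hbound : 2 * ((e : ℕ) + 1) + 1 = arcCode (e, true) + 1 := by rw [← hT]; ring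
  have hTF : arcCode (e, true) = arcCode (e, false) + 1 := by rw [← hT, ← hF]
  have htF : (edgeDigraph ends coin).tail (e, false) = (ends e).1 := rfl
  have htT : (edgeDigraph ends coin).tail (e, true) = (ends e).2 := rfl
  have hhF : (edgeDigraph ends coin).head (e, false) = (ends e).2 := rfl
  have hhT : (edgeDigraph ends coin).head (e, true) = (ends e).1 := rfl
  have hfirst := hM.first
  rw [hF] at hs hfirst
  rw [hTF.symm] at hs
  have hupd : ∀ (f : ℕ → ℕ) (v w : Fin n) (x : ℕ), Function.update f v x w =
      if w = v then x else f w := by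
    intro f v w x
    by_cases h : w = v
    · subst h; simp
    · rw [if_neg h, Function.update_of_ne fun h' => h (Fin.ext h')]
  -- The table of first arcs after `(e, false)` has been entered and before `(e, true)` is.
  have hmid : ∀ v : Fin n, IsPrev (edgeDigraph ends coin) arcCode v (arcCode (e, true))
      (Function.update (arr 7) (ends e).1 (arcCode (e, false)) v) := by
    intro v
    rw [hTF, hupd]
    split_ifs with h
    · exact .succ_of_tail_eq (htF.trans h.symm)
    · exact (hfirst v).succ_of_tail_ne arcCode_injective fun h' => h (h'.symm.trans htF)
  refine ⟨_, _, hs, ?_⟩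
  constructor
  case regs =>
    intro j hj
    have h3 : j ≠ 3 := by omega
    have h4 : j ≠ 4 := by omega
    have h5 : j ≠ 5 := by omega
    have h6 : j ≠ 6 := by omega
    have h7 : j ≠ 7 := by omega
    have h8 : j ≠ 8 := by omega
    simp [h3, h4, h5, h6, h7, h8, hM.regs j hj]
  case arrs =>
    intro j hj
    have h3 : j ≠ 3 := by omega
    have h4 : j ≠ 4 := by omega
    have h5 : j ≠ 5 := by omega
    have h6 : j ≠ 6 := by omega
    have h7 : j ≠ 7 := by omega
    have h9 : j ≠ 9 := by omega
    simp [h3, h4, h5, h6, h7, h9, hM.arrs j hj]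
  case head =>
    intro a ha
    rcases hcase a ha with rfl | rfl | ⟨h, h1, h2⟩
    · simp [hne, hhF]
    · simp [hhT]
    · simp [h1, h2, hM.head a h]
  case kind =>
    intro a ha
    rcases hcase a ha with rfl | rfl | ⟨h, h1, h2⟩
    · simp [hne]
    · simp
    · simp [h1, h2, hM.kind a h]
  case rev =>
    intro a ha
    rcases hcase a ha with rfl | rfl | ⟨h, h1, h2⟩
    · simp [hne, arcRev]
    · simp [arcRev]
    · simp [h1, h2, hM.rev a h]
  case link =>
    intro a ha
    rcases hcase a ha with rfl | rfl | ⟨h, h1, h2⟩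
    · simpa [hne, htF] using hfirst (ends e).1
    · simpa [htT] using hmid (ends e).2
    · simpa [h1, h2] using hM.link a h
  case first =>
    intro v
    rw [hbound]
    have h : IsPrev (edgeDigraph ends coin) arcCode v (arcCode (e, true) + 1)
        (Function.update (Function.update (arr 7) (ends e).1 (arcCode (e, false))) (ends e).2
          (arcCode (e, true)) v) := by
      rw [hupd]
      split_ifs with h
      · exact .succ_of_tail_eq (htT.trans h.symm)
      · exact (hmid v).succ_of_tail_ne arcCode_injective fun h' => h (h'.symm.trans htT)
    simpa using h
  case ptr =>
    intro v
    simp [hupd, hM.ptr]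
  case code => simp [hTF, ← hF]; ring
  all_goals simp [hM.num, hM.edges, hM.left, hM.right]

theorem exists_build : ∃ reg arr, Steps popProgram (23 * m) (inputConfig ends) ⟨0, reg, arr⟩ ∧
    BuildMem ends coin m reg arr := by
  suffices ∀ i ≤ m, ∃ reg arr, Steps popProgram (23 * i) (inputConfig ends) ⟨0, reg, arr⟩ ∧
      BuildMem ends coin i reg arr from this m le_rfl
  intro i
  induction i with
  | zero => exact fun _ => ⟨_, _, .refl _, buildMem_inputConfig⟩
  | succ i ih =>
    intro hi
    obtain ⟨reg, arr, hs, hM⟩ := ih (by omega)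
    obtain ⟨reg', arr', hs', hM'⟩ := hM.exists_step (by omega)
    exact ⟨reg', arr', hs.trans hs', hM'⟩

/-- The state of the search before the first step. -/
def initial (first : Fin n → ℕ) : Search (Fin n) where
  done v := decide (v = 0)
  pos _ := 0
  ptr := first
  size := 0
  comps := 0
  act := 0
  start _ := 0
  actPos _ := 0

/-- Array `8` is still zero, so the search starts without present arcs, and only the root is
finished. -/
theorem exists_initial (ends : Fin m → Fin n × Fin n) (coin : ℕ → PMF Bool) :
    ∃ first reg arr, Steps popProgram (23 * m + 3) (inputConfig ends) ⟨25, reg, arr⟩ ∧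
      Mem (edgeDigraph ends coin) arcCode (fun a => a.1) arcRev (2 * m + 1) (initial first) 0
        (fun _ => false) reg arr ∧
      (initial first).Ok (edgeDigraph ends coin) arcCode fun _ => false := by
  obtain ⟨reg, arr, hs, hM⟩ := exists_build (ends := ends) (coin := coin)
  have h2 := hM.regs 2 (by omega)
  have hroot : ∀ v : Fin n, (v : ℕ) = 0 ↔ v = 0 := fun v => by
    rw [Fin.ext_iff, Fin.val_zero]
  have hs' : Steps popProgram 3 ⟨0, reg, arr⟩ ⟨25, _, _⟩ :=
    .jumpEq_pos rfl (by rw [hM.edge, hM.edges]) <| .const rfl <| .store rfl <| .refl _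
  refine ⟨fun v => arr 7 v, _, _, hs.trans hs', ?_, ?_⟩
  · constructor
    case adj =>
      constructor
      case head => intro a; simpa using hM.head a a.1.2
      case kind => intro a; simpa using hM.kind a a.1.2
      case rev => intro a; simpa using hM.rev a a.1.2
      case link => intro a; simpa using hM.link a a.1.2
      case first => intro v; simpa using hM.first v
    case done =>
      intro v
      by_cases hv : v = 0
      · subst hv; simp [h2, initial]
      · have := (hroot v).not.2 hv
        simp [h2, initial, hv, this, hM.arrs]
    case ptr => intro v; simp [initial, hM.ptr]
    case path => intro v hv; simp [initial] at hv
    case start => intro i hi hi'; simp only [initial] at hi'; omega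
    case actPos => intro i hi hi'; simp only [initial] at hi'; omega
    all_goals simp [initial, hM.num, hM.regs, hM.arrs]
  · constructor
    case done_reach =>
      intro v hv
      have : v = 0 := by simpa [initial] using hv
      subst this
      exact .refl
    case ptr_arc =>
      intro v
      exact (hM.first v).arc
    case ptr_new =>
      intro a _ _
      exact (hM.first _).le a rfl (arcCode_lt a)
    all_goals simp [initial, edgeDigraph]
    all_goals omega

end Search

end

section

open scoped Classical

/-- The expectation of `ψ` on the event that every vertex reaches the root. -/
noncomputable def CoinDigraph.goodMean {V A : Type*} [Fintype A] (N : CoinDigraph V A)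
    (ψ : (A → Bool) → ENNReal) : ENNReal :=
  ∑ ω, N.wt ω * (CoinDigraph.ind (N.ReachesSet ω {N.root}) * ψ ω)

end

/-! ### The reward of the whole program. -/

section

open scoped Classical

open CoinDigraph Program Search

set_option linter.unusedSectionVars false

variable {n m : ℕ} [NeZero n] {ends : Fin m → Fin n × Fin n} {coin : ℕ → PMF Bool}
  {G : SimpleGraph (Fin n)}

theorem IsEdgeList.ne (hE : IsEdgeList G ends) (e : Fin m) : (ends e).1 ≠ (ends e).2 := by
  have h : listedEdge ends e ∈ G.edgeSet := hE.2 ▸ Set.mem_range_self e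
  exact (G.mem_edgeSet.1 h).ne

theorem IsEdgeList.card_eq [DecidableRel G.Adj] (hE : IsEdgeList G ends) :
    Nat.card G.edgeSet = m := by
  rw [← hE.2, ← Nat.card_congr (Equiv.ofInjective _ hE.1)]
  simp

theorem bidirected_edgeDigraph (hG : G.Connected) (hE : IsEdgeList G ends)
    (hpos : ∀ e : Fin m, coin e true ≠ 0) : (edgeDigraph ends coin).Bidirected arcRev where
  rv_rv := arcRev_arcRev
  tail_rv := tail_arcRev
  coin_rv a h1 h2 := by
    ext x
    rcases a with ⟨e, _ | _⟩
    · have h1' : (ends e).1 ≠ 0 := h1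
      have h2' : (ends e).2 ≠ 0 := h2
      simp [edgeDigraph, arcRev, h1', h2']
    · have h1' : (ends e).2 ≠ 0 := h1
      have h2' : (ends e).1 ≠ 0 := h2
      simp [edgeDigraph, arcRev, h1', h2']
  coin_root a h := by
    have h' : (if a.2 then (ends a.1).2 else (ends a.1).1) = 0 := h
    simp [edgeDigraph, h']
  coin_pos a h := by
    have h' : (if a.2 then (ends a.1).2 else (ends a.1).1) ≠ 0 := h
    simpa [edgeDigraph, h'] using hpos a.1
  exists_arc U hU hr := by
    obtain ⟨u, hu⟩ := hU
    obtain ⟨p⟩ := hG.preconnected u 0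
    obtain ⟨d, -, h1, h2⟩ := p.exists_boundary_dart U hu hr
    have hd : s(d.fst, d.snd) ∈ Set.range (listedEdge ends) := hE.2 ▸ d.adj
    obtain ⟨e, he⟩ := hd
    rcases Sym2.eq_iff.1 he with ⟨h3, h4⟩ | ⟨h3, h4⟩
    · exact ⟨(e, false), by simpa [edgeDigraph, h3] using h1, by simpa [edgeDigraph, h4] using h2⟩
    · exact ⟨(e, true), by simpa [edgeDigraph, h4] using h1, by simpa [edgeDigraph, h3] using h2⟩

theorem coin_edgeDigraph {a : Fin m × Bool} (h : (edgeDigraph ends coin).tail a ≠ 0) (x : Bool) :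
    (edgeDigraph ends coin).coin a x = coin a.1 x := by
  have h' : (if a.2 then (ends a.1).2 else (ends a.1).1) ≠ 0 := h
  simp [edgeDigraph, h']

theorem IsEdgeList.exists_tail_eq (hG : G.Connected) (hE : IsEdgeList G ends) (v : Fin n)
    (hv : v ≠ 0) : ∃ a, (edgeDigraph ends coin).tail a = v := by
  obtain ⟨p⟩ := hG.preconnected v 0
  obtain ⟨d, -, h1, h2⟩ := p.exists_boundary_dart {v} rfl (by simpa using hv.symm)
  have hd : s(d.fst, d.snd) ∈ Set.range (listedEdge ends) := hE.2 ▸ d.adj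
  obtain ⟨e, he⟩ := hd
  rcases Sym2.eq_iff.1 he with ⟨h3, h4⟩ | ⟨h3, h4⟩
  · exact ⟨(e, false), h3.trans h1⟩
  · exact ⟨(e, true), h4.trans h1⟩

/-- The reward of the whole program. -/
theorem reward_popProgram_le (hG : G.Connected) (hE : IsEdgeList G ends)
    (hpos : ∀ e : Fin m, coin e true ≠ 0) (ρ : ENNReal)
    (hρ : ∀ e : Fin m, coin e false ≤ ρ * coin e true) {τ : ENNReal} (hτ : τ ≠ ⊤)
    {r : Config → ENNReal} {ψ : (Fin m × Bool → Bool) → ENNReal} (hψ : ∀ ω, ψ ω ≠ ⊤)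
    (hr : ∀ ω c, (edgeDigraph ends coin).ReachesSet ω {0} →
      (∀ a, ((edgeDigraph ends coin).bfsOrder arcCode arcRev ω (2 * m + 1)).idxOf
          ((edgeDigraph ends coin).head a) <
        ((edgeDigraph ends coin).bfsOrder arcCode arcRev ω (2 * m + 1)).idxOf
          ((edgeDigraph ends coin).tail a) → c.arr 2 a.1 = (ω a).toNat) → r c ≤ ψ ω) (T : ℕ) :
    popProgram.reward coin τ r T (inputConfig ends) ≤
      ((500 * m + 120 * n + 10 : ℕ) : ENNReal) * τ + 400 * m * n * ρ * τ +
        (edgeDigraph ends coin).goodMean ψ / (edgeDigraph ends coin).reachProb {0} := by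
  obtain ⟨first, reg, arr, hs, hM, hO⟩ := exists_initial ends coin
  have hroot : (edgeDigraph ends coin).root = 0 := rfl
  -- Here `x` collects the construction of the lists, the initial potential and the output phase.
  -- The two remaining terms are those of `Bidirected.value_false_le` with `2 * m` arcs and `κ = 200
  -- * τ`; the first of them accounts for the step from 100 to 500.
  have aux : ∀ x : ℕ, x ≤ 100 * m + 120 * n + 10 → (x : ENNReal) * τ +
      (200 * τ * ((m * 2 : ℕ) : ENNReal) +
        200 * τ * (((m * 2 : ℕ) : ENNReal) * ((n : ENNReal) * ρ))) ≤
      ((500 * m + 120 * n + 10 : ℕ) : ENNReal) * τ + 400 * m * n * ρ * τ := by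
    intro x hx
    have h : (x : ENNReal) ≤ ((100 * m + 120 * n + 10 : ℕ) : ENNReal) := Nat.cast_le.2 hx
    refine (add_le_add_left (mul_le_mul_left h τ) _).trans (le_of_eq ?_)
    push_cast
    ring
  have h1 := reward_le (N := edgeDigraph ends coin) (enc := arcCode) (kind := fun a => a.1)
    (rv := arcRev) (M := 2 * m + 1) (coin := coin) (τ := τ) (r := r)
    arcCode_injective arcCode_pos arcCode_lt (fun a ha b => (coin_edgeDigraph ha b).symm)
    (fun v hv => hE.exists_tail_eq hG v hv) (K := 6 * n + 16 * (2 * m) + 3) (ψ := ψ) ?_ T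
    (initial first) 0 (fun _ => false) reg arr hO hM (Nat.zero_le _)
    fun v hv => absurd hv (Nat.not_lt_zero _)
  · have h2 : (edgeDigraph ends coin).limValue (200 * τ) ψ (fun _ => false) ≤
        200 * τ * Fintype.card (Fin m × Bool) +
          200 * τ * (Fintype.card (Fin m × Bool) * (Fintype.card (Fin n) * ρ)) +
            (edgeDigraph ends coin).goodMean ψ / (edgeDigraph ends coin).reachProb {0} :=
      iSup_le fun t => (bidirected_edgeDigraph hG hE hpos).value_false_le ρ (fun a ha => by
        rw [coin_edgeDigraph ha, coin_edgeDigraph ha]; exact hρ a.1)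
        (ENNReal.mul_ne_top (by simp) hτ) hψ t
    have hpot : (initial first).pot (edgeDigraph ends coin) arcCode 0 ≤
        20 * (2 * m) + 100 * n + 10 * n := by
      have h3 := Finset.card_le_univ (Finset.univ.filter fun a =>
        arcCode a ≤ (initial first).ptr ((edgeDigraph ends coin).tail a))
      have h4 := Finset.card_le_univ (Finset.univ.filter fun v : Fin n =>
        (initial first).pos v = 0 ∧ (initial first).done v = false)
      rw [Fintype.card_prod, Fintype.card_bool, Fintype.card_fin] at h3
      rw [Fintype.card_fin] at h4
      have h5 : (initial first).comps = 0 := rfl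
      have h6 : (initial first).act = 0 := rfl
      have h7 : (initial first).size = 0 := rfl
      unfold pot
      rw [h5, h6, h7]
      omega
    rw [if_pos (show (initial first).act = 0 from rfl)] at h1
    refine (hs.reward_le T).trans ((add_le_add_right (h1.trans (add_le_add_right h2 _)) _).trans ?_)
    rw [Fintype.card_prod, Fintype.card_bool, Fintype.card_fin, Fintype.card_fin,
      ← add_assoc, ← add_assoc, ← add_mul, ← Nat.cast_add]
    exact add_le_add_left (aux _ (by omega)) _
  · intro S ω reg arr hM hreach
    obtain ⟨t, c', h1, h2, h3, h4⟩ := hM.exists_output arcCode_injective arcCode_pos arcCode_lt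
      (fun a b h => eq_or_eq_arcRev a b h) (fun _ => rfl) arcRev_arcRev tail_arcRev head_arcRev
      (by rw [hroot, Fin.val_zero])
    refine ⟨t, c', h1, ?_, h2, hr ω c' hreach h4⟩
    rw [Fintype.card_prod, Fintype.card_bool, Fintype.card_fin] at h3
    omega

end

/-! ## The law of the output -/

namespace CoinDigraph

set_option linter.unusedSectionVars false

section

open scoped Classical

variable {V A : Type*} [Fintype A] {N : CoinDigraph V A}

theorem sum_wt_mul_ind (X : Finset A) (η : A → Bool) :
    ∑ ω, N.wt ω * ind (∀ a ∈ X, ω a = η a) = ∏ a ∈ X, N.coin a (η a) := by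
  have h : ∀ ω : A → Bool, N.wt ω * ind (∀ a ∈ X, ω a = η a) =
      ∏ a, N.coin a (ω a) * (if a ∈ X → ω a = η a then 1 else 0) := by
    intro ω
    rw [Finset.prod_mul_distrib, Finset.prod_ite_zero]
    simp [wt, ind]
  simp only [h]
  rw [← Fintype.prod_sum fun a x => N.coin a x * (if a ∈ X → x = η a then 1 else 0),
    ← Finset.prod_subset (Finset.subset_univ X)]
  · refine Finset.prod_congr rfl fun a ha => ?_
    cases η a <;> simp [ha]
  · intro a _ ha
    simp [ha, N.coin_sum]

theorem goodMean_ind {Q : (A → Bool) → Prop} {P : Prop} (X : Finset A) (η : A → Bool)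
    (h : ∀ ω, N.ReachesSet ω {N.root} ∧ Q ω ↔ P ∧ ∀ a ∈ X, ω a = η a) :
    N.goodMean (fun ω => ind (Q ω)) = ind P * ∏ a ∈ X, N.coin a (η a) := by
  rw [goodMean, ← sum_wt_mul_ind, Finset.mul_sum]
  refine Finset.sum_congr rfl fun ω _ => ?_
  have h1 : ∀ a b : Prop, ind a * ind b = ind (a ∧ b) := by
    intro a b
    by_cases ha : a <;> by_cases hb : b <;> simp [ind, ha, hb]
  rw [h1, ind_congr (h ω), ← h1]
  ring

theorem goodMean_one : N.goodMean (fun _ => 1) = N.reachProb {N.root} := by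
  simp [goodMean, reachProb]

theorem goodMean_sum {ι : Type*} (s : Finset ι) (ψ : ι → (A → Bool) → ENNReal) :
    N.goodMean (fun ω => ∑ i ∈ s, ψ i ω) = ∑ i ∈ s, N.goodMean (ψ i) := by
  simp only [goodMean, Finset.mul_sum]
  exact Finset.sum_comm

theorem goodMean_ind_add (Q : (A → Bool) → Prop) :
    N.goodMean (fun ω => ind (Q ω)) + N.goodMean (fun ω => ind (¬ Q ω)) =
      N.reachProb {N.root} := by
  rw [← goodMean_one, goodMean, goodMean, goodMean, ← Finset.sum_add_distrib]
  refine Finset.sum_congr rfl fun ω _ => ?_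
  by_cases h : Q ω <;> simp [ind, h]

end

end CoinDigraph

/-! ### The output as a function of one orientation per edge. -/

section

open scoped Classical

open CoinDigraph Program Search

set_option linter.unusedSectionVars false

variable {n m : ℕ} [NeZero n] {ends : Fin m → Fin n × Fin n} {coin : ℕ → PMF Bool}
  {G : SimpleGraph (Fin n)}

variable (ends coin) in
/-- The position of a vertex in the breadth-first order. -/
noncomputable def edgeRank (ω : Fin m × Bool → Bool) (v : Fin n) : ℕ :=
  ((edgeDigraph ends coin).bfsOrder arcCode arcRev ω (2 * m + 1)).idxOf v

variable (ends coin) in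
/-- The orientation of an edge that leads to the earlier vertex. -/
noncomputable def earlier (ω : Fin m × Bool → Bool) (e : Fin m) : Bool :=
  decide (edgeRank ends coin ω (ends e).1 < edgeRank ends coin ω (ends e).2)

theorem mem_bfsOrder (ω : Fin m × Bool → Bool) (v : Fin n) :
    v ∈ (edgeDigraph ends coin).bfsOrder arcCode arcRev ω (2 * m + 1) ↔
      (edgeDigraph ends coin).Reach ω v 0 :=
  mem_bfsOrder_iff arcCode_injective arcCode_lt arcRev_arcRev head_arcRev tail_arcRev

theorem reachesSet_iff (ω : Fin m × Bool → Bool) :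
    (edgeDigraph ends coin).ReachesSet ω {(edgeDigraph ends coin).root} ↔
      ∀ v, v ∈ (edgeDigraph ends coin).bfsOrder arcCode arcRev ω (2 * m + 1) := by
  simp only [mem_bfsOrder]
  refine forall_congr' fun v => ?_
  simp [edgeDigraph]

theorem eq_earlier {ω : Fin m × Bool → Bool} {a : Fin m × Bool}
    (h : edgeRank ends coin ω ((edgeDigraph ends coin).head a) <
      edgeRank ends coin ω ((edgeDigraph ends coin).tail a)) :
    a = (a.1, earlier ends coin ω a.1) := by
  rcases a with ⟨e, _ | _⟩
  · have h' : edgeRank ends coin ω (ends e).2 < edgeRank ends coin ω (ends e).1 := h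
    simp [earlier, h'.le]
  · have h' : edgeRank ends coin ω (ends e).1 < edgeRank ends coin ω (ends e).2 := h
    simp [earlier, h']

/-- In a good configuration every vertex is in the order, so the two endpoints of an edge have
different ranks. -/
theorem IsEdgeList.earlier_spec (hE : IsEdgeList G ends) {ω : Fin m × Bool → Bool}
    (h : (edgeDigraph ends coin).ReachesSet ω {(edgeDigraph ends coin).root}) (e : Fin m) :
    edgeRank ends coin ω ((edgeDigraph ends coin).head (e, earlier ends coin ω e)) <
      edgeRank ends coin ω ((edgeDigraph ends coin).tail (e, earlier ends coin ω e)) := by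
  rw [reachesSet_iff] at h
  have hne : edgeRank ends coin ω (ends e).1 ≠ edgeRank ends coin ω (ends e).2 := fun h' =>
    hE.ne e ((List.idxOf_inj (h _)).1 h')
  by_cases hlt : edgeRank ends coin ω (ends e).1 < edgeRank ends coin ω (ends e).2
  · have : earlier ends coin ω e = true := by simp [earlier, hlt]
    rw [this]
    exact hlt
  · have : earlier ends coin ω e = false := by simp [earlier]; omega
    rw [this]
    exact lt_of_le_of_ne (not_lt.1 hlt) hne.symm

theorem bfsOrder_eq {ω ω' : Fin m × Bool → Bool}
    (h : ∀ e, ω (e, earlier ends coin ω e) = ω' (e, earlier ends coin ω e)) :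
    (edgeDigraph ends coin).bfsOrder arcCode arcRev ω' (2 * m + 1) =
      (edgeDigraph ends coin).bfsOrder arcCode arcRev ω (2 * m + 1) :=
  bfsOrder_congr arcCode_injective head_arcRev tail_arcRev fun a ha => by
    rw [eq_earlier (ends := ends) (coin := coin) ha]
    exact h a.1

/-- If the output is `S`, then `ω` agrees with the symmetric configuration of `S` on all arcs to
earlier vertices. The two then have the same breadth-first order, so these arcs are determined by
`S` alone. The argument works in both directions. -/
theorem reachesSet_and_earlier_iff (S : Fin m → Bool) (ω : Fin m × Bool → Bool) :
    ((edgeDigraph ends coin).ReachesSet ω {(edgeDigraph ends coin).root} ∧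
        (fun e => ω (e, earlier ends coin ω e)) = S) ↔
      (edgeDigraph ends coin).ReachesSet (fun a => S a.1) {(edgeDigraph ends coin).root} ∧
        ∀ e, ω (e, earlier ends coin (fun a => S a.1) e) = S e := by
  have key : ∀ ω ω' : Fin m × Bool → Bool,
      (∀ e, ω (e, earlier ends coin ω e) = ω' (e, earlier ends coin ω e)) →
      (edgeDigraph ends coin).ReachesSet ω {(edgeDigraph ends coin).root} →
      (edgeDigraph ends coin).ReachesSet ω' {(edgeDigraph ends coin).root} ∧
        earlier ends coin ω' = earlier ends coin ω := by
    intro ω ω' h hr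
    have h1 := bfsOrder_eq h
    rw [reachesSet_iff] at hr ⊢
    rw [h1]
    refine ⟨hr, ?_⟩
    have h2 : ∀ v, edgeRank ends coin ω' v = edgeRank ends coin ω v := fun v => by
      rw [edgeRank, edgeRank, h1]
    funext e
    rw [earlier, earlier, decide_eq_decide, h2, h2]
  constructor
  · rintro ⟨h1, h2⟩
    obtain ⟨h3, h4⟩ := key ω (fun a => S a.1) (fun e => congrFun h2 e) h1
    exact ⟨h3, fun e => by rw [h4]; exact congrFun h2 e⟩
  · rintro ⟨h1, h2⟩
    obtain ⟨h3, h4⟩ := key (fun a => S a.1) ω (fun e => (h2 e).symm) h1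
    exact ⟨h3, by ext e; rw [h4]; exact h2 e⟩

/-- The event fixes exactly one arc of each edge. None of these arcs starts at the root, which has
rank zero, so each of them has the law of its edge coin. -/
theorem goodMean_earlier (hE : IsEdgeList G ends) (S : Fin m → Bool) :
    (edgeDigraph ends coin).goodMean
        (fun ω => ind ((fun e => ω (e, earlier ends coin ω e)) = S)) =
      ind ((edgeDigraph ends coin).ReachesSet (fun a => S a.1) {(edgeDigraph ends coin).root}) *
        ∏ e : Fin m, coin e (S e) := by
  have hinj : Function.Injective fun e => (e, earlier ends coin (fun a => S a.1) e) :=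
    fun e e' h => congrArg Prod.fst h
  rw [goodMean_ind (Finset.univ.image fun e => (e, earlier ends coin (fun a => S a.1) e))
    (fun a => S a.1) fun ω => (reachesSet_and_earlier_iff S ω).trans (and_congr_right fun _ => by
      simp only [Finset.mem_image, Finset.mem_univ, true_and, forall_exists_index,
        forall_apply_eq_imp_iff])]
  by_cases h : (edgeDigraph ends coin).ReachesSet (fun a => S a.1) {(edgeDigraph ends coin).root}
  · rw [Finset.prod_image fun e _ e' _ h => hinj h]
    congr 1
    refine Finset.prod_congr rfl fun e _ => coin_edgeDigraph (fun h0 => ?_) _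
    have h1 := hE.earlier_spec h e
    have h2 : edgeRank ends coin (fun a => S a.1) 0 = 0 := idxOf_root (N := edgeDigraph ends coin) arcCode_injective
    rw [h0, h2] at h1
    exact absurd h1 (Nat.not_lt_zero _)
  · rw [ind_false h, zero_mul, zero_mul]

end

namespace CoinDigraph

theorem goodMean_congr {V A : Type*} [Fintype A] {N : CoinDigraph V A}
    {ψ ψ' : (A → Bool) → ENNReal} (h : ∀ ω, N.ReachesSet ω {N.root} → ψ ω = ψ' ω) :
    N.goodMean ψ = N.goodMean ψ' := by
  unfold goodMean
  refine Finset.sum_congr rfl fun ω _ => ?_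
  by_cases hr : N.ReachesSet ω {N.root}
  · rw [h ω hr]
  · rw [ind_false hr, zero_mul, zero_mul]

end CoinDigraph

/-! ### The law of the output and the weights of edge sets. -/

section

open CoinDigraph Program Search

set_option linter.unusedSectionVars false
set_option linter.deprecated false

theorem coinLaw_true {x : ℝ} (h1 : x ≤ 1) : coinLaw x true = ENNReal.ofReal x := by
  have : x.toNNReal ≤ 1 := Real.toNNReal_le_one.2 h1
  simp [coinLaw, PMF.bernoulli, PMF.ofFintype_apply, ENNReal.ofReal, this]

theorem coinLaw_false {x : ℝ} (h0 : 0 ≤ x) (h1 : x ≤ 1) :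
    coinLaw x false = ENNReal.ofReal (1 - x) := by
  have : x.toNNReal ≤ 1 := Real.toNNReal_le_one.2 h1
  simp [coinLaw, PMF.bernoulli, PMF.ofFintype_apply, this, ENNReal.ofReal_sub 1 h0]
  rfl

variable {n m : ℕ} {G : SimpleGraph (Fin n)} {ends : Fin m → Fin n × Fin n}
  {p : Sym2 (Fin n) → ℝ}

theorem IsEdgeList.mem_edgeSet (hE : IsEdgeList G ends) (e : Fin m) :
    listedEdge ends e ∈ G.edgeSet := hE.2 ▸ Set.mem_range_self e

theorem edgeCoin_true (hE : IsEdgeList G ends) (hp : ∀ e ∈ G.edgeSet, 0 < p e ∧ p e < 1)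
    (e : Fin m) : edgeCoin ends p e true = ENNReal.ofReal (1 - p (listedEdge ends e)) := by
  have := hp _ (hE.mem_edgeSet e)
  rw [edgeCoin, dif_pos e.2, coinLaw_true (by linarith)]

theorem edgeCoin_false (hE : IsEdgeList G ends) (hp : ∀ e ∈ G.edgeSet, 0 < p e ∧ p e < 1)
    (e : Fin m) : edgeCoin ends p e false = ENNReal.ofReal (p (listedEdge ends e)) := by
  have := hp _ (hE.mem_edgeSet e)
  rw [edgeCoin, dif_pos e.2, coinLaw_false (by linarith) (by linarith), sub_sub_cancel]

/-- The set of edges marked by `T`. -/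
def markedEdges (ends : Fin m → Fin n × Fin n) (T : Fin m → Bool) : Finset (Sym2 (Fin n)) :=
  (Finset.univ.filter fun e => T e = true).image (listedEdge ends)

theorem IsEdgeList.mem_markedEdges (hE : IsEdgeList G ends) {T : Fin m → Bool} {e : Fin m} :
    listedEdge ends e ∈ markedEdges ends T ↔ T e = true := by
  rw [markedEdges, hE.1.mem_finset_image]
  simp

theorem IsEdgeList.markedEdges_inj (hE : IsEdgeList G ends) {T T' : Fin m → Bool} :
    markedEdges ends T = markedEdges ends T' ↔ T = T' := by
  refine ⟨fun h => ?_, fun h => h ▸ rfl⟩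
  funext e
  rw [Bool.eq_iff_iff, ← hE.mem_markedEdges, h, hE.mem_markedEdges]

theorem IsEdgeList.exists_markedEdges [DecidableRel G.Adj] (hE : IsEdgeList G ends)
    {S : Finset (Sym2 (Fin n))} (hS : S ⊆ G.edgeFinset) : ∃ T, markedEdges ends T = S := by
  refine ⟨fun e => decide (listedEdge ends e ∈ S), ?_⟩
  ext x
  simp only [markedEdges, Finset.mem_image, Finset.mem_filter, Finset.mem_univ, true_and,
    decide_eq_true_eq]
  constructor
  · rintro ⟨e, he, rfl⟩
    exact he
  · intro hx
    have h1 : x ∈ Set.range (listedEdge ends) := hE.2 ▸ (SimpleGraph.mem_edgeFinset.1 (hS hx))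
    obtain ⟨e, rfl⟩ := h1
    exact ⟨e, hx, rfl⟩

theorem IsEdgeList.markedEdges_subset [DecidableRel G.Adj] (hE : IsEdgeList G ends)
    (T : Fin m → Bool) : markedEdges ends T ⊆ G.edgeFinset := by
  intro x hx
  obtain ⟨e, -, rfl⟩ := Finset.mem_image.1 hx
  exact SimpleGraph.mem_edgeFinset.2 (hE.mem_edgeSet e)

theorem IsEdgeList.prod_edgeCoin [DecidableRel G.Adj] (hE : IsEdgeList G ends)
    (hp : ∀ e ∈ G.edgeSet, 0 < p e ∧ p e < 1) (T : Fin m → Bool) :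
    ∏ e : Fin m, edgeCoin ends p e (T e) =
      ENNReal.ofReal (subgraphWeight G p (markedEdges ends T)) := by
  have h1 : ∀ e : Fin m, edgeCoin ends p e (T e) = ENNReal.ofReal
      (if T e = true then 1 - p (listedEdge ends e) else p (listedEdge ends e)) := by
    intro e
    cases T e
    · simp [edgeCoin_false hE hp]
    · simp [edgeCoin_true hE hp]
  have h2 : G.edgeFinset \ markedEdges ends T =
      (Finset.univ.filter fun e => ¬ T e = true).image (listedEdge ends) := by
    ext x
    rw [Finset.mem_sdiff, SimpleGraph.mem_edgeFinset, ← hE.2]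
    constructor
    · rintro ⟨⟨e, rfl⟩, h⟩
      rw [hE.mem_markedEdges] at h
      exact Finset.mem_image_of_mem _ (by simpa using h)
    · intro h
      obtain ⟨e, he, rfl⟩ := Finset.mem_image.1 h
      exact ⟨⟨e, rfl⟩, by rw [hE.mem_markedEdges]; simpa using he⟩
  rw [Finset.prod_congr rfl fun e _ => h1 e, ← ENNReal.ofReal_prod_of_nonneg]
  · rw [Finset.prod_ite, subgraphWeight, h2, markedEdges, Finset.prod_image, Finset.prod_image]
    · exact fun e _ e' _ h => hE.1 h
    · exact fun e _ e' _ h => hE.1 h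
  · intro e _
    have := hp _ (hE.mem_edgeSet e)
    split_ifs <;> linarith

variable [NeZero n] {coin : ℕ → PMF Bool}

theorem IsEdgeList.step_iff (hE : IsEdgeList G ends) (T : Fin m → Bool) (x y : Fin n) :
    (edgeDigraph ends coin).Step (fun a => T a.1) x y ↔
      (SimpleGraph.fromEdgeSet (markedEdges ends T : Set (Sym2 (Fin n)))).Adj x y := by
  rw [SimpleGraph.fromEdgeSet_adj, Finset.mem_coe]
  constructor
  · rintro ⟨⟨e, _ | _⟩, rfl, rfl, he⟩
    · exact ⟨hE.mem_markedEdges.2 he, hE.ne e⟩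
    · refine ⟨?_, (hE.ne e).symm⟩
      rw [Sym2.eq_swap]
      exact hE.mem_markedEdges.2 he
  · rintro ⟨h, -⟩
    obtain ⟨e, he, hxy⟩ := Finset.mem_image.1 h
    have he' : T e = true := by simpa using he
    rcases Sym2.eq_iff.1 hxy with ⟨h1, h2⟩ | ⟨h1, h2⟩
    · exact ⟨(e, false), h1, h2, he'⟩
    · exact ⟨(e, true), h2, h1, he'⟩

/-- With both orientations present or absent together, arcs are adjacency in the marked graph, and
reaching the root from everywhere is connectedness. -/
theorem IsEdgeList.reachesSet_iff_mem [DecidableRel G.Adj] (hE : IsEdgeList G ends)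
    (T : Fin m → Bool) :
    (edgeDigraph ends coin).ReachesSet (fun a => T a.1) {(edgeDigraph ends coin).root} ↔
      markedEdges ends T ∈ connectedSubgraphs G := by
  have h1 : ∀ x y, (edgeDigraph ends coin).Reach (fun a => T a.1) x y ↔
      (SimpleGraph.fromEdgeSet (markedEdges ends T : Set (Sym2 (Fin n)))).Reachable x y := by
    intro x y
    rw [SimpleGraph.reachable_iff_reflTransGen, Reach]
    have : (edgeDigraph ends coin).Step (fun a => T a.1) =
        (SimpleGraph.fromEdgeSet (markedEdges ends T : Set (Sym2 (Fin n)))).Adj := by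
      funext x y
      exact propext (hE.step_iff T x y)
    rw [this]
  rw [connectedSubgraphs, Finset.mem_filter, Finset.mem_powerset,
    and_iff_right (hE.markedEdges_subset T)]
  constructor
  · intro h
    have h2 : ∀ x, (SimpleGraph.fromEdgeSet
        (markedEdges ends T : Set (Sym2 (Fin n)))).Reachable x 0 := by
      intro x
      obtain ⟨y, hy, hr⟩ := h x
      rw [Finset.mem_singleton] at hy
      subst hy
      exact (h1 _ _).1 hr
    have : Nonempty (Fin n) := ⟨0⟩
    exact ⟨fun x y => (h2 x).trans (h2 y).symm⟩
  · intro h x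
    exact ⟨_, Finset.mem_singleton_self _, (h1 _ _).2 (h.preconnected _ _)⟩

theorem goodMean_markedEdges [DecidableRel G.Adj] (hE : IsEdgeList G ends)
    (hp : ∀ e ∈ G.edgeSet, 0 < p e ∧ p e < 1) {S : Finset (Sym2 (Fin n))}
    (hS : S ∈ connectedSubgraphs G) :
    (edgeDigraph ends (edgeCoin ends p)).goodMean (fun ω =>
        ind (markedEdges ends (fun e => ω (e, earlier ends (edgeCoin ends p) ω e)) = S)) =
      ENNReal.ofReal (subgraphWeight G p S) := by
  have hS' := hS
  rw [connectedSubgraphs, Finset.mem_filter, Finset.mem_powerset] at hS'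
  obtain ⟨T, rfl⟩ := hE.exists_markedEdges hS'.1
  simp only [hE.markedEdges_inj]
  rw [goodMean_earlier hE, ind_true ((hE.reachesSet_iff_mem T).2 hS), one_mul,
    hE.prod_edgeCoin hp]

theorem IsEdgeList.markedEdges_mem [DecidableRel G.Adj] (hE : IsEdgeList G ends)
    {ω : Fin m × Bool → Bool}
    (h : (edgeDigraph ends coin).ReachesSet ω {(edgeDigraph ends coin).root}) :
    markedEdges ends (fun e => ω (e, earlier ends coin ω e)) ∈ connectedSubgraphs G := by
  rw [← hE.reachesSet_iff_mem (coin := coin)]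
  exact ((reachesSet_and_earlier_iff _ ω).1 ⟨h, rfl⟩).1

/-- Every good configuration outputs exactly one connected set, so the probabilities of the outputs
add up to that of the good event. -/
theorem reachProb_edgeDigraph [DecidableRel G.Adj] (hE : IsEdgeList G ends)
    (hp : ∀ e ∈ G.edgeSet, 0 < p e ∧ p e < 1) :
    (edgeDigraph ends (edgeCoin ends p)).reachProb {0} =
      ENNReal.ofReal (∑ S ∈ connectedSubgraphs G, subgraphWeight G p S) := by
  have hw : ∀ S ∈ connectedSubgraphs G, 0 ≤ subgraphWeight G p S := by
    intro S hS
    rw [connectedSubgraphs, Finset.mem_filter, Finset.mem_powerset] at hS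
    refine mul_nonneg (Finset.prod_nonneg fun e he => ?_) (Finset.prod_nonneg fun e he => ?_)
    · have := hp e (SimpleGraph.mem_edgeFinset.1 (hS.1 he))
      linarith
    · exact (hp e (SimpleGraph.mem_edgeFinset.1 (Finset.mem_sdiff.1 he).1)).1.le
  rw [ENNReal.ofReal_sum_of_nonneg hw, ← Finset.sum_congr rfl fun S hS =>
    goodMean_markedEdges hE hp hS, ← goodMean_sum]
  refine goodMean_one.symm.trans (goodMean_congr fun ω hω => ?_)
  rw [Finset.sum_eq_single_of_mem _ (hE.markedEdges_mem hω) fun S _ hS => ind_false hS.symm,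
    ind_true rfl]

theorem goodMean_markedEdges_eq_zero [DecidableRel G.Adj] (hE : IsEdgeList G ends)
    {S : Finset (Sym2 (Fin n))} (hS : S ∉ connectedSubgraphs G) :
    (edgeDigraph ends coin).goodMean (fun ω =>
        ind (markedEdges ends (fun e => ω (e, earlier ends coin ω e)) = S)) = 0 := by
  refine (goodMean_congr (ψ' := fun _ => 0) fun ω hω => ind_false fun h => ?_).trans
    (by simp [goodMean])
  exact hS (h ▸ hE.markedEdges_mem hω)

theorem outputEdges_eq (hE : IsEdgeList G ends) {ω : Fin m × Bool → Bool} {c : Config}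
    (h : (edgeDigraph ends coin).ReachesSet ω {0})
    (hc : ∀ a, ((edgeDigraph ends coin).bfsOrder arcCode arcRev ω (2 * m + 1)).idxOf
          ((edgeDigraph ends coin).head a) <
        ((edgeDigraph ends coin).bfsOrder arcCode arcRev ω (2 * m + 1)).idxOf
          ((edgeDigraph ends coin).tail a) → c.arr 2 a.1 = (ω a).toNat) :
    outputEdges ends c = markedEdges ends (fun e => ω (e, earlier ends coin ω e)) := by
  rw [outputEdges, markedEdges]
  congr 1
  refine Finset.filter_congr fun e _ => ?_
  have h1 := hc _ (hE.earlier_spec h e)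
  rw [show c.arr 2 e = _ from h1]
  cases ω (e, earlier ends coin ω e) <;> simp

theorem haltProb_popProgram_le (hG : G.Connected) (hE : IsEdgeList G ends)
    (hpos : ∀ e : Fin m, coin e true ≠ 0) (ρ : ENNReal)
    (hρ : ∀ e : Fin m, coin e false ≤ ρ * coin e true) (Q : Finset (Sym2 (Fin n)) → Prop) :
    popProgram.haltProb coin (inputConfig ends) (fun c => Q (outputEdges ends c)) ≤
      (edgeDigraph ends coin).goodMean (fun ω =>
        ind (Q (markedEdges ends (fun e => ω (e, earlier ends coin ω e))))) /
          (edgeDigraph ends coin).reachProb {0} := by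
  refine haltProb_le _ _ fun T => ?_
  refine (reward_popProgram_le hG hE hpos ρ hρ (τ := 0) ENNReal.zero_ne_top
    (ψ := fun ω => ind (Q (markedEdges ends (fun e => ω (e, earlier ends coin ω e)))))
    (fun ω => ?_) (fun ω c h hc => ?_) T).trans ?_
  · unfold ind
    split_ifs <;> simp
  · rw [outputEdges_eq hE h hc]
  · simp

/-- The upper bounds for `Q` and for its negation add up to one. So do the halting probabilities, at
least, because the expected time is finite; hence both upper bounds are attained. -/
theorem haltProb_popProgram (hG : G.Connected) (hE : IsEdgeList G ends)
    (hpos : ∀ e : Fin m, coin e true ≠ 0) (ρ : ENNReal)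
    (hρ : ∀ e : Fin m, coin e false ≤ ρ * coin e true)
    (hT : popProgram.expectedTime coin (inputConfig ends) ≠ ⊤)
    (Q : Finset (Sym2 (Fin n)) → Prop) :
    popProgram.haltProb coin (inputConfig ends) (fun c => Q (outputEdges ends c)) =
      (edgeDigraph ends coin).goodMean (fun ω =>
        ind (Q (markedEdges ends (fun e => ω (e, earlier ends coin ω e))))) /
          (edgeDigraph ends coin).reachProb {0} := by
  refine le_antisymm (haltProb_popProgram_le hG hE hpos ρ hρ Q) ?_
  have h1 := haltProb_popProgram_le hG hE hpos ρ hρ fun S => ¬ Q S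
  have h2 := one_le_haltProb_add (fun c => Q (outputEdges ends c)) hT
  have h3 := goodMean_ind_add (N := edgeDigraph ends coin)
    fun ω => Q (markedEdges ends (fun e => ω (e, earlier ends coin ω e)))
  have hq : (edgeDigraph ends coin).reachProb {0} ≠ 0 :=
    (bidirected_edgeDigraph hG hE hpos).reachProb_ne_zero _ (by simp [edgeDigraph])
  have hq' : (edgeDigraph ends coin).reachProb {0} ≠ ⊤ :=
    ((reachProb_le_one _).trans_lt ENNReal.one_lt_top).ne
  have h4 := ENNReal.div_self hq hq'
  rw [← show _ = (edgeDigraph ends coin).reachProb {0} from h3] at h4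
  nth_rewrite 1 [ENNReal.add_div] at h4
  rw [show _ = (edgeDigraph ends coin).reachProb {0} from h3] at h4
  rw [← h4] at h2
  have h5 := h2.trans (add_le_add_right h1 _)
  refine (ENNReal.add_le_add_iff_right ?_).1 h5
  refine (ENNReal.div_lt_top ?_ hq).ne
  refine ne_top_of_le_ne_top hq' ?_
  rw [← show _ = (edgeDigraph ends coin).reachProb {0} from h3]
  exact le_add_self

theorem expectedTime_popProgram_le (hG : G.Connected) (hE : IsEdgeList G ends)
    (hpos : ∀ e : Fin m, coin e true ≠ 0) (ρ : ENNReal)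
    (hρ : ∀ e : Fin m, coin e false ≤ ρ * coin e true) :
    popProgram.expectedTime coin (inputConfig ends) ≤
      ((500 * m + 120 * n + 10 : ℕ) : ENNReal) + 400 * m * n * ρ := by
  refine expectedTime_le _ fun T => ?_
  refine (reward_popProgram_le hG hE hpos ρ hρ (τ := 1) ENNReal.one_ne_top (r := 0)
    (ψ := fun _ => 0) (fun _ => ENNReal.zero_ne_top) (fun _ _ _ _ => le_rfl) T).trans ?_
  simp [goodMean]

end

theorem corollary3p6 :
    ∃ (prog : Program) (C : ℝ),
      ∀ (n m : ℕ) (G : SimpleGraph (Fin n)) [DecidableRel G.Adj]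
        (ends : Fin m → Fin n × Fin n) (p : Sym2 (Fin n) → ℝ) (pmax : ℝ),
        G.Connected →
        IsEdgeList G ends →
        (∀ e ∈ G.edgeSet, 0 < p e ∧ p e < 1) →
        IsGreatest (p '' G.edgeSet) pmax →
        (∀ S : Finset (Sym2 (Fin n)),
          prog.haltProb (edgeCoin ends p) (inputConfig ends) (fun c => outputEdges ends c = S) =
            ENNReal.ofReal (connectedSubgraphLaw G p S)) ∧
        prog.expectedTime (edgeCoin ends p) (inputConfig ends) ≤
          ENNReal.ofReal (C * (m + pmax * m * n / (1 - pmax))) := by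
  refine ⟨popProgram, 800, fun n m G _ ends p pmax hG hE hp hmax => ?_⟩
  have hn : n ≠ 0 := by
    obtain ⟨v⟩ := hG.nonempty
    exact (Nat.zero_lt_of_lt v.2).ne'
  have : NeZero n := ⟨hn⟩
  obtain ⟨⟨x, hx, hpx⟩, hle⟩ := hmax
  have hmax0 : 0 < pmax := hpx ▸ (hp x hx).1
  have hmax1 : pmax < 1 := hpx ▸ (hp x hx).2
  have hm : 1 ≤ m := by
    obtain ⟨e, -⟩ : x ∈ Set.range (listedEdge ends) := hE.2 ▸ hx
    exact Nat.one_le_of_lt e.2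
  have hnm : n ≤ m + 1 := by
    have := hG.card_vert_le_card_edgeSet_add_one
    rwa [hE.card_eq, Nat.card_fin] at this
  have hpos : ∀ e : Fin m, edgeCoin ends p e true ≠ 0 := by
    intro e
    have := hp _ (hE.mem_edgeSet e)
    rw [edgeCoin_true hE hp]
    exact (ENNReal.ofReal_pos.2 (by linarith)).ne'
  -- The odds `p e / (1 - p e)` increase with `p e`, so those of `pmax` dominate.
  have hρ : ∀ e : Fin m, edgeCoin ends p e false ≤
      ENNReal.ofReal (pmax / (1 - pmax)) * edgeCoin ends p e true := by
    intro e
    have h1 := hp _ (hE.mem_edgeSet e)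
    have h2 : p (listedEdge ends e) ≤ pmax := hle ⟨_, hE.mem_edgeSet e, rfl⟩
    rw [edgeCoin_true hE hp, edgeCoin_false hE hp, ← ENNReal.ofReal_mul
      (div_nonneg hmax0.le (by linarith))]
    refine ENNReal.ofReal_le_ofReal ?_
    rw [div_mul_eq_mul_div, le_div_iff₀ (by linarith)]
    nlinarith
  have htime : popProgram.expectedTime (edgeCoin ends p) (inputConfig ends) ≤
      ENNReal.ofReal (800 * (m + pmax * m * n / (1 - pmax))) := by
    refine (expectedTime_popProgram_le hG hE hpos _ hρ).trans ?_
    have hρ0 : 0 ≤ pmax / (1 - pmax) := div_nonneg hmax0.le (by linarith)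
    have h1 : ((500 * m + 120 * n + 10 : ℕ) : ENNReal) +
        400 * m * n * ENNReal.ofReal (pmax / (1 - pmax)) =
        ENNReal.ofReal (((500 * m + 120 * n + 10 : ℕ) : ℝ) + 400 * m * n * (pmax / (1 - pmax))) := by
      rw [ENNReal.ofReal_add (by positivity) (by positivity), ENNReal.ofReal_natCast,
        ENNReal.ofReal_mul (by positivity), ENNReal.ofReal_mul (by positivity),
        ENNReal.ofReal_mul (by positivity), ENNReal.ofReal_natCast, ENNReal.ofReal_natCast]
      simp
    rw [h1]
    refine ENNReal.ofReal_le_ofReal ?_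
    -- Connectedness gives `n ≤ m + 1`, and `1 ≤ m` absorbs the constants: the left side is at most
    -- `750 * m`. This is the larger of the two demands on the constant 800.
    have h2 : ((500 * m + 120 * n + 10 : ℕ) : ℝ) ≤ 800 * m := by
      exact_mod_cast (by omega : 500 * m + 120 * n + 10 ≤ 800 * m)
    have h3 : 0 ≤ (m : ℝ) * n * (pmax / (1 - pmax)) := by positivity
    have h4 : pmax * m * n / (1 - pmax) = m * n * (pmax / (1 - pmax)) := by ring
    rw [h4]
    linarith
  refine ⟨fun S => ?_, htime⟩
  rw [haltProb_popProgram hG hE hpos _ hρ (ne_top_of_le_ne_top ENNReal.ofReal_ne_top htime)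
    fun S' => S' = S, reachProb_edgeDigraph hE hp, connectedSubgraphLaw]
  split_ifs with hS
  · rw [goodMean_markedEdges hE hp hS, ENNReal.ofReal_div_of_pos]
    rw [← ENNReal.ofReal_pos, ← reachProb_edgeDigraph hE hp]
    exact pos_iff_ne_zero.2 ((bidirected_edgeDigraph hG hE hpos).reachProb_ne_zero _
      (by simp [edgeDigraph]))
  · rw [goodMean_markedEdges_eq_zero hE hS]
    simp
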